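/- Let $d\in\{2,3\}$, let $A>0$, $\gamma>1$, $\bar\rho>0$, $\mu>0$, $\lambda\ge 0$ be constants with either (Case 3) $\lambda=1$, $\mu\le 1$, $d=2$, or (Case 4) $\lambda>1$, $d\in\{2,3\}$. Let $M>0$ and let $\rho_0\in C_0^\infty(\mathbb R^d)$, $u_0=(u_{1,0},\dots,u_{d,0})\in C_0^\infty(\mathbb R^d;\mathbb R^d)$ be supported in $\{|x|\le M\}$. For $\varepsilon>0$ consider the compressible Euler equations with damping $$\partial_t\rho+\operatorname{div}(\rho u)=0,\qquad \partial_t(\rho u)+\operatorname{div}(\rho u\otimes u+p(\rho)\,\mathrm I_d)=-\frac{\mu}{(1+t)^\lambda}\,\rho u,\qquad p(\rho)=A\rho^\gamma,$$ $$\rho(0,x)=\bar\rho+\varepsilon\rho_0(x),\qquad u(0,x)=\varepsilon u_0(x),$$ and let the lifespan $T_\varepsilon\in[0,\infty]$ be the supremum of all $T>0$ for which there is a solution $(\rho,u)\in C^\infty([0,T)\times\mathbb R^d)$ with $\rho>0$. Put $$q_0(l)=\int_{x_1>l}(x_1-l)^2(\rho(0,x)-\bar\rho)\,dx,\qquad q_1(l)=2\int_{x_1>l}(x_1-l)(\rho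 u_1)(0,x)\,dx .$$ Let $a,b\in\mathbb C$ satisfy $a+b=1$ and $ab=\frac{\mu\lambda}{2}$ if $\lambda>1$, $ab=\frac\mu2\left(1-\frac\mu2\right)$ if $\lambda=1$; let $\Psi(a,b,c;z)=\sum_{n\ge0}\frac{(a)_n(b)_n}{n!\,(c)_n}z^n$, where $(a)_0=1$ and $(a)_n=a(a+1)\cdots(a+n-1)$, and let $\delta_0\in(0,1)$ be such that $\frac12\le\Psi(a,b,1;z)\le\frac32$ and $\frac12\le\Psi(a+1,b+1,2;z)\le\frac32$ for $-\frac{\delta_0}2\le z\le0$ (such a $\delta_0$ exists). Let $0\le\tilde M<M$, $\max\{\tilde M,M-\delta_0\}\le M_0<M$ and $\Lambda\ge 3ab$. Then there are constants $\varepsilon_0>0$ and $C>0$, independent of $\varepsilon$, such that for every $0<\varepsilon\le\varepsilon_0$ for which $$q_0(l)>0,\quad q_1(l)\ge0\quad\text{for all } l\in(\tilde M,M),\qquad q_1(l)\ge\Lambda q_0(l)\quad\text{for all } l\in(M_0,M),$$ the lifespan is finite, $T_\varepsilon<\infty$; and if moreover $\gamma=2$, then $T_\varepsilon\le e^{C/\varepsilon^2}$.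 -/

import Mathlib

open scoped ContDiff

noncomputable section

namespace DampedEuler

/-- The Euclidean space `ℝ^d`. -/
abbrev Space (d : ℕ) : Type := EuclideanSpace ℝ (Fin d)

/-- The partial derivative `∂_i f (x)` of a scalar function on `ℝ^d`. -/
def pderiv {d : ℕ} (i : Fin d) (f : Space d → ℝ) (x : Space d) : ℝ :=
  fderiv ℝ f x (EuclideanSpace.single i (1 : ℝ))

/-- The constants of the problem: the pressure law `p(ρ) = A ρ ^ γ`, the background density
`ρ̄` and the damping coefficient `α(t) = μ / (1 + t) ^ λ`. -/
structure Params where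
  A : ℝ
  γ : ℝ
  rhoBar : ℝ
  mu : ℝ
  lam : ℝ
  A_pos : 0 < A
  one_lt_γ : 1 < γ
  rhoBar_pos : 0 < rhoBar
  mu_pos : 0 < mu
  lam_nonneg : 0 ≤ lam

/-- The pressure `p(ρ) = A ρ ^ γ`. -/
def Params.pressure (P : Params) (r : ℝ) : ℝ := P.A * r ^ P.γ

/-- The frictional coefficient `α(t) = μ / (1 + t) ^ λ`. -/
def Params.damping (P : Params) (t : ℝ) : ℝ := P.mu / (1 + t) ^ P.lam

/-- The initial density `ρ(0, x) = ρ̄ + ε ρ₀(x)`. -/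
def initDensity {d : ℕ} (P : Params) (ε : ℝ) (ρ₀ : Space d → ℝ) (x : Space d) : ℝ :=
  P.rhoBar + ε * ρ₀ x

/-- The initial velocity `u(0, x) = ε u₀(x)`. -/
def initVelocity {d : ℕ} (ε : ℝ) (u₀ : Space d → Space d) (x : Space d) : Space d :=
  ε • u₀ x

/-- `(ρ, u)` is a `C^∞` solution on `[0, T) × ℝ^d`, with positive density, of the compressible
Euler equations with time-dependent damping and initial data `(ρ̄ + ε ρ₀, ε u₀)`.
As `(ρ, u)` is smooth up to `t = 0`, the equations extend to `t = 0` by continuity. -/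
structure IsSmoothSolution {d : ℕ} (P : Params) (ε : ℝ) (ρ₀ : Space d → ℝ)
    (u₀ : Space d → Space d) (T : ℝ) (ρ : ℝ → Space d → ℝ) (u : ℝ → Space d → Space d) :
    Prop where
  smooth_density :
    ContDiffOn ℝ ∞ (fun z : ℝ × Space d => ρ z.1 z.2) (Set.Ico 0 T ×ˢ Set.univ)
  smooth_velocity :
    ContDiffOn ℝ ∞ (fun z : ℝ × Space d => u z.1 z.2) (Set.Ico 0 T ×ˢ Set.univ)
  density_pos : ∀ t ∈ Set.Ico 0 T, ∀ x, 0 < ρ t x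
  mass : ∀ t ∈ Set.Ioo 0 T, ∀ x,
    deriv (fun s => ρ s x) t + (∑ j, pderiv j (fun y => ρ t y * u t y j) x) = 0
  momentum : ∀ t ∈ Set.Ioo 0 T, ∀ x, ∀ i,
    deriv (fun s => ρ s x * u s x i) t
        + (∑ j, pderiv j (fun y => ρ t y * u t y i * u t y j) x)
        + pderiv i (fun y => P.pressure (ρ t y)) x
      = -(P.damping t * (ρ t x * u t x i))
  init_density : ∀ x, ρ 0 x = initDensity P ε ρ₀ x
  init_velocity : ∀ x, u 0 x = initVelocity ε u₀ x

/-- The lifespan `T_ε ∈ [0, ∞]`: the supremum of all `T > 0` such that a smooth solution exists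
on `[0, T) × ℝ^d`. -/
def lifespan {d : ℕ} (P : Params) (ε : ℝ) (ρ₀ : Space d → ℝ) (u₀ : Space d → Space d) : ENNReal :=
  sSup {τ : ENNReal | ∃ T : ℝ, 0 < T ∧ τ = ENNReal.ofReal T ∧
    ∃ (ρ : ℝ → Space d → ℝ) (u : ℝ → Space d → Space d), IsSmoothSolution P ε ρ₀ u₀ T ρ u}

/-- `q₀(l) = ∫_{x₁ > l} (x₁ - l)² (ρ(0,x) - ρ̄) dx`; the coordinate `x₁` is `x 0`. -/
def q0 {d : ℕ} [NeZero d] (P : Params) (ε : ℝ) (ρ₀ : Space d → ℝ) (l : ℝ) : ℝ :=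
  ∫ x in {x : Space d | l < x 0}, (x 0 - l) ^ 2 * (initDensity P ε ρ₀ x - P.rhoBar)

/-- `q₁(l) = 2 ∫_{x₁ > l} (x₁ - l) (ρ u₁)(0,x) dx`. -/
def q1 {d : ℕ} [NeZero d] (P : Params) (ε : ℝ) (ρ₀ : Space d → ℝ) (u₀ : Space d → Space d)
    (l : ℝ) : ℝ :=
  2 * ∫ x in {x : Space d | l < x 0},
    (x 0 - l) * (initDensity P ε ρ₀ x * initVelocity ε u₀ x 0)

/-- The value of the product `ab` : `μ/2 (1 - μ/2)` if `λ = 1`, and `μλ/2` if `λ > 1`. -/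
def Params.ab (P : Params) : ℝ :=
  if P.lam = 1 then P.mu / 2 * (1 - P.mu / 2) else P.mu * P.lam / 2

/-- The hypergeometric function `Ψ(a, b, c; z) = ∑ (a)_n (b)_n / (n! (c)_n) z^n` of a real
variable `z` (`|z| < 1`). The parameters `a`, `b` may be complex; where the function is used,
they are either real or conjugate to each other, so that the sum is real and the real part taken
here changes nothing. -/
def Psi (a b : ℂ) (c z : ℝ) : ℝ := (ordinaryHypergeometric a b (c : ℂ) (z : ℂ)).re

/-- `δ ∈ (0, 1)` is such that `1/2 ≤ Ψ(a,b,1;z), Ψ(a+1,b+1,2;z) ≤ 3/2` for `-δ/2 ≤ z ≤ 0`, where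
`a + b = 1` and `ab` is as above. (The pair `a, b` is determined up to order.) -/
def Params.IsDelta (P : Params) (δ : ℝ) : Prop :=
  0 < δ ∧ δ < 1 ∧ ∀ a b : ℂ, a + b = 1 → a * b = (P.ab : ℂ) → ∀ z ∈ Set.Icc (-(δ / 2)) 0,
    Psi a b 1 z ∈ Set.Icc (1 / 2 : ℝ) (3 / 2) ∧
      Psi (a + 1) (b + 1) 2 z ∈ Set.Icc (1 / 2 : ℝ) (3 / 2)

/-- The hypergeometric series has a positive radius of convergence. -/
theorem radius_pos (a b c : ℂ) : 0 < (ordinaryHypergeometricSeries ℂ a b c).radius := by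
  by_cases h : ∀ kn : ℕ, (kn : ℂ) ≠ -a ∧ (kn : ℂ) ≠ -b ∧ (kn : ℂ) ≠ -c
  · rw [ordinaryHypergeometricSeries_radius_eq_one _ a b c h]; simp
  · push Not at h
    obtain ⟨k, hk⟩ := h
    by_cases h1 : (k : ℂ) = -a
    · rw [show a = -(k:ℂ) by rw [h1]; ring, ordinaryHypergeometric_radius_top_of_neg_nat₁]; simp
    by_cases h2 : (k : ℂ) = -b
    · rw [show b = -(k:ℂ) by rw [h2]; ring, ordinaryHypergeometric_radius_top_of_neg_nat₂]; simp
    have h3 := hk h1 h2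
    rw [show c = -(k:ℂ) by rw [h3]; ring, ordinaryHypergeometric_radius_top_of_neg_nat₃]; simp

/-- `Ψ` is close to `Ψ(a, b, c; 0) = 1` near `z = 0`. -/
theorem psi_event (a b : ℂ) (c : ℝ) :
    ∀ᶠ z in nhds (0:ℝ), Psi a b c z ∈ Set.Icc (1 / 2 : ℝ) (3 / 2) := by
  have h := ((ordinaryHypergeometricSeries ℂ a b (c:ℂ)).hasFPowerSeriesOnBall
    (radius_pos a b c)).continuousOn.continuousAt (by
      simpa using Metric.eball_mem_nhds (0:ℂ) (radius_pos a b c))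
  have h2 : ContinuousAt (Psi a b c) 0 := by
    unfold Psi
    refine Complex.continuous_re.continuousAt.comp ?_
    refine ContinuousAt.comp (f := fun z : ℝ => (z:ℂ)) ?_ Complex.continuous_ofReal.continuousAt
    simpa using h
  have h3 : Psi a b c 0 = 1 := by simp [Psi]
  refine h2.eventually_mem ?_
  rw [h3]; exact Icc_mem_nhds (by norm_num) (by norm_num)

/-- A number `δ` as above exists. -/
theorem exists_isDelta (P : Params) : ∃ δ, P.IsDelta δ := by
  obtain ⟨r, hr⟩ := IsAlgClosed.exists_pow_nat_eq (1 - 4 * (P.ab : ℂ)) (n := 2) (by norm_num)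
  set a₀ := (1 + r) / 2
  set b₀ := (1 - r) / 2
  have hs : a₀ + b₀ = 1 := by simp [a₀, b₀]; ring
  have hp : a₀ * b₀ = P.ab := by
    have : a₀ * b₀ = (1 - r^2)/4 := by simp [a₀, b₀]; ring
    rw [this, hr]; ring
  have e := ((psi_event a₀ b₀ 1).and (psi_event (a₀+1) (b₀+1) 2)).and
    ((psi_event b₀ a₀ 1).and (psi_event (b₀+1) (a₀+1) 2))
  obtain ⟨η, hη, H⟩ := Metric.eventually_nhds_iff.1 e
  refine ⟨min η (1/2), by positivity, by simp; norm_num, ?_⟩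
  intro a b h1 h2 z hz
  have hzd : dist z 0 < η := by
    rw [Real.dist_eq, sub_zero, abs_of_nonpos hz.2]
    have := hz.1
    have := min_le_left η (1/2)
    linarith
  have : (a - a₀) * (a - b₀) = 0 := by
    linear_combination a * h1 - h2 - a * hs + hp
  rcases mul_eq_zero.1 this with h | h
  · have ha : a = a₀ := sub_eq_zero.1 h
    have hb : b = b₀ := by linear_combination h1 - hs - ha
    subst ha; rw [hb]; exact (H hzd).1
  · have ha : a = b₀ := sub_eq_zero.1 h
    have hb : b = a₀ := by linear_combination h1 - hs - ha
    rw [ha, hb]; exact (H hzd).2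

end DampedEuler

end

/-! The proof follows Sideris: the flow is tested against the weight (x₁ - l)₊². Put P(t,l) = ∫ (x₁
- l)₊² (ρ - ρ̄) dx and let c be the sound speed of the background. Mass and momentum conservation
yield the one-dimensional damped wave equation P_tt - c² P_ll + α P_t = G, with G = 2 ∫_{x₁>l} (ρ
u₁² + excess). The excess is the pressure minus its tangent at ρ̄, so G ≥ 0 by convexity. With E =
exp(½∫α), the product v = E P solves v_tt - c² v_ll + V v = E G, where V = -α'/2 - α²/4 decays like
(1+t)⁻². This is derived as two transport equations, one for each family of characteristics
(`hasDerivAt_weight_mul_momP`, `hasDerivAt_momY`), and integrated to a d'Alembert formula in the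
coordinates (t, ξ), ξ = l - ct (`charV_eq`).

Perturbations travel no faster than c (`eq_background`), so v = 0 for ξ ≥ M. In the strip M - 2cD <
ξ < M a backward triangle therefore meets the support of v only in a layer of width D, however large
t is. For small D the potential is a perturbation, uniformly in time. The part of its contribution
that is not small is paid for by the initial momentum, q₁ ≥ 3ab q₀. This gives v ≥ ½ q₀ + ½ (cone
integral of E G) (`strip_lower_bound`).

Conversely G is bounded below in terms of P. In the strip the mass excess sits in a cap of height at
most 1 of a ball of radius M + ct, whose volume is O((1+t)^((d-1)/2)). A Hölder-type splitting turns
this into E G ≥ k (1+t)⁻¹ min(v², v^p), p = min(γ, 2); the two cases on λ, μ, d are those in which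
the volume times E is O(1+t) (`exists_weight_bound`, `momG_ge`, `exists_charG_ge`).

Since ∫ dt/(1+t) diverges, iterating the two inequalities on shrinking strips forces v to become
infinite before a finite time exp(O(ℓ)) (`blowup_time_lt`), where ℓ is of order 1/ε when γ = 2.

Finite speed of propagation comes from the relative entropy in backward cones of slope C > c. Near
the background the entropy flux is at most C times the entropy, and a continuity induction keeps the
state at the background (`eq_background_of_cone`). -/

noncomputable section
namespace DampedEuler

/-! ### Characteristic triangles and the wave equation with a small potential. -/

/-- The integral of `h` over the backward characteristic triangle with apex `(t, ξ)`, in the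
coordinates `(τ, ξ)` with `ξ = l - c τ`. -/
def coneIntegral (c : ℝ) (h : ℝ → ℝ → ℝ) (t ξ : ℝ) : ℝ :=
  ∫ σ in (0:ℝ)..t, ∫ τ in (0:ℝ)..(t - σ), h τ (ξ + 2 * c * σ)

theorem continuous_inner {h : ℝ → ℝ → ℝ} (hh : Continuous (Function.uncurry h)) (c t ξ : ℝ) :
    Continuous fun σ : ℝ => ∫ τ in (0:ℝ)..(t - σ), h τ (ξ + 2 * c * σ) := by
  have : Continuous (Function.uncurry fun σ τ : ℝ => h τ (ξ + 2 * c * σ)) :=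
    hh.comp (by fun_prop : Continuous fun z : ℝ × ℝ => (z.2, ξ + 2 * c * z.1))
  exact intervalIntegral.continuous_parametric_intervalIntegral_of_continuous this
    (by fun_prop)

theorem continuous_slice {h : ℝ → ℝ → ℝ} (hh : Continuous (Function.uncurry h)) (η : ℝ) :
    Continuous fun τ : ℝ => h τ η :=
  hh.comp (by fun_prop : Continuous fun z : ℝ => (z, η))

theorem coneIntegral_sub {h₁ h₂ : ℝ → ℝ → ℝ} (hh₁ : Continuous (Function.uncurry h₁))
    (hh₂ : Continuous (Function.uncurry h₂)) (c t ξ : ℝ) :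
    coneIntegral c (fun τ η => h₁ τ η - h₂ τ η) t ξ
      = coneIntegral c h₁ t ξ - coneIntegral c h₂ t ξ := by
  unfold coneIntegral
  rw [← intervalIntegral.integral_sub ((continuous_inner hh₁ c t ξ).intervalIntegrable _ _)
    ((continuous_inner hh₂ c t ξ).intervalIntegrable _ _)]
  refine intervalIntegral.integral_congr fun σ _ => ?_
  exact intervalIntegral.integral_sub ((continuous_slice hh₁ _).intervalIntegrable _ _)
    ((continuous_slice hh₂ _).intervalIntegrable _ _)

theorem coneIntegral_add {h₁ h₂ : ℝ → ℝ → ℝ} (hh₁ : Continuous (Function.uncurry h₁))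
    (hh₂ : Continuous (Function.uncurry h₂)) (c t ξ : ℝ) :
    coneIntegral c (fun τ η => h₁ τ η + h₂ τ η) t ξ
      = coneIntegral c h₁ t ξ + coneIntegral c h₂ t ξ := by
  unfold coneIntegral
  rw [← intervalIntegral.integral_add ((continuous_inner hh₁ c t ξ).intervalIntegrable _ _)
    ((continuous_inner hh₂ c t ξ).intervalIntegrable _ _)]
  refine intervalIntegral.integral_congr fun σ _ => ?_
  exact intervalIntegral.integral_add ((continuous_slice hh₁ _).intervalIntegrable _ _)
    ((continuous_slice hh₂ _).intervalIntegrable _ _)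

/-- The base of the triangle with apex `(s, ξ + 2ca)` is part of the base of the triangle with apex
`(t, ξ)` as soon as `s + a ≤ t`; nonnegativity does the rest. -/
theorem integral_shift_le {w : ℝ → ℝ} (hw : Continuous w) {c ξ t a s : ℝ} (hs : 0 ≤ s)
    (ha : 0 ≤ a) (hst : s + a ≤ t) (hpos : ∀ σ ∈ Set.Icc 0 t, 0 ≤ w (ξ + 2 * c * σ)) :
    ∫ σ in (0:ℝ)..s, w (ξ + 2 * c * a + 2 * c * σ) ≤ ∫ σ in (0:ℝ)..t, w (ξ + 2 * c * σ) := by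
  have h1 : ∫ σ in (0:ℝ)..s, w (ξ + 2 * c * a + 2 * c * σ)
      = ∫ σ in (0 + a)..(s + a), w (ξ + 2 * c * σ) := by
    rw [← intervalIntegral.integral_comp_add_right (fun σ => w (ξ + 2 * c * σ))]
    refine intervalIntegral.integral_congr fun σ _ => ?_
    congr 1; ring
  rw [h1]
  refine intervalIntegral.integral_mono_interval (by linarith) (by linarith) hst ?_
    (Continuous.intervalIntegrable (by fun_prop) _ _)
  refine (MeasureTheory.ae_restrict_iff' measurableSet_Ioc).2 (Filter.Eventually.of_forall ?_)
  intro σ hσ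
  exact hpos σ ⟨hσ.1.le, hσ.2⟩

/-- For `s + a ≤ t` the first triangle is contained in the second, and the integrand is nonnegative
on the times involved. After shifting `σ` by `a`, the inner and then the outer domain are enlarged.
-/
theorem coneIntegral_mono {H : ℝ → ℝ → ℝ} (hH : Continuous (Function.uncurry H))
    {c ξ t a s T : ℝ} (hs : 0 ≤ s) (ha : 0 ≤ a) (hst : s + a ≤ t) (htT : t ≤ T)
    (hpos : ∀ τ ∈ Set.Icc 0 T, ∀ η, 0 ≤ H τ η) :
    coneIntegral c H s (ξ + 2 * c * a) ≤ coneIntegral c H t ξ := by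
  have h1 : coneIntegral c H s (ξ + 2 * c * a)
      = ∫ σ in (0 + a)..(s + a), ∫ τ in (0:ℝ)..(s + a - σ), H τ (ξ + 2 * c * σ) := by
    rw [← intervalIntegral.integral_comp_add_right
      (fun σ => ∫ τ in (0:ℝ)..(s + a - σ), H τ (ξ + 2 * c * σ))]
    refine intervalIntegral.integral_congr fun σ _ => ?_
    rw [show s + a - (σ + a) = s - σ by ring, show ξ + 2 * c * a + 2 * c * σ
      = ξ + 2 * c * (σ + a) by ring]
  have hin : ∀ u v η : ℝ, 0 ≤ u → u ≤ v → v ≤ T →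
      ∫ τ in (0:ℝ)..u, H τ η ≤ ∫ τ in (0:ℝ)..v, H τ η := by
    intro u v η hu huv hv
    refine intervalIntegral.integral_mono_interval le_rfl hu huv ?_
      ((continuous_slice hH η).intervalIntegrable _ _)
    refine (MeasureTheory.ae_restrict_iff' measurableSet_Ioc).2 (Filter.Eventually.of_forall ?_)
    intro σ hσ
    exact hpos σ ⟨hσ.1.le, hσ.2.trans hv⟩ η
  rw [h1]
  calc _ ≤ ∫ σ in (0 + a)..(s + a), ∫ τ in (0:ℝ)..(t - σ), H τ (ξ + 2 * c * σ) := by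
        refine intervalIntegral.integral_mono_on (by linarith)
          ((continuous_inner hH c (s + a) ξ).intervalIntegrable _ _)
          ((continuous_inner hH c t ξ).intervalIntegrable _ _) ?_
        intro σ hσ
        exact hin _ _ _ (by linarith [hσ.2]) (by linarith) (by linarith [hσ.1])
    _ ≤ _ := by
        refine intervalIntegral.integral_mono_interval (by linarith) (by linarith) hst ?_
          ((continuous_inner hH c t ξ).intervalIntegrable _ _)
        refine (MeasureTheory.ae_restrict_iff' measurableSet_Ioc).2
          (Filter.Eventually.of_forall ?_)
        intro σ hσ
        refine intervalIntegral.integral_nonneg (by linarith [hσ.2]) ?_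
        intro τ hτ
        exact hpos τ ⟨hτ.1, by linarith [hσ.1, hτ.2]⟩ _

/-- The integral of a function bounded by `b` and vanishing beyond `D`. -/
theorem abs_integral_le_of_eq_zero {φ : ℝ → ℝ} (hφ : Continuous φ) {s D b : ℝ} (hs : 0 ≤ s)
    (hD : 0 ≤ D) (hb : 0 ≤ b) (h0 : ∀ σ ∈ Set.Icc 0 s, D ≤ σ → φ σ = 0)
    (hle : ∀ σ ∈ Set.Icc 0 s, |φ σ| ≤ b) : |∫ σ in (0:ℝ)..s, φ σ| ≤ b * D := by
  have key : ∀ u, 0 ≤ u → u ≤ s → |∫ σ in (0:ℝ)..u, φ σ| ≤ b * u := by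
    intro u hu hus
    have := intervalIntegral.norm_integral_le_of_norm_le_const (a := 0) (b := u) (C := b) (f := φ) ?_
    · simpa [abs_of_nonneg hu] using this
    · intro σ hσ
      rw [Set.uIoc_of_le hu] at hσ
      exact hle σ ⟨hσ.1.le, hσ.2.trans hus⟩
  rcases le_total s D with h | h
  · exact (key s hs le_rfl).trans (by gcongr)
  · rw [← intervalIntegral.integral_add_adjacent_intervals (b := D) (hφ.intervalIntegrable _ _)
      (hφ.intervalIntegrable _ _)]
    have : ∫ σ in D..s, φ σ = 0 := by
      rw [intervalIntegral.integral_congr (g := fun _ => 0)]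
      · simp
      · intro σ hσ
        rw [Set.uIcc_of_le h] at hσ
        exact h0 σ ⟨hD.trans hσ.1, hσ.2⟩ hσ.1
    rw [this, add_zero]
    exact key D hD h

theorem abs_integral_mul_le {V g : ℝ → ℝ} (hV : Continuous V) (hg : Continuous g) {s B K : ℝ}
    (hs : 0 ≤ s) (hB : 0 ≤ B) (hK : ∫ τ in (0:ℝ)..s, |V τ| ≤ K)
    (hle : ∀ τ ∈ Set.Icc 0 s, |g τ| ≤ B) : |∫ τ in (0:ℝ)..s, V τ * g τ| ≤ K * B := by
  calc |∫ τ in (0:ℝ)..s, V τ * g τ| ≤ ∫ τ in (0:ℝ)..s, |V τ * g τ| :=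
        intervalIntegral.abs_integral_le_integral_abs hs
    _ ≤ ∫ τ in (0:ℝ)..s, |V τ| * B := by
        refine intervalIntegral.integral_mono_on hs
          (Continuous.intervalIntegrable (by fun_prop) _ _)
          (Continuous.intervalIntegrable (by fun_prop) _ _) ?_
        intro τ hτ
        rw [abs_mul]
        exact mul_le_mul_of_nonneg_left (hle τ hτ) (abs_nonneg _)
    _ = (∫ τ in (0:ℝ)..s, |V τ|) * B := intervalIntegral.integral_mul_const _ _
    _ ≤ K * B := by gcongr

/-- Since `g` vanishes beyond the front `M`, only the outgoing characteristics with `σ < D`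
contribute, and each costs at most `K * B` because `V` is integrable in time. The bound thus
involves the width of the strip and not the elapsed time. -/
theorem abs_coneIntegral_le {V : ℝ → ℝ} {g : ℝ → ℝ → ℝ} (hV : Continuous V)
    (hg : Continuous (Function.uncurry g)) {c ξ t T M D B K : ℝ} (ht : 0 ≤ t) (htT : t ≤ T)
    (hc : 0 < c) (hD : 0 ≤ D) (hξ : M ≤ ξ + 2 * c * D) (hB : 0 ≤ B) (hK0 : 0 ≤ K)
    (hK : ∀ s ∈ Set.Icc 0 T, ∫ τ in (0:ℝ)..s, |V τ| ≤ K)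
    (hg0 : ∀ τ ∈ Set.Icc 0 T, ∀ η, M ≤ η → g τ η = 0)
    (hle : ∀ σ τ, 0 ≤ σ → 0 ≤ τ → τ + σ ≤ t → |g τ (ξ + 2 * c * σ)| ≤ B) :
    |coneIntegral c (fun τ η => V τ * g τ η) t ξ| ≤ K * B * D := by
  have hVg : Continuous (Function.uncurry fun τ η : ℝ => V τ * g τ η) :=
    (hV.comp continuous_fst).mul hg
  refine abs_integral_le_of_eq_zero (continuous_inner hVg c t ξ) ht hD (by positivity) ?_ ?_
  · intro σ hσ hDσ
    rw [intervalIntegral.integral_congr (g := fun _ => 0)]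
    · simp
    · intro τ hτ
      rw [Set.uIcc_of_le (by linarith [hσ.2])] at hτ
      have : M ≤ ξ + 2 * c * σ := hξ.trans (by gcongr)
      simp [hg0 τ ⟨hτ.1, by linarith [hτ.2, hσ.1]⟩ _ this]
  · intro σ hσ
    refine abs_integral_mul_le hV (continuous_slice hg _) (by linarith [hσ.2]) hB
      (hK _ ⟨by linarith [hσ.2], by linarith [hσ.1]⟩) ?_
    intro τ hτ
    exact hle σ τ hσ.1 hτ.1 (by linarith [hτ.2])

set_option maxHeartbeats 1000000 in
/-- Lower bound for solutions of the wave equation with a small potential, in a thin strip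
behind the wave front `ξ = M`. -/
theorem strip_lower_bound {V q w : ℝ → ℝ} {v H : ℝ → ℝ → ℝ} {c M D K β T : ℝ}
    (hV : Continuous V) (hq : Continuous q) (hw : Continuous w)
    (hv : Continuous (Function.uncurry v)) (hH : Continuous (Function.uncurry H))
    (hc : 0 < c) (hD : 0 ≤ D) (hK0 : 0 ≤ K)
    (hKV : ∀ s ∈ Set.Icc 0 T, ∫ τ in (0:ℝ)..s, |V τ| ≤ K)
    (hβV : ∀ s ∈ Set.Icc 0 T, ∫ τ in (0:ℝ)..s, V τ ≤ β)
    (hVK : ∀ s ∈ Set.Icc 0 T, |V s| ≤ K)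
    (hq0 : ∀ η, M ≤ η → q η = 0) (hv0 : ∀ τ ∈ Set.Icc 0 T, ∀ η, M ≤ η → v τ η = 0)
    (hH0 : ∀ τ ∈ Set.Icc 0 T, ∀ η, 0 ≤ H τ η)
    (hqpos : ∀ η, M - 2 * c * D < η → 0 ≤ q η)
    (hwq : ∀ η, M - 2 * c * D < η → 3 * β * q η ≤ w η) (hβ : 0 ≤ β)
    (hκ : 4 * (K * D) ≤ 1) (hκβ : K * D * (1 + 2 * K) ≤ β) (hD1 : 2 * D ≤ 1)
    (hrep : ∀ t ∈ Set.Icc 0 T, ∀ ξ, v t ξ = 1 / 2 * (q ξ + q (ξ + 2 * c * t))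
      + (∫ σ in (0:ℝ)..t, w (ξ + 2 * c * σ))
      + coneIntegral c (fun τ η => H τ η - V τ * v τ η) t ξ)
    {t ξ : ℝ} (ht : t ∈ Set.Icc 0 T) (hξ : M - 2 * c * D < ξ) :
    1 / 2 * q ξ + 1 / 2 * coneIntegral c H t ξ ≤ v t ξ := by
  -- `A` is the boundary part of d'Alembert's formula. It is split off because its interaction with
  -- `V` has to be measured by `Q = ∫ q`, which the hypothesis on `w` dominates; only the remainder
  -- `g = v - A` is estimated through its maximum.
  set A : ℝ → ℝ → ℝ := fun τ η => 1 / 2 * q η + 1 / 2 * q (η + 2 * c * τ) with hA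
  have hAc : Continuous (Function.uncurry A) := by
    simp only [hA, Function.uncurry_def]; fun_prop
  set g : ℝ → ℝ → ℝ := fun τ η => v τ η - A τ η with hg
  have hgc : Continuous (Function.uncurry g) := hv.sub hAc
  have hVc : Continuous fun z : ℝ × ℝ => V z.1 := hV.comp continuous_fst
  set Q : ℝ := ∫ σ in (0:ℝ)..t, q (ξ + 2 * c * σ) with hQ
  set f1 : ℝ := ∫ σ in (0:ℝ)..t, w (ξ + 2 * c * σ) with hf1
  have hqp : ∀ σ, 0 ≤ σ → 0 ≤ q (ξ + 2 * c * σ) := fun σ hσ =>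
    hqpos _ (by have : 0 ≤ 2 * c * σ := by positivity
                linarith)
  have hwp : ∀ σ, 0 ≤ σ → 3 * β * q (ξ + 2 * c * σ) ≤ w (ξ + 2 * c * σ) := fun σ hσ =>
    hwq _ (by have : 0 ≤ 2 * c * σ := by positivity
              linarith)
  have hQ0 : 0 ≤ Q := intervalIntegral.integral_nonneg ht.1 fun σ hσ => hqp σ hσ.1
  have hf1Q : 3 * β * Q ≤ f1 := by
    rw [hQ, ← intervalIntegral.integral_const_mul]
    exact intervalIntegral.integral_mono_on ht.1
      (Continuous.intervalIntegrable (by fun_prop) _ _)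
      (Continuous.intervalIntegrable (by fun_prop) _ _) fun σ hσ => hwp σ hσ.1
  -- the cone integral of `V A` is controlled by `Q`
  have hqc1 : Continuous (Function.uncurry fun (τ η : ℝ) => V τ * (1 / 2 * q η)) := by
    simp only [Function.uncurry_def]; fun_prop
  have hqc2 : Continuous (Function.uncurry fun (τ η : ℝ) => V τ * (1 / 2 * q (η + 2 * c * τ))) := by
    simp only [Function.uncurry_def]; fun_prop
  have hsplit : ∀ s η, coneIntegral c (fun τ η => V τ * A τ η) s η
      = coneIntegral c (fun τ η => V τ * (1 / 2 * q η)) s η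
        + coneIntegral c (fun τ η => V τ * (1 / 2 * q (η + 2 * c * τ))) s η := by
    intro s η
    rw [← coneIntegral_add hqc1 hqc2]
    unfold coneIntegral
    simp only [hA, mul_add]
  have hfirst : ∀ s η, coneIntegral c (fun τ η => V τ * (1 / 2 * q η)) s η
      = ∫ σ in (0:ℝ)..s, (∫ τ in (0:ℝ)..(s - σ), V τ) * (1 / 2 * q (η + 2 * c * σ)) := by
    intro s η
    unfold coneIntegral
    refine intervalIntegral.integral_congr fun σ _ => ?_
    exact intervalIntegral.integral_mul_const _ _
  have hVprim : ∀ s : ℝ, Continuous fun σ : ℝ => ∫ τ in (0:ℝ)..(s - σ), V τ := fun s =>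
    intervalIntegral.continuous_parametric_intervalIntegral_of_continuous
      (f := fun _ τ => V τ) (by simp only [Function.uncurry_def]; fun_prop) (by fun_prop)
  have hQle : ∀ s a, 0 ≤ s → 0 ≤ a → s + a ≤ t →
      ∫ σ in (0:ℝ)..s, q (ξ + 2 * c * a + 2 * c * σ) ≤ Q := fun s a hs ha hst =>
    integral_shift_le hq hs ha hst fun σ hσ => hqp σ hσ.1
  -- The factor `q η` is constant along outgoing characteristics, so the integral of `V` is taken
  -- alone. This term carries no small factor `D`. At the apex only an upper bound is needed, hence
  -- the one-sided constant `β`, which is matched by the hypothesis on `w`; elsewhere the cruder `K`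
  -- suffices.
  have hfirst_le : coneIntegral c (fun τ η => V τ * (1 / 2 * q η)) t ξ ≤ β / 2 * Q := by
    rw [hfirst, hQ, ← intervalIntegral.integral_const_mul]
    refine intervalIntegral.integral_mono_on ht.1
      (((hVprim t).mul (by fun_prop)).intervalIntegrable _ _)
      (Continuous.intervalIntegrable (by fun_prop) _ _) ?_
    intro σ hσ
    have h1 := hβV (t - σ) ⟨by linarith [hσ.2], by linarith [hσ.1, ht.2]⟩
    have h2 := hqp σ hσ.1
    nlinarith
  have hfirst_abs : ∀ s a, 0 ≤ s → 0 ≤ a → s + a ≤ t →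
      |coneIntegral c (fun τ η => V τ * (1 / 2 * q η)) s (ξ + 2 * c * a)| ≤ K / 2 * Q := by
    intro s a hs ha hst
    rw [hfirst]
    refine (intervalIntegral.abs_integral_le_integral_abs hs).trans ?_
    refine le_trans ?_ (mul_le_mul_of_nonneg_left (hQle s a hs ha hst) (by positivity))
    rw [← intervalIntegral.integral_const_mul]
    refine intervalIntegral.integral_mono_on hs
      (((hVprim s).mul (by fun_prop)).abs.intervalIntegrable _ _)
      (Continuous.intervalIntegrable (by fun_prop) _ _) ?_
    intro σ hσ
    have h2 : 0 ≤ q (ξ + 2 * c * a + 2 * c * σ) := by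
      have := hqp (a + σ) (by linarith [hσ.1])
      convert this using 2; ring
    have h1 : |∫ τ in (0:ℝ)..(s - σ), V τ| ≤ K :=
      (intervalIntegral.abs_integral_le_integral_abs (by linarith [hσ.2])).trans
        (hKV (s - σ) ⟨by linarith [hσ.2], by linarith [hσ.1, ht.2]⟩)
    rw [abs_mul, abs_of_nonneg (by positivity : 0 ≤ 1 / 2 * q (ξ + 2 * c * a + 2 * c * σ))]
    nlinarith
  -- Here `q` varies along the outgoing characteristics, so its `τ`-integral is at most `Q`, with
  -- `|V| ≤ K` pointwise. The outer integral has effective length `D` because `q` vanishes beyond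
  -- `M`.
  have hsecond_abs : ∀ s a, 0 ≤ s → 0 ≤ a → s + a ≤ t →
      |coneIntegral c (fun τ η => V τ * (1 / 2 * q (η + 2 * c * τ))) s (ξ + 2 * c * a)|
        ≤ K * Q * D := by
    intro s a hs ha hst
    refine abs_integral_le_of_eq_zero (continuous_inner hqc2 c s _) hs hD (by positivity) ?_ ?_
    · intro σ hσ hDσ
      rw [intervalIntegral.integral_congr (g := fun _ => 0)]
      · simp
      · intro τ hτ
        rw [Set.uIcc_of_le (by linarith [hσ.2])] at hτ
        have h1 : 0 ≤ 2 * c * a := by positivity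
        have h2 : 2 * c * D ≤ 2 * c * σ := by gcongr
        have h3 : 0 ≤ 2 * c * τ := mul_nonneg (by positivity) hτ.1
        simp [hq0 (ξ + 2 * c * a + 2 * c * σ + 2 * c * τ) (by linarith)]
    · intro σ hσ
      have hsσ : 0 ≤ s - σ := by linarith [hσ.2]
      refine (intervalIntegral.abs_integral_le_integral_abs hsσ).trans ?_
      have h1 : ∫ τ in (0:ℝ)..(s - σ), q (ξ + 2 * c * (a + σ) + 2 * c * τ) ≤ Q :=
        hQle (s - σ) (a + σ) hsσ (by linarith [hσ.1]) (by linarith)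
      refine le_trans ?_ (mul_le_mul_of_nonneg_left h1 hK0)
      rw [← intervalIntegral.integral_const_mul]
      refine intervalIntegral.integral_mono_on hsσ
        (Continuous.intervalIntegrable (by fun_prop) _ _)
        (Continuous.intervalIntegrable (by fun_prop) _ _) ?_
      intro τ hτ
      have e : ξ + 2 * c * a + 2 * c * σ + 2 * c * τ = ξ + 2 * c * (a + σ) + 2 * c * τ := by ring
      have h2 : 0 ≤ q (ξ + 2 * c * (a + σ) + 2 * c * τ) := by
        have := hqp (a + σ + τ) (by linarith [hσ.1, hτ.1])
        convert this using 2; ring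
      rw [abs_mul, e, abs_of_nonneg
        (by positivity : 0 ≤ 1 / 2 * q (ξ + 2 * c * (a + σ) + 2 * c * τ))]
      have := hVK τ ⟨hτ.1, by linarith [hτ.2, hσ.1, ht.2]⟩
      nlinarith [abs_nonneg (V τ)]
  -- representation of `g`
  have hg0 : ∀ τ ∈ Set.Icc 0 T, ∀ η, M ≤ η → g τ η = 0 := by
    intro τ hτ η hη
    have h3 : 0 ≤ 2 * c * τ := mul_nonneg (by positivity) hτ.1
    simp [hg, hA, hv0 τ hτ η hη, hq0 η hη, hq0 (η + 2 * c * τ) (by linarith)]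
  have hVg : Continuous (Function.uncurry fun τ η : ℝ => V τ * g τ η) := hVc.mul hgc
  have hVA : Continuous (Function.uncurry fun τ η : ℝ => V τ * A τ η) := hVc.mul hAc
  have hVv : Continuous (Function.uncurry fun τ η : ℝ => V τ * v τ η) := hVc.mul hv
  have hgrep : ∀ s ∈ Set.Icc 0 T, ∀ η, g s η = (∫ σ in (0:ℝ)..s, w (η + 2 * c * σ))
      + coneIntegral c H s η - coneIntegral c (fun τ η => V τ * A τ η) s η
      - coneIntegral c (fun τ η => V τ * g τ η) s η := by
    intro s hs η
    have h1 : coneIntegral c (fun τ η => V τ * v τ η) s η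
        = coneIntegral c (fun τ η => V τ * A τ η) s η
          + coneIntegral c (fun τ η => V τ * g τ η) s η := by
      rw [← coneIntegral_add hVA hVg]
      congr 1; funext τ η; simp only [hg]; ring
    have h2 := hrep s hs η
    rw [coneIntegral_sub hH hVv, h1] at h2
    simp only [hg, hA] at h2 ⊢
    rw [h2]; ring
  -- the maximum of `|g|` over the triangle
  set Tri : Set (ℝ × ℝ) := {z | 0 ≤ z.1 ∧ 0 ≤ z.2 ∧ z.1 + z.2 ≤ t} with hTri
  have hTriC : IsCompact Tri := by
    refine (isCompact_Icc.prod isCompact_Icc : IsCompact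
      (Set.Icc (0:ℝ) t ×ˢ Set.Icc (0:ℝ) t)).of_isClosed_subset ?_ ?_
    · exact (isClosed_le continuous_const continuous_fst).inter
        ((isClosed_le continuous_const continuous_snd).inter
          (isClosed_le (continuous_fst.add continuous_snd) continuous_const))
    · rintro ⟨x, y⟩ ⟨h1, h2, h3⟩
      simp only at h1 h2 h3
      exact ⟨⟨h1, by linarith⟩, ⟨h2, by linarith⟩⟩
  have hgcomp : Continuous fun z : ℝ × ℝ => |g z.1 (ξ + 2 * c * z.2)| :=
    (hgc.comp (by fun_prop : Continuous fun z : ℝ × ℝ => (z.1, ξ + 2 * c * z.2))).abs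
  obtain ⟨z, hz, hzmax⟩ := hTriC.exists_isMaxOn ⟨(t, 0), ht.1, le_rfl, by simp⟩
    hgcomp.continuousOn
  obtain ⟨s, a⟩ := z
  obtain ⟨hs, ha, hsa⟩ := hz
  simp only at hs ha hsa
  set B := |g s (ξ + 2 * c * a)| with hB
  have hB0 : 0 ≤ B := abs_nonneg _
  have hmax : ∀ σ τ, 0 ≤ σ → 0 ≤ τ → τ + σ ≤ t → |g τ (ξ + 2 * c * σ)| ≤ B := by
    intro σ τ hσ hτ hστ
    exact hzmax (a := (τ, σ)) ⟨hτ, hσ, hστ⟩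
  have hVg_abs : ∀ s a, 0 ≤ s → 0 ≤ a → s + a ≤ t →
      |coneIntegral c (fun τ η => V τ * g τ η) s (ξ + 2 * c * a)| ≤ K * B * D := by
    intro s a hs ha hst
    have h1 : 0 ≤ 2 * c * a := by positivity
    refine abs_coneIntegral_le hV hgc hs (by linarith [ht.2]) hc hD (by linarith) hB0 hK0 hKV hg0 ?_
    intro σ τ hσ hτ hστ
    have := hmax (a + σ) τ (by linarith) hτ (by linarith)
    convert this using 3; ring
  have hf1_mono : |∫ σ in (0:ℝ)..s, w (ξ + 2 * c * a + 2 * c * σ)| ≤ f1 := by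
    rw [abs_of_nonneg]
    · refine integral_shift_le hw hs ha hsa fun σ hσ => ?_
      exact le_trans (mul_nonneg (by positivity) (hqp σ hσ.1)) (hwp σ hσ.1)
    · refine intervalIntegral.integral_nonneg hs fun σ hσ => ?_
      have h1 := hqp (a + σ) (by linarith [hσ.1])
      have h2 := hwp (a + σ) (by linarith [hσ.1])
      rw [show ξ + 2 * c * (a + σ) = ξ + 2 * c * a + 2 * c * σ by ring] at h1 h2
      exact le_trans (mul_nonneg (by positivity) h1) h2
  have hcone0 : ∀ s η, 0 ≤ s → s ≤ T → 0 ≤ coneIntegral c H s η := by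
    intro s η hs hsT
    refine intervalIntegral.integral_nonneg hs fun σ hσ =>
      intervalIntegral.integral_nonneg (by linarith [hσ.2]) fun τ hτ => ?_
    exact hH0 τ ⟨hτ.1, by linarith [hτ.2, hσ.1]⟩ _
  have hLH := coneIntegral_mono (ξ := ξ) (c := c) hH hs ha hsa ht.2 hH0
  have hLH0 := hcone0 s (ξ + 2 * c * a) hs (by linarith [ht.2])
  set F := f1 + coneIntegral c H t ξ with hF
  have hBle : B ≤ F + (K / 2 * Q + K * Q * D) + K * B * D := by
    have e := hgrep s ⟨hs, by linarith [ht.2]⟩ (ξ + 2 * c * a)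
    rw [hsplit] at e
    have i1 := abs_le.1 hf1_mono
    have i2 := abs_le.1 (hfirst_abs s a hs ha hsa)
    have i3 := abs_le.1 (hsecond_abs s a hs ha hsa)
    have i4 := abs_le.1 (hVg_abs s a hs ha hsa)
    refine abs_le.2 ⟨?_, ?_⟩ <;> linarith
  -- Absorption: `K D ≤ 1/4` moves a quarter of `B` to the left, and `D ≤ 1/2` makes the second
  -- potential term at most `K Q / 2`, so even `B ≤ (4/3) (F + K Q)`.
  have hBF : B ≤ 2 * (F + K * Q) := by
    have h1 : K * B * D ≤ 1 / 4 * B := by nlinarith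
    have h2 : K * Q * D ≤ K / 2 * Q := by nlinarith [mul_nonneg hK0 hQ0]
    nlinarith [mul_nonneg hK0 hQ0, hcone0 t ξ ht.1 ht.2]
  have e := hgrep t ht ξ
  rw [hsplit] at e
  have j2 := hsecond_abs t 0 ht.1 le_rfl (by simp)
  have j3 := hVg_abs t 0 ht.1 le_rfl (by simp)
  rw [show ξ + 2 * c * 0 = ξ by ring] at j2 j3
  have j2' := (abs_le.1 j2).2
  have j3' := (abs_le.1 j3).2
  have hx : v t ξ = 1 / 2 * q ξ + 1 / 2 * q (ξ + 2 * c * t) + g t ξ := by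
    simp only [hg, hA]; ring
  have hq2 := hqp t ht.1
  have hKBD : K * B * D ≤ K * D * (2 * (F + K * Q)) := by
    have : K * B * D = K * D * B := by ring
    rw [this]; gcongr
  have hF0 : 0 ≤ F := by
    have := hcone0 t ξ ht.1 ht.2
    have : 0 ≤ f1 := le_trans (by positivity) hf1Q
    linarith
  have h5 : K * D * F ≤ 1 / 4 * F := by nlinarith
  have h6 : K * D * (1 + 2 * K) * Q ≤ β * Q := by gcongr
  have h7 : 0 ≤ β * Q := by positivity
  -- Balance at the apex: the losses are `β Q / 2` from the first potential term, at most `β Q` from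
  -- all terms with a factor `K D Q`, and `F / 2`. What remains is half the cone integral plus `(f1
  -- - 3 β Q) / 2`, which is the origin of the factor 3 in `hwq`.
  rw [hx, e]
  nlinarith

end DampedEuler
end

/-! ### Blowup by iteration on shrinking strips. -/

noncomputable section
namespace DampedEuler

/-- The blowup mechanism: a function that dominates the cone integral of `k v ^ p / (1 + τ)`
in a strip behind the front cannot exist for too long. -/
theorem blowup_time_lt {v H : ℝ → ℝ → ℝ} {c ξ₁ d k p a₀ ℓ T : ℝ}
    (hH : Continuous (Function.uncurry H)) (hc : 0 < c) (hd : 0 < d) (hk : 0 < k) (hp : 1 < p)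
    (ha₀ : 0 < a₀) (hℓ : 0 < ℓ)
    (hlarge : (4:ℝ) ^ (1 / (p - 1)) ≤ 1 / 2 * k * d * ℓ * a₀ ^ (p - 1))
    (hH0 : ∀ τ ∈ Set.Icc 0 T, ∀ η, 0 ≤ H τ η)
    (hva : ∀ t ∈ Set.Icc 0 T, ∀ ξ ∈ Set.Icc ξ₁ (ξ₁ + 4 * c * d), a₀ ≤ v t ξ)
    (hvH : ∀ t ∈ Set.Icc 0 T, ∀ ξ ∈ Set.Icc ξ₁ (ξ₁ + 4 * c * d),
      1 / 2 * coneIntegral c H t ξ ≤ v t ξ)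
    (hHv : ∀ t ∈ Set.Icc 0 T, ∀ ξ ∈ Set.Icc ξ₁ (ξ₁ + 4 * c * d),
      k / (1 + t) * v t ξ ^ p ≤ H t ξ) :
    T < Real.exp (2 * (ℓ + d)) - 1 := by
  by_contra! hT
  -- The growth ratio is fixed by `R ^ (p - 1) = 4`: the gain `4 ^ n` from the nonlinearity
  -- compensates the loss `x n ^ 2 = 4 ^ (-n)`, one factor `x n` coming from the width of the strip
  -- and one from the logarithmic time.
  set R : ℝ := (4:ℝ) ^ (1 / (p - 1)) with hR
  have hp1 : 0 < p - 1 := by linarith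
  have hR1 : 1 < R := Real.one_lt_rpow (by norm_num) (by positivity)
  have hRp : R ^ (p - 1) = 4 := by
    rw [hR, ← Real.rpow_mul (by norm_num)]
    rw [one_div, inv_mul_cancel₀ hp1.ne', Real.rpow_one]
  set x : ℕ → ℝ := fun n => (1 / 2 : ℝ) ^ n with hx
  have hx0 : ∀ n, 0 < x n := fun n => by positivity
  have hx1 : ∀ n, x n ≤ 1 := fun n => pow_le_one₀ (by norm_num) (by norm_num)
  have hxs : ∀ n, x (n + 1) = x n / 2 := fun n => by simp only [hx, pow_succ]; ring
  -- Going from `n` to `n + 1` multiplies `1 + t n` by `exp ((ℓ + d) x n)`. The part `ℓ x n` is the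
  -- logarithmic time over which the source is integrated; the part `d x n` makes room for the depth
  -- `σ ≤ d x n` of the triangle. All `t n` stay below `exp (2 (ℓ + d)) - 1`.
  set t : ℕ → ℝ := fun n => Real.exp (2 * (ℓ + d) * (1 - x n)) - 1 with ht
  have ht0 : ∀ n, 0 ≤ t n := fun n => by
    have : 0 ≤ 2 * (ℓ + d) * (1 - x n) := by
      have := hx1 n
      have : 0 ≤ 1 - x n := by linarith
      positivity
    have := Real.one_le_exp this
    simp only [ht]; linarith
  have htT : ∀ n, t n ≤ T := fun n => by
    refine le_trans ?_ hT
    have : 2 * (ℓ + d) * (1 - x n) ≤ 2 * (ℓ + d) := by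
      have := hx0 n
      nlinarith
    have := Real.exp_le_exp.2 this
    simp only [ht]; linarith
  have hstep : ∀ n, Real.exp (ℓ * x n) * (1 + t n) ≤ 1 + t (n + 1) - d * x n := by
    intro n
    have e1 : 1 + t n = Real.exp (2 * (ℓ + d) * (1 - x n)) := by simp [ht]
    have e2 : 1 + t (n + 1) = (1 + t n) * (Real.exp (ℓ * x n) * Real.exp (d * x n)) := by
      rw [e1, ← Real.exp_add, ← Real.exp_add]
      simp only [ht, hxs]
      rw [add_sub_cancel]; congr 1; ring
    have h1 : 1 ≤ 1 + t n := by linarith [ht0 n]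
    have h2 : 1 ≤ Real.exp (ℓ * x n) := Real.one_le_exp (by have := hx0 n; positivity)
    have h3 : d * x n + 1 ≤ Real.exp (d * x n) := Real.add_one_le_exp _
    have h4 : 0 < d * x n := mul_pos hd (hx0 n)
    rw [e2]
    have h5 : 1 ≤ (1 + t n) * Real.exp (ℓ * x n) := one_le_mul_of_one_le_of_one_le h1 h2
    nlinarith
  -- Halving the width at each step leaves room for the shift: a `ξ` within `2 c d x n` of `ξ₁`,
  -- moved by `2 c σ` with `σ ≤ d x n`, still lies in the strip of level `n`.
  have key : ∀ n : ℕ, ∀ s ∈ Set.Icc (t n) T, ∀ ξ ∈ Set.Icc ξ₁ (ξ₁ + 4 * c * d * x n),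
      a₀ * R ^ n ≤ v s ξ := by
    intro n
    induction n with
    | zero =>
      intro s hs ξ hξ
      simp only [pow_zero, mul_one, hx] at hξ ⊢
      exact hva s ⟨(ht0 0).trans hs.1, hs.2⟩ ξ hξ
    | succ n ih =>
      intro s hs ξ hξ
      have hs0 : 0 ≤ s := (ht0 _).trans hs.1
      have hcd : 0 < c * d * x n := mul_pos (mul_pos hc hd) (hx0 n)
      have hcd1 : c * d * x n ≤ c * d := by
        have := hx1 n
        have : 0 < c * d := by positivity
        nlinarith
      have hξ2 : ξ ≤ ξ₁ + 2 * c * d * x n := by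
        have := hξ.2
        rw [hxs] at this
        linarith
      have hξ' : ξ ∈ Set.Icc ξ₁ (ξ₁ + 4 * c * d) := ⟨hξ.1, by linarith⟩
      refine le_trans ?_ (hvH s ⟨hs0, hs.2⟩ ξ hξ')
      have hst := hstep n
      have hdx : 0 < d * x n := mul_pos hd (hx0 n)
      have hdxs : t n + d * x n ≤ s := by
        have h2 : 1 ≤ Real.exp (ℓ * x n) := Real.one_le_exp (by have := hx0 n; positivity)
        have := hs.1
        nlinarith [ht0 n]
      have haR : 0 < a₀ * R ^ n := by positivity
      -- lower bound for the inner integrals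
      have hinner : ∀ σ ∈ Set.Icc 0 (d * x n),
          k * (a₀ * R ^ n) ^ p * (ℓ * x n) ≤
            ∫ τ in (0:ℝ)..(s - σ), H τ (ξ + 2 * c * σ) := by
        intro σ hσ
        have hη : ξ + 2 * c * σ ∈ Set.Icc ξ₁ (ξ₁ + 4 * c * d * x n) := by
          have h1 : 0 ≤ 2 * c * σ := mul_nonneg (by positivity) hσ.1
          have h2 : 2 * c * σ ≤ 2 * c * (d * x n) :=
            mul_le_mul_of_nonneg_left hσ.2 (by positivity)
          constructor
          · linarith [hξ.1]
          · linarith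
        have hη' : ξ + 2 * c * σ ∈ Set.Icc ξ₁ (ξ₁ + 4 * c * d) := ⟨hη.1, by linarith [hη.2]⟩
        have htσ : t n ≤ s - σ := by linarith [hσ.2]
        have hpos1 : 0 < 1 + t n := by linarith [ht0 n]
        calc k * (a₀ * R ^ n) ^ p * (ℓ * x n)
            ≤ k * (a₀ * R ^ n) ^ p * (Real.log (1 + (s - σ)) - Real.log (1 + t n)) := by
              refine mul_le_mul_of_nonneg_left ?_ (by positivity)
              rw [← Real.log_div (by linarith) hpos1.ne']
              rw [Real.le_log_iff_exp_le (by apply div_pos <;> linarith), le_div_iff₀ hpos1]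
              linarith [hs.1, hσ.2]
          _ = ∫ τ in (t n)..(s - σ), k / (1 + τ) * (a₀ * R ^ n) ^ p := by
              rw [intervalIntegral.integral_eq_sub_of_hasDerivAt
                (f := fun τ => k * (a₀ * R ^ n) ^ p * Real.log (1 + τ))]
              · ring
              · intro τ hτ
                rw [Set.uIcc_of_le htσ] at hτ
                have h1 : 1 + τ ≠ 0 := by linarith [hτ.1]
                have hd : HasDerivAt (fun s : ℝ => 1 + s) 1 τ := (hasDerivAt_id τ).const_add 1
                exact ((hd.log h1).const_mul (k * (a₀ * R ^ n) ^ p)).congr_deriv (by ring)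
              · refine ContinuousOn.intervalIntegrable ?_
                intro τ hτ
                rw [Set.uIcc_of_le htσ] at hτ
                have h1 : 1 + τ ≠ 0 := by linarith [hτ.1]
                exact ContinuousAt.continuousWithinAt (by fun_prop (disch := exact h1))
          _ ≤ ∫ τ in (t n)..(s - σ), H τ (ξ + 2 * c * σ) := by
              refine intervalIntegral.integral_mono_on htσ ?_
                ((continuous_slice hH _).intervalIntegrable _ _) ?_
              · refine ContinuousOn.intervalIntegrable ?_
                intro τ hτ
                rw [Set.uIcc_of_le htσ] at hτ
                have h1 : 1 + τ ≠ 0 := by linarith [hτ.1]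
                exact ContinuousAt.continuousWithinAt (by fun_prop (disch := exact h1))
              · intro τ hτ
                have hτT : τ ≤ T := by linarith [hτ.2, hσ.1, hs.2]
                have hτ0 : 0 ≤ τ := (ht0 n).trans hτ.1
                refine le_trans ?_ (hHv τ ⟨hτ0, hτT⟩ _ hη')
                have h3 := ih τ ⟨hτ.1, hτT⟩ _ hη
                gcongr
          _ ≤ _ := by
              refine intervalIntegral.integral_mono_interval (ht0 n) htσ le_rfl ?_
                ((continuous_slice hH _).intervalIntegrable _ _)
              refine (MeasureTheory.ae_restrict_iff' measurableSet_Ioc).2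
                (Filter.Eventually.of_forall fun τ hτ => ?_)
              exact hH0 τ ⟨hτ.1.le, by linarith [hτ.2, hσ.1, hs.2]⟩ _
      have hcone : (d * x n) * (k * (a₀ * R ^ n) ^ p * (ℓ * x n)) ≤ coneIntegral c H s ξ := by
        calc _ = ∫ σ in (0:ℝ)..(d * x n), k * (a₀ * R ^ n) ^ p * (ℓ * x n) := by
              rw [intervalIntegral.integral_const, sub_zero, smul_eq_mul]
          _ ≤ ∫ σ in (0:ℝ)..(d * x n), ∫ τ in (0:ℝ)..(s - σ), H τ (ξ + 2 * c * σ) :=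
            intervalIntegral.integral_mono_on hdx.le (by simp)
              ((continuous_inner hH c s ξ).intervalIntegrable _ _) hinner
          _ ≤ _ := by
            refine intervalIntegral.integral_mono_interval le_rfl hdx.le
              (by linarith [ht0 n]) ?_ ((continuous_inner hH c s ξ).intervalIntegrable _ _)
            refine (MeasureTheory.ae_restrict_iff' measurableSet_Ioc).2
              (Filter.Eventually.of_forall fun σ hσ => ?_)
            refine intervalIntegral.integral_nonneg (by linarith [hσ.2]) fun τ hτ => ?_
            exact hH0 τ ⟨hτ.1, by linarith [hτ.2, hσ.1, hs.2]⟩ _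
      have hpow : (a₀ * R ^ n) ^ p * x n * x n = a₀ ^ p * R ^ n := by
        have e1 : (a₀ * R ^ n) ^ p = a₀ ^ p * (R ^ n * 4 ^ n) := by
          rw [Real.mul_rpow ha₀.le (by positivity)]
          congr 1
          have e : (R ^ n) ^ (p - 1) = 4 ^ n := by
            rw [← Real.rpow_pow_comm (by positivity), hRp]
          calc (R ^ n) ^ p = (R ^ n) ^ (1 + (p - 1)) := by congr 1; ring
            _ = _ := by rw [Real.rpow_add (by positivity), Real.rpow_one, e]
        have e2 : x n * x n * 4 ^ n = 1 := by
          simp only [hx]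
          rw [← mul_pow, ← mul_pow]; norm_num
        rw [e1]
        linear_combination (a₀ ^ p * R ^ n) * e2
      have hap : a₀ ^ p = a₀ ^ (p - 1) * a₀ := by
        rw [Real.rpow_sub_one ha₀.ne']; field_simp
      calc a₀ * R ^ (n + 1) = R * (a₀ * R ^ n) := by ring
        _ ≤ (1 / 2 * k * d * ℓ * a₀ ^ (p - 1)) * (a₀ * R ^ n) := by gcongr
        _ = 1 / 2 * (d * k * ℓ) * ((a₀ * R ^ n) ^ p * x n * x n) := by rw [hpow, hap]; ring
        _ = 1 / 2 * ((d * x n) * (k * (a₀ * R ^ n) ^ p * (ℓ * x n))) := by ring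
        _ ≤ _ := by gcongr
  -- All levels are reached before time `T`, so `v T ξ₁` would exceed `a₀ R ^ n` for every `n`.
  have hlim := tendsto_pow_atTop_atTop_of_one_lt hR1
  obtain ⟨n, hn⟩ := (hlim.eventually_gt_atTop (v T ξ₁ / a₀)).exists
  have h1 := key n T ⟨htT n, le_rfl⟩ ξ₁ ⟨le_rfl, le_add_of_nonneg_right (mul_nonneg (by positivity) (hx0 n).le)⟩
  rw [div_lt_iff₀ ha₀] at hn
  linarith

end DampedEuler
end

noncomputable section
namespace DampedEuler

/-! ### The damping coefficient -/

/-- A primitive of the damping coefficient, vanishing at `t = 0`. -/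
def Params.dampingPrim (P : Params) (t : ℝ) : ℝ :=
  if P.lam = 1 then P.mu * Real.log (1 + t)
  else P.mu / (P.lam - 1) * (1 - (1 + t) ^ (1 - P.lam))

/-- The integrating factor `exp (½ ∫ α)`. -/
def Params.weight (P : Params) (t : ℝ) : ℝ := Real.exp (P.dampingPrim t / 2)

/-- The potential `- α' / 2 - α ^ 2 / 4`. -/
def Params.potential (P : Params) (t : ℝ) : ℝ :=
  P.lam * P.damping t / (2 * (1 + t)) - P.damping t ^ 2 / 4

theorem Params.hasDerivAt_dampingPrim (P : Params) {t : ℝ} (ht : -1 < t) :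
    HasDerivAt P.dampingPrim (P.damping t) t := by
  have h1 : 0 < 1 + t := by linarith
  have hd : HasDerivAt (fun s : ℝ => 1 + s) 1 t := (hasDerivAt_id t).const_add 1
  unfold Params.dampingPrim Params.damping
  by_cases h : P.lam = 1
  · simp only [h, if_true, Real.rpow_one]
    exact ((hd.log h1.ne').const_mul P.mu).congr_deriv (by ring)
  · simp only [h, if_false]
    have h2 : P.lam - 1 ≠ 0 := sub_ne_zero.2 h
    refine (((hd.rpow_const (p := 1 - P.lam) (Or.inl h1.ne')).const_sub 1).const_mul
      (P.mu / (P.lam - 1))).congr_deriv ?_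
    rw [show 1 - P.lam - 1 = -P.lam by ring, Real.rpow_neg h1.le]
    field_simp
    ring

theorem Params.hasDerivAt_damping (P : Params) {t : ℝ} (ht : -1 < t) :
    HasDerivAt P.damping (-(P.lam * P.damping t / (1 + t))) t := by
  have h1 : 0 < 1 + t := by linarith
  have hd : HasDerivAt (fun s : ℝ => 1 + s) 1 t := (hasDerivAt_id t).const_add 1
  unfold Params.damping
  have h3 : 0 < (1 + t) ^ P.lam := Real.rpow_pos_of_pos h1 _
  refine (((hd.rpow_const (p := P.lam) (Or.inl h1.ne')).inv h3.ne').const_mul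
    P.mu).congr_deriv ?_
  rw [Real.rpow_sub_one h1.ne']
  field_simp

theorem Params.hasDerivAt_weight (P : Params) {t : ℝ} (ht : -1 < t) :
    HasDerivAt P.weight (P.damping t / 2 * P.weight t) t := by
  exact ((P.hasDerivAt_dampingPrim ht).div_const 2).exp.congr_deriv (by
    unfold Params.weight; ring)

theorem Params.damping_nonneg (P : Params) {t : ℝ} (ht : -1 < t) : 0 ≤ P.damping t :=
  div_nonneg P.mu_pos.le (Real.rpow_nonneg (by linarith) _)

theorem Params.damping_zero (P : Params) : P.damping 0 = P.mu := by simp [Params.damping]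

theorem Params.weight_zero (P : Params) : P.weight 0 = 1 := by
  simp [Params.weight, Params.dampingPrim]

theorem Params.one_le_weight (P : Params) (hl : 1 ≤ P.lam) {t : ℝ} (ht : 0 ≤ t) :
    1 ≤ P.weight t := by
  apply Real.one_le_exp
  unfold Params.dampingPrim
  have hm := P.mu_pos.le
  split_ifs with h
  · have := Real.log_nonneg (by linarith : 1 ≤ 1 + t)
    positivity
  · have h1 : 0 < P.lam - 1 := sub_pos.2 (lt_of_le_of_ne hl (Ne.symm h))
    have := Real.rpow_le_one_of_one_le_of_nonpos (by linarith : 1 ≤ 1 + t)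
      (by linarith : 1 - P.lam ≤ 0)
    have : 0 ≤ 1 - (1 + t) ^ (1 - P.lam) := by linarith
    positivity

theorem Params.damping_le (P : Params) (hl : 1 ≤ P.lam) {t : ℝ} (ht : 0 ≤ t) :
    P.damping t ≤ P.mu / (1 + t) := by
  unfold Params.damping
  have := P.mu_pos.le
  gcongr
  exact Real.self_le_rpow_of_one_le (by linarith) hl

/-- The growth of the integrating factor compensates the spatial decay. -/
theorem Params.exists_weight_bound (P : Params) {d : ℕ}
    (hcase : (P.lam = 1 ∧ P.mu ≤ 1 ∧ d = 2) ∨ (1 < P.lam ∧ (d = 2 ∨ d = 3))) :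
    ∃ C ≥ 1, ∀ t, 0 ≤ t → (1 + t) ^ (((d:ℝ) - 1) / 2) * P.weight t ≤ C * (1 + t) := by
  rcases hcase with ⟨hl, hm, rfl⟩ | ⟨hl, hd⟩
  · refine ⟨1, le_rfl, fun t ht => ?_⟩
    have h1 : 0 < 1 + t := by linarith
    -- For `λ = 1` the total exponent is `(d - 1)/2 + μ/2`; with `d = 2` and `μ ≤ 1` it is at most
    -- 1.
    have : P.weight t = (1 + t) ^ (P.mu / 2) := by
      unfold Params.weight Params.dampingPrim
      rw [if_pos hl, Real.rpow_def_of_pos h1]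
      congr 1; ring
    rw [this, ← Real.rpow_add h1, one_mul]
    calc _ ≤ (1 + t) ^ (1:ℝ) := Real.rpow_le_rpow_of_exponent_le (by linarith)
          (by push_cast; linarith)
      _ = _ := Real.rpow_one _
  · have h2 : 0 < P.lam - 1 := by linarith
    have hm := P.mu_pos
    refine ⟨Real.exp (P.mu / (P.lam - 1)), Real.one_le_exp (by positivity), fun t ht => ?_⟩
    have h1 : 0 < 1 + t := by linarith
    -- For `λ > 1` the damping is integrable, so the integrating factor is bounded and the spatial
    -- factor with `d ≤ 3` may use up the whole power `1 + t`.
    have hw : P.weight t ≤ Real.exp (P.mu / (P.lam - 1)) := by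
      unfold Params.weight Params.dampingPrim
      rw [if_neg hl.ne']
      apply Real.exp_le_exp.2
      have h3 := Real.rpow_nonneg h1.le (1 - P.lam)
      have h4 : 0 < P.mu / (P.lam - 1) := by positivity
      nlinarith
    have hd' : (1 + t) ^ (((d:ℝ) - 1) / 2) ≤ 1 + t := by
      calc _ ≤ (1 + t) ^ (1:ℝ) := Real.rpow_le_rpow_of_exponent_le (by linarith) (by
            rcases hd with rfl | rfl <;> norm_num)
        _ = _ := Real.rpow_one _
    rw [mul_comm]
    have : 0 ≤ P.weight t := (Real.exp_pos _).le
    gcongr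

theorem Params.ab_pos (P : Params) (hcase : (P.lam = 1 ∧ P.mu ≤ 1) ∨ 1 < P.lam) : 0 < P.ab := by
  have := P.mu_pos
  unfold Params.ab
  split_ifs with h
  · rcases hcase with ⟨_, h2⟩ | h2
    · have : 0 < 1 - P.mu / 2 := by linarith
      positivity
    · exact absurd h h2.ne'
  · rcases hcase with ⟨h1, _⟩ | h2
    · exact absurd h1 h
    · positivity

/-- This is the reason for the value of `ab`. For `λ = 1` it is an equality; for `λ > 1` the square
`α²/4` is dropped. The one-sided bound yields the constant `β` of `strip_lower_bound`. -/
theorem Params.potential_le (P : Params) (hl : 1 ≤ P.lam) {t : ℝ} (ht : 0 ≤ t) :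
    P.potential t ≤ P.ab / (1 + t) ^ 2 := by
  have h1 : 0 < 1 + t := by linarith
  unfold Params.potential Params.ab
  split_ifs with h
  · unfold Params.damping
    rw [h, Real.rpow_one]
    apply le_of_eq
    field_simp
    ring
  · have h2 := P.damping_le hl ht
    have h3 : P.lam * P.damping t / (2 * (1 + t)) ≤ P.lam * (P.mu / (1 + t)) / (2 * (1 + t)) := by
      have := P.lam_nonneg
      gcongr
    have h4 : P.lam * (P.mu / (1 + t)) / (2 * (1 + t)) = P.mu * P.lam / 2 / (1 + t) ^ 2 := by
      field_simp
    nlinarith [sq_nonneg (P.damping t)]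

/-- Quadratic decay makes the potential integrable in time, so that its effect on the strip is
bounded uniformly in `t`. -/
theorem Params.abs_potential_le (P : Params) (hl : 1 ≤ P.lam) {t : ℝ} (ht : 0 ≤ t) :
    |P.potential t| ≤ (P.mu * P.lam / 2 + P.mu ^ 2 / 4) / (1 + t) ^ 2 := by
  have h1 : 0 < 1 + t := by linarith
  have h2 := P.damping_le hl ht
  have h0 := P.damping_nonneg (by linarith : -1 < t)
  have hl0 := P.lam_nonneg
  have h3 : P.lam * P.damping t / (2 * (1 + t)) ≤ P.lam * (P.mu / (1 + t)) / (2 * (1 + t)) := by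
    gcongr
  have h5 : 0 ≤ P.lam * P.damping t / (2 * (1 + t)) := by positivity
  have h4 : P.lam * (P.mu / (1 + t)) / (2 * (1 + t)) = P.mu * P.lam / 2 / (1 + t) ^ 2 := by
    field_simp
  have h6 : P.damping t ^ 2 ≤ (P.mu / (1 + t)) ^ 2 := by gcongr
  have h7 : (P.mu / (1 + t)) ^ 2 = P.mu ^ 2 / (1 + t) ^ 2 := by rw [div_pow]
  have h8 : (P.mu * P.lam / 2 + P.mu ^ 2 / 4) / (1 + t) ^ 2
      = P.mu * P.lam / 2 / (1 + t) ^ 2 + P.mu ^ 2 / (1 + t) ^ 2 / 4 := by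
    rw [add_div]; ring
  have h9 := sq_nonneg (P.damping t)
  have h10 := sq_nonneg (P.mu / (1 + t))
  unfold Params.potential
  rw [abs_le, h8, ← h7, ← h4]
  have h11 : 0 ≤ P.lam * (P.mu / (1 + t)) / (2 * (1 + t)) := h5.trans h3
  constructor <;> linarith

theorem integral_inv_sq_le {b s : ℝ} (hb : 0 ≤ b) (hs : 0 ≤ s) :
    ∫ τ in (0:ℝ)..s, b / (1 + τ) ^ 2 ≤ b := by
  rw [intervalIntegral.integral_eq_sub_of_hasDerivAt (f := fun τ => -(b / (1 + τ)))]
  · simp only [add_zero, div_one, sub_neg_eq_add, neg_add_le_iff_le_add]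
    have : 0 ≤ b / (1 + s) := by positivity
    linarith
  · intro τ hτ
    rw [Set.uIcc_of_le hs] at hτ
    have h1 : 1 + τ ≠ 0 := by linarith [hτ.1]
    have hd : HasDerivAt (fun s : ℝ => 1 + s) 1 τ := (hasDerivAt_id τ).const_add 1
    exact ((hd.inv h1).const_mul b).neg.congr_deriv (by field_simp)
  · refine ContinuousOn.intervalIntegrable ?_
    intro τ hτ
    rw [Set.uIcc_of_le hs] at hτ
    have h1 : (1 + τ) ^ 2 ≠ 0 := by have := hτ.1; positivity
    exact ContinuousAt.continuousWithinAt (by fun_prop (disch := exact h1))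

/-! ### Convexity of the pressure -/

/-- Bernoulli's inequality for `1 + (2z + z²) = (1 + z)²` with exponent `γ/2 ≥ 1`. -/
theorem one_add_rpow_sub_ge_of_two_le {γ z : ℝ} (hγ : 2 ≤ γ) (hz : 0 ≤ z) :
    z ^ 2 ≤ (1 + z) ^ γ - 1 - γ * z := by
  have h1 := one_add_mul_self_le_rpow_one_add (s := 2 * z + z ^ 2) (p := γ / 2)
    (by nlinarith [sq_nonneg z]) (by linarith)
  have h2 : (1 + (2 * z + z ^ 2)) ^ (γ / 2) = (1 + z) ^ γ := by
    rw [show 1 + (2 * z + z ^ 2) = (1 + z) ^ (2:ℝ) by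
      rw [show (2:ℝ) = ((2:ℕ):ℝ) by norm_num, Real.rpow_natCast]; push_cast; ring,
      ← Real.rpow_mul (by linarith)]
    congr 1; ring
  rw [h2] at h1
  nlinarith [sq_nonneg z]

/-- With `q = γ - 1` one has `(1 + γz)(1 + z - qz) = (1 + z)² - q²z²`, and Bernoulli bounds `(1 +
z)^(-q)`; this leaves the remainder `q² z² (1 + z)^(γ-2)`. It is of order `z²` for `z ≤ 1` and of
order `z^γ` for `z ≥ 1`, whence the minimum. -/
theorem one_add_rpow_sub_ge_of_le_two {γ z : ℝ} (hγ1 : 1 < γ) (hγ : γ ≤ 2) (hz : 0 ≤ z) :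
    (γ - 1) ^ 2 / 2 * min (z ^ 2) (z ^ γ) ≤ (1 + z) ^ γ - 1 - γ * z := by
  have h1 : 0 < 1 + z := by linarith
  set q := γ - 1 with hq
  have hq0 : 0 < q := by linarith
  -- `(1 + z) ^ (-q) ≤ 1 - q z / (1 + z)`
  have hb : (1 + z) ^ (-q) ≤ 1 - q * (z / (1 + z)) := by
    have := rpow_one_add_le_one_add_mul_self (s := -(z / (1 + z))) (p := q)
      (by rw [neg_le_neg_iff, div_le_one h1]; linarith) hq0.le (by linarith)
    rw [show 1 + -(z / (1 + z)) = (1 + z)⁻¹ by field_simp; ring, Real.inv_rpow h1.le,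
      ← Real.rpow_neg h1.le] at this
    linarith
  have hγq : (1 + z) ^ γ = (1 + z) ^ 2 * (1 + z) ^ (γ - 2) := by
    rw [← Real.rpow_natCast, ← Real.rpow_add h1]; congr 1; push_cast; ring
  have hqq : (1 + z) ^ (γ - 2) * (1 + z) * (1 + z) ^ (-q) = 1 := by
    nth_rewrite 2 [← Real.rpow_one (1 + z)]
    rw [← Real.rpow_add h1, ← Real.rpow_add h1, hq]
    rw [show γ - 2 + 1 + -(γ - 1) = 0 by ring, Real.rpow_zero]
  have hX : 0 < (1 + z) ^ (γ - 2) := Real.rpow_pos_of_pos h1 _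
  have key : q ^ 2 * z ^ 2 * (1 + z) ^ (γ - 2) ≤ (1 + z) ^ γ - 1 - γ * z := by
    -- multiply the Bernoulli inequality by `(1 + γ z) (1 + z) ^ (γ - 1)`
    have h2 : (1 + γ * z) * ((1 + z) ^ (γ - 2) * (1 + z) * (1 + z) ^ (-q))
        ≤ (1 + γ * z) * ((1 + z) ^ (γ - 2) * (1 + z) * (1 - q * (z / (1 + z)))) := by
      gcongr
    rw [hqq, mul_one] at h2
    have h3 : (1 + z) ^ (γ - 2) * (1 + z) * (1 - q * (z / (1 + z)))
        = (1 + z) ^ (γ - 2) * (1 + z - q * z) := by field_simp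
    rw [h3] at h2
    have h4 : (1 + γ * z) * ((1 + z) ^ (γ - 2) * (1 + z - q * z))
        = (1 + z) ^ γ - q ^ 2 * z ^ 2 * (1 + z) ^ (γ - 2) := by
      rw [hγq, hq]; ring
    linarith
  refine le_trans ?_ key
  rcases le_total z 1 with h | h
  · have h5 : (1:ℝ) / 2 ≤ (1 + z) ^ (γ - 2) := by
      calc (1:ℝ) / 2 = 2 ^ (-1:ℝ) := by rw [Real.rpow_neg_one]; norm_num
        _ ≤ 2 ^ (γ - 2) := Real.rpow_le_rpow_of_exponent_le (by norm_num) (by linarith)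
        _ ≤ _ := Real.rpow_le_rpow_of_nonpos h1 (by linarith) (by linarith)
    have h6 := min_le_left (z ^ 2) (z ^ γ)
    calc q ^ 2 / 2 * min (z ^ 2) (z ^ γ) ≤ q ^ 2 / 2 * z ^ 2 := by gcongr
      _ = q ^ 2 * z ^ 2 * (1 / 2) := by ring
      _ ≤ _ := by gcongr
  · have hz0 : 0 < z := by linarith
    have h5 : (1:ℝ) / 2 * z ^ (γ - 2) ≤ (1 + z) ^ (γ - 2) := by
      calc (1:ℝ) / 2 * z ^ (γ - 2) = 2 ^ (-1:ℝ) * z ^ (γ - 2) := by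
            rw [Real.rpow_neg_one]; norm_num
        _ ≤ 2 ^ (γ - 2) * z ^ (γ - 2) := by
            gcongr
            · norm_num
            · linarith
        _ = (2 * z) ^ (γ - 2) := (Real.mul_rpow (by norm_num) hz0.le).symm
        _ ≤ _ := Real.rpow_le_rpow_of_nonpos h1 (by linarith) (by linarith)
    have h6 := min_le_right (z ^ 2) (z ^ γ)
    have h7 : z ^ γ = z ^ 2 * z ^ (γ - 2) := by
      rw [← Real.rpow_natCast, ← Real.rpow_add hz0]; congr 1; push_cast; ring
    calc q ^ 2 / 2 * min (z ^ 2) (z ^ γ) ≤ q ^ 2 / 2 * z ^ γ := by gcongr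
      _ = q ^ 2 * z ^ 2 * (1 / 2 * z ^ (γ - 2)) := by rw [h7]; ring
      _ ≤ _ := by gcongr

/-- The speed of sound of the background state. -/
def Params.sound (P : Params) : ℝ := Real.sqrt (P.A * P.γ * P.rhoBar ^ (P.γ - 1))

theorem Params.sound_sq (P : Params) : P.sound ^ 2 = P.A * P.γ * P.rhoBar ^ (P.γ - 1) := by
  have := P.A_pos
  have := P.rhoBar_pos
  have := P.one_lt_γ
  exact Real.sq_sqrt (by positivity)

theorem Params.sound_pos (P : Params) : 0 < P.sound := by
  have := P.A_pos
  have := P.rhoBar_pos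
  have := P.one_lt_γ
  exact Real.sqrt_pos.2 (by positivity)

/-- The excess of the pressure over its linearization at the background density. -/
def Params.excess (P : Params) (ρ : ℝ) : ℝ :=
  P.pressure ρ - P.pressure P.rhoBar - P.sound ^ 2 * (ρ - P.rhoBar)

theorem Params.excess_eq (P : Params) {ρ : ℝ} (hρ : 0 ≤ ρ) :
    P.excess ρ = P.A * P.rhoBar ^ P.γ *
      ((1 + (ρ - P.rhoBar) / P.rhoBar) ^ P.γ - 1 - P.γ * ((ρ - P.rhoBar) / P.rhoBar)) := by
  have hr := P.rhoBar_pos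
  rw [show 1 + (ρ - P.rhoBar) / P.rhoBar = ρ / P.rhoBar by field_simp; ring,
    Real.div_rpow hρ hr.le]
  unfold Params.excess Params.pressure
  rw [P.sound_sq, Real.rpow_sub_one hr.ne']
  have : 0 < P.rhoBar ^ P.γ := by positivity
  field_simp

theorem Params.excess_nonneg (P : Params) {ρ : ℝ} (hρ : 0 ≤ ρ) : 0 ≤ P.excess ρ := by
  have hr := P.rhoBar_pos
  have hA := P.A_pos
  rw [P.excess_eq hρ]
  have h := one_add_mul_self_le_rpow_one_add (s := (ρ - P.rhoBar) / P.rhoBar) (p := P.γ)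
    (by rw [le_div_iff₀ hr]; linarith) P.one_lt_γ.le
  have h1 : 0 < P.A * P.rhoBar ^ P.γ := by positivity
  exact mul_nonneg h1.le (by linarith)

/-- The exponent of the nonlinearity. -/
def Params.expo (P : Params) : ℝ := min P.γ 2

/-- The quantitative convexity in the variable `z = y / ρ̄`. The minimum is needed because a density
perturbation may be small or large, and for `γ < 2` the growth at infinity is subquadratic. -/
theorem Params.exists_excess_ge (P : Params) : ∃ k > 0, ∀ y, 0 ≤ y →
    k * min (y ^ 2) (y ^ P.expo) ≤ P.excess (P.rhoBar + y) := by
  have hr := P.rhoBar_pos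
  have hA := P.A_pos
  have hγ := P.one_lt_γ
  have h1 : 0 < P.A * P.rhoBar ^ P.γ := by positivity
  have hp0 : 1 < P.expo := lt_min hγ (by norm_num)
  obtain ⟨k, hk, H⟩ : ∃ k > 0, ∀ z, 0 ≤ z →
      k * min (z ^ 2) (z ^ P.expo) ≤ (1 + z) ^ P.γ - 1 - P.γ * z := by
    rcases le_total P.γ 2 with h | h
    · refine ⟨(P.γ - 1) ^ 2 / 2, by have : 0 < P.γ - 1 := by linarith
                                    positivity, fun z hz => ?_⟩
      have := one_add_rpow_sub_ge_of_le_two hγ h hz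
      rwa [Params.expo, min_eq_left h]
    · refine ⟨1, one_pos, fun z hz => ?_⟩
      refine le_trans ?_ (one_add_rpow_sub_ge_of_two_le h hz)
      rw [one_mul]; exact min_le_left _ _
  set m := min ((1 / P.rhoBar) ^ 2) ((1 / P.rhoBar) ^ P.expo) with hm
  have hm0 : 0 < m := lt_min (by positivity) (by positivity)
  refine ⟨P.A * P.rhoBar ^ P.γ * (k * m), by positivity, fun y hy => ?_⟩
  rw [P.excess_eq (by linarith), add_sub_cancel_left, mul_assoc]
  refine mul_le_mul_of_nonneg_left (le_trans ?_ (H (y / P.rhoBar) (by positivity))) h1.le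
  rw [mul_assoc]
  refine mul_le_mul_of_nonneg_left ?_ hk.le
  have e1 : (y / P.rhoBar) ^ 2 = (1 / P.rhoBar) ^ 2 * y ^ 2 := by rw [← mul_pow]; ring
  have e2 : (y / P.rhoBar) ^ P.expo = (1 / P.rhoBar) ^ P.expo * y ^ P.expo := by
    rw [← Real.mul_rpow (by positivity) hy]; congr 1; ring
  rw [e1, e2]
  refine le_min ?_ ?_
  · exact mul_le_mul (min_le_left _ _) (min_le_left _ _)
      (le_min (by positivity) (by positivity)) (by positivity)
  · exact mul_le_mul (min_le_right _ _) (min_le_right _ _)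
      (le_min (by positivity) (by positivity)) (by positivity)

end DampedEuler
end

noncomputable section
namespace DampedEuler

open MeasureTheory Filter Topology

/-! ### Integrals depending on a parameter -/

section Param

variable {d : ℕ}

theorem integrable_of_bound_on {h : Space d → ℝ} {K : Set (Space d)} (hK : IsCompact K) {C : ℝ}
    (hm : AEStronglyMeasurable h volume) (hb : ∀ x ∈ K, |h x| ≤ C) (h0 : ∀ x ∉ K, h x = 0) :
    Integrable h := by
  have hi : Integrable (K.indicator fun _ => C) :=
    (integrable_indicator_iff hK.measurableSet).2
      (integrableOn_const hK.measure_lt_top.ne)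
  refine hi.mono' hm (Eventually.of_forall fun x => ?_)
  by_cases hx : x ∈ K
  · simpa [hx] using hb x hx
  · simp [hx, h0 x hx]

/-- A tube argument: the strict bound at each point of the compact set persists nearby, and
compactness makes the neighbourhood of the parameter uniform. It provides the dominating constants
for integrals over a fixed compact set. -/
theorem eventually_bound_of_continuous {X : Type*} [TopologicalSpace X] {f : X → Space d → ℝ}
    (hf : Continuous (Function.uncurry f)) {K : Set (Space d)} (hK : IsCompact K) (x₀ : X) :
    ∃ C, 0 ≤ C ∧ ∀ᶠ x in 𝓝 x₀, ∀ y ∈ K, |f x y| ≤ C := by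
  have hf0 : Continuous (f x₀) := hf.comp (by fun_prop : Continuous fun y => (x₀, y))
  obtain ⟨C, hC⟩ := hK.exists_bound_of_continuousOn hf0.continuousOn
  refine ⟨|C| + 1, by positivity, ?_⟩
  refine hK.eventually_forall_of_forall_eventually fun y hy => ?_
  have h1 : |f x₀ y| < |C| + 1 := by
    have := hC y hy
    rw [Real.norm_eq_abs] at this
    linarith [le_abs_self C]
  have := hf.abs.continuousAt.eventually_lt (x₀ := (x₀, y)) continuousAt_const h1
  filter_upwards [this] with z hz
  exact hz.le

/-- Continuity of an integral with a discontinuous weight `g`. -/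
theorem continuous_integral_weight {X : Type*} [TopologicalSpace X] [FirstCountableTopology X]
    {f g : X → Space d → ℝ} {K : Set (Space d)} (hK : IsCompact K)
    (hf : Continuous (Function.uncurry f)) (hf0 : ∀ x, ∀ y ∉ K, f x y = 0)
    (hg : ∀ x, Measurable (g x)) (hgb : ∀ x₀, ∃ C, ∀ᶠ x in 𝓝 x₀, ∀ y ∈ K, |g x y| ≤ C)
    (hgc : ∀ x₀, ∀ᵐ y, ContinuousAt (fun x => g x y) x₀) :
    Continuous fun x => ∫ y, g x y * f x y := by
  refine continuous_iff_continuousAt.2 fun x₀ => ?_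
  obtain ⟨C, hC0, hC⟩ := eventually_bound_of_continuous hf hK x₀
  obtain ⟨C', hC'⟩ := hgb x₀
  have hfx : ∀ x, Continuous (f x) := fun x => hf.comp (by fun_prop : Continuous fun y => (x, y))
  have hfy : ∀ y, Continuous fun x => f x y := fun y =>
    hf.comp (by fun_prop : Continuous fun x => (x, y))
  refine MeasureTheory.continuousAt_of_dominated (bound := K.indicator fun _ => |C'| * C) ?_ ?_ ?_ ?_
  · exact Eventually.of_forall fun x => (hg x).aestronglyMeasurable.mul
      (hfx x).aestronglyMeasurable
  · filter_upwards [hC, hC'] with x hx hx'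
    refine Eventually.of_forall fun y => ?_
    by_cases hy : y ∈ K
    · simp only [hy, Set.indicator_of_mem, Real.norm_eq_abs, abs_mul]
      exact mul_le_mul ((hx' y hy).trans (le_abs_self _)) (hx y hy) (abs_nonneg _) (abs_nonneg _)
    · simp [hy, hf0 x y hy]
  · exact (integrable_indicator_iff hK.measurableSet).2 (integrableOn_const hK.measure_lt_top.ne)
  · filter_upwards [hgc x₀] with y hy
    exact hy.mul (hfy y).continuousAt

theorem hasDerivAt_time {f : ℝ → Space d → ℝ} {t : ℝ} {x : Space d}
    (hf : DifferentiableAt ℝ (Function.uncurry f) (t, x)) :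
    HasDerivAt (fun s => f s x) (fderiv ℝ (Function.uncurry f) (t, x) (1, 0)) t := by
  have h1 : HasDerivAt (fun s : ℝ => (s, x)) ((1 : ℝ), (0 : Space d)) t :=
    (hasDerivAt_id t).prodMk (hasDerivAt_const t x)
  exact hf.hasFDerivAt.comp_hasDerivAt t h1

/-- Differentiation of an integral with a Lipschitz weight `g`. -/
theorem hasDerivAt_integral_weight {f g : ℝ → Space d → ℝ} {g' : Space d → ℝ} {t₀ a b : ℝ}
    {K : Set (Space d)} (hK : IsCompact K) (ht₀ : t₀ ∈ Set.Ioo a b)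
    (hf : ∀ t ∈ Set.Ioo a b, ∀ x, ContDiffAt ℝ 1 (Function.uncurry f) (t, x))
    (hf0 : ∀ t ∈ Set.Ioo a b, ∀ x ∉ K, f t x = 0)
    (hg : ∀ t, Measurable (g t)) (hg' : Measurable g') {Cg Lg : ℝ}
    (hgb : ∀ t ∈ Set.Ioo a b, ∀ x ∈ K, |g t x| ≤ Cg)
    (hgL : ∀ s ∈ Set.Ioo a b, ∀ t ∈ Set.Ioo a b, ∀ x ∈ K, |g s x - g t x| ≤ Lg * |s - t|)
    (hgd : ∀ᵐ x, HasDerivAt (fun t => g t x) (g' x) t₀) :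
    HasDerivAt (fun t => ∫ x, g t x * f t x)
      (∫ x, (g' x * f t₀ x + g t₀ x * deriv (fun s => f s x) t₀)) t₀ := by
  obtain ⟨η, hη, hηs⟩ : ∃ η > 0, Set.Icc (t₀ - η) (t₀ + η) ⊆ Set.Ioo a b := by
    refine ⟨min (t₀ - a) (b - t₀) / 2, ?_, ?_⟩
    · have : 0 < min (t₀ - a) (b - t₀) := lt_min (by linarith [ht₀.1]) (by linarith [ht₀.2])
      positivity
    · have h0 : 0 < min (t₀ - a) (b - t₀) := lt_min (by linarith [ht₀.1]) (by linarith [ht₀.2])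
      have h1 := min_le_left (t₀ - a) (b - t₀)
      have h2 := min_le_right (t₀ - a) (b - t₀)
      intro s hs
      exact ⟨by linarith [hs.1], by linarith [hs.2]⟩
  set I := Set.Icc (t₀ - η) (t₀ + η) with hI
  have hIn : I ∈ 𝓝 t₀ := Icc_mem_nhds (by linarith) (by linarith)
  have hdf : ∀ t ∈ I, ∀ x, HasDerivAt (fun s => f s x)
      (fderiv ℝ (Function.uncurry f) (t, x) (1, 0)) t := fun t ht x =>
    hasDerivAt_time ((hf t (hηs ht) x).differentiableAt one_ne_zero)
  have hcf : ContinuousOn (Function.uncurry f) (I ×ˢ K) := fun z hz =>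
    (hf z.1 (hηs hz.1) z.2).continuousAt.continuousWithinAt
  have hcd : ContinuousOn (fun z : ℝ × Space d => fderiv ℝ (Function.uncurry f) z (1, 0))
      (I ×ˢ K) := fun z hz =>
    (((hf z.1 (hηs hz.1) z.2).fderiv_right (m := 0) (by norm_num)).continuousAt.clm_apply
      continuousAt_const).continuousWithinAt
  obtain ⟨C0, hC0⟩ := (isCompact_Icc.prod hK).exists_bound_of_continuousOn hcf
  obtain ⟨C1, hC1⟩ := (isCompact_Icc.prod hK).exists_bound_of_continuousOn hcd
  have hcx : ∀ t ∈ I, Continuous (f t) := fun t ht => continuous_iff_continuousAt.2 fun x =>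
    ((hf t (hηs ht) x).continuousAt.comp (f := fun y => (t, y)) (by fun_prop) :)
  have hcdx : Continuous fun x => deriv (fun s => f s x) t₀ := by
    have ht : t₀ ∈ I := mem_of_mem_nhds hIn
    have : (fun x => deriv (fun s => f s x) t₀)
        = fun x => fderiv ℝ (Function.uncurry f) (t₀, x) (1, 0) :=
      funext fun x => (hdf t₀ ht x).deriv
    rw [this]
    refine continuous_iff_continuousAt.2 fun x => ?_
    exact (((hf t₀ ht₀ x).fderiv_right (m := 0) (by norm_num)).continuousAt.clm_apply
      continuousAt_const).comp (f := fun y => (t₀, y))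
        (g := fun z : ℝ × Space d => fderiv ℝ (Function.uncurry f) z (1, 0)) (by fun_prop)
  have ht₀I : t₀ ∈ I := mem_of_mem_nhds hIn
  refine (hasDerivAt_integral_of_dominated_loc_of_lip
    (bound := K.indicator fun _ => Cg * C1 + Lg * C0) hIn ?_ ?_ ?_ ?_ ?_ ?_).2
  · filter_upwards [hIn] with t ht
    exact (hg t).aestronglyMeasurable.mul (hcx t ht).aestronglyMeasurable
  · refine integrable_of_bound_on hK (C := Cg * C0)
      ((hg t₀).aestronglyMeasurable.mul (hcx t₀ ht₀I).aestronglyMeasurable) ?_ ?_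
    · intro x hx
      rw [abs_mul]
      have h1 := hgb t₀ ht₀ x hx
      exact mul_le_mul h1 (hC0 (t₀, x) ⟨ht₀I, hx⟩) (abs_nonneg _) ((abs_nonneg _).trans h1)
    · intro x hx
      simp [hf0 t₀ ht₀ x hx]
  · exact (hg'.aestronglyMeasurable.mul (hcx t₀ ht₀I).aestronglyMeasurable).add
      ((hg t₀).aestronglyMeasurable.mul hcdx.aestronglyMeasurable)
  · refine Eventually.of_forall fun x => LipschitzOnWith.of_dist_le_mul fun s hs t ht => ?_
    rw [Real.dist_eq, Real.dist_eq]
    by_cases hx : x ∈ K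
    · simp only [hx, Set.indicator_of_mem]
      have hL : |f s x - f t x| ≤ C1 * |s - t| := by
        have := (convex_Icc (t₀ - η) (t₀ + η)).norm_image_sub_le_of_norm_hasDerivWithin_le
          (f := fun s => f s x) (C := C1) (fun r hr => (hdf r hr x).hasDerivWithinAt)
          (fun r hr => hC1 (r, x) ⟨hr, hx⟩) ht hs
        simpa using this
      have h1 := hgb s (hηs hs) x hx
      have h2 := hgL s (hηs hs) t (hηs ht) x hx
      have h3 : |f t x| ≤ C0 := hC0 (t, x) ⟨ht, hx⟩
      calc |g s x * f s x - g t x * f t x|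
          = |g s x * (f s x - f t x) + (g s x - g t x) * f t x| := by congr 1; ring
        _ ≤ |g s x| * |f s x - f t x| + |g s x - g t x| * |f t x| := by
            refine (abs_add_le _ _).trans_eq ?_
            rw [abs_mul, abs_mul]
        _ ≤ Cg * (C1 * |s - t|) + Lg * |s - t| * C0 := by
            have := (abs_nonneg _).trans h1
            have := (abs_nonneg _).trans h2
            gcongr
        _ = (Cg * C1 + Lg * C0) * |s - t| := by ring
        _ ≤ _ := by
            gcongr
            exact le_abs_self _
    · simp [hx, hf0 s (hηs hs) x hx, hf0 t (hηs ht) x hx]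
  · exact (integrable_indicator_iff hK.measurableSet).2 (integrableOn_const hK.measure_lt_top.ne)
  · filter_upwards [hgd] with x hx
    have := hx.mul (hdf t₀ ht₀I x)
    rwa [← (hdf t₀ ht₀I x).deriv] at this

theorem hasDerivAt_space {f : Space d → ℝ} {x : Space d} (hf : DifferentiableAt ℝ f x)
    (j : Fin d) :
    HasDerivAt (fun s : ℝ => f (x + s • EuclideanSpace.single j (1:ℝ))) (pderiv j f x) 0 := by
  have := hf.hasFDerivAt.hasLineDerivAt (EuclideanSpace.single j (1:ℝ))
  exact this

theorem pderiv_eq_of_hasDerivAt {f : Space d → ℝ} {x : Space d} (hf : DifferentiableAt ℝ f x)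
    {j : Fin d} {f' : ℝ}
    (h : HasDerivAt (fun s : ℝ => f (x + s • EuclideanSpace.single j (1:ℝ))) f' 0) :
    pderiv j f x = f' :=
  (hasDerivAt_space hf j).unique h

/-- Integration by parts against a differentiable compactly supported function. -/
theorem integral_mul_pderiv {f g : Space d → ℝ} {K : Set (Space d)} (hK : IsCompact K)
    (hf : ContDiff ℝ 1 f) (hg : ContDiff ℝ 1 g) (hf0 : ∀ x ∉ K, f x = 0) (j : Fin d) :
    ∫ x, f x * pderiv j g x = -∫ x, pderiv j f x * g x := by
  have hcs : HasCompactSupport f := HasCompactSupport.intro hK hf0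
  have h1 : Continuous fun x => fderiv ℝ f x (EuclideanSpace.single j 1) :=
    (hf.continuous_fderiv one_ne_zero).clm_apply continuous_const
  have h2 : Continuous fun x => fderiv ℝ g x (EuclideanSpace.single j 1) :=
    (hg.continuous_fderiv one_ne_zero).clm_apply continuous_const
  refine integral_mul_fderiv_eq_neg_fderiv_mul_of_integrable ?_ ?_ ?_ ?_ ?_
  · refine (h1.mul hg.continuous).integrable_of_hasCompactSupport ?_
    exact (hcs.fderiv_apply (𝕜 := ℝ) _).mul_right
  · exact (hf.continuous.mul h2).integrable_of_hasCompactSupport hcs.mul_right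
  · exact (hf.continuous.mul hg.continuous).integrable_of_hasCompactSupport hcs.mul_right
  · exact fun x _ => (hf.differentiable one_ne_zero) x
  · exact fun x _ => (hg.differentiable one_ne_zero) x

end Param

end DampedEuler
end

noncomputable section
namespace DampedEuler

open MeasureTheory Filter Topology

/-! ### Smooth solutions -/

section Smooth

variable {d : ℕ} {P : Params} {ε : ℝ} {ρ₀ : Space d → ℝ} {u₀ : Space d → Space d} {T : ℝ}
  {ρ : ℝ → Space d → ℝ} {u : ℝ → Space d → Space d}

/-- Time truncated to `[0, T]`. -/
def clamp (T t : ℝ) : ℝ := max 0 (min t T)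

theorem continuous_clamp (T : ℝ) : Continuous (clamp T) := by unfold clamp; fun_prop

theorem clamp_mem {T t : ℝ} (hT : 0 ≤ T) : clamp T t ∈ Set.Icc 0 T :=
  ⟨le_max_left _ _, max_le hT (min_le_right _ _)⟩

theorem clamp_eq {T t : ℝ} (ht : t ∈ Set.Icc 0 T) : clamp T t = t := by
  unfold clamp; rw [min_eq_left ht.2, max_eq_right ht.1]

theorem clamp_eventuallyEq {T t : ℝ} (ht : t ∈ Set.Ioo 0 T) : clamp T =ᶠ[𝓝 t] id := by
  filter_upwards [Ioo_mem_nhds ht.1 ht.2] with s hs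
  exact clamp_eq ⟨hs.1.le, hs.2.le⟩

/-- The solution is controlled only on `[0, T)`. Freezing time outside `[0, T₁]` gives functions
that are continuous for all times, to which statements about global continuity apply. -/
theorem continuous_clamped {X : Type*} [TopologicalSpace X] {f : ℝ × Space d → X} {T T₁ : ℝ}
    (hf : ContinuousOn f (Set.Ico 0 T ×ˢ Set.univ)) (h0 : 0 ≤ T₁) (hT : T₁ < T) :
    Continuous fun z : ℝ × Space d => f (clamp T₁ z.1, z.2) := by
  refine hf.comp_continuous ?_ ?_
  · exact ((continuous_clamp T₁).comp continuous_fst).prodMk continuous_snd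
  · intro z
    have := clamp_mem (t := z.1) h0
    exact ⟨⟨this.1, this.2.trans_lt hT⟩, trivial⟩

namespace IsSmoothSolution

variable (S : IsSmoothSolution P ε ρ₀ u₀ T ρ u)
include S

theorem contDiffAt_density {t : ℝ} (ht : t ∈ Set.Ioo 0 T) (x : Space d) :
    ContDiffAt ℝ ∞ (fun z : ℝ × Space d => ρ z.1 z.2) (t, x) :=
  S.smooth_density.contDiffAt (prod_mem_nhds (Ico_mem_nhds ht.1 ht.2) univ_mem)

theorem contDiffAt_velocity {t : ℝ} (ht : t ∈ Set.Ioo 0 T) (x : Space d) (i : Fin d) :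
    ContDiffAt ℝ ∞ (fun z : ℝ × Space d => u z.1 z.2 i) (t, x) :=
  contDiffAt_euclidean.1
    (S.smooth_velocity.contDiffAt (prod_mem_nhds (Ico_mem_nhds ht.1 ht.2) univ_mem)) i

theorem contDiffAt_density_slice {t : ℝ} (ht : t ∈ Set.Ioo 0 T) (x : Space d) :
    ContDiffAt ℝ ∞ (ρ t) x :=
  (S.contDiffAt_density ht x).comp (f := fun y : Space d => (t, y)) x
    (contDiffAt_const.prodMk contDiffAt_id)

theorem contDiffAt_velocity_slice {t : ℝ} (ht : t ∈ Set.Ioo 0 T) (x : Space d) (i : Fin d) :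
    ContDiffAt ℝ ∞ (fun y => u t y i) x :=
  (S.contDiffAt_velocity ht x i).comp (f := fun y : Space d => (t, y)) x
    (contDiffAt_const.prodMk contDiffAt_id)

theorem continuous_density {T₁ : ℝ} (h0 : 0 ≤ T₁) (hT : T₁ < T) :
    Continuous fun z : ℝ × Space d => ρ (clamp T₁ z.1) z.2 :=
  continuous_clamped S.smooth_density.continuousOn h0 hT

theorem continuous_velocity {T₁ : ℝ} (h0 : 0 ≤ T₁) (hT : T₁ < T) :
    Continuous fun z : ℝ × Space d => u (clamp T₁ z.1) z.2 :=
  continuous_clamped S.smooth_velocity.continuousOn h0 hT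

theorem hasDerivAt_density_time {t : ℝ} (ht : t ∈ Set.Ioo 0 T) (x : Space d) :
    HasDerivAt (fun s => ρ s x) (deriv (fun s => ρ s x) t) t :=
  (hasDerivAt_time (f := ρ)
    ((S.contDiffAt_density ht x).differentiableAt (by simp))).differentiableAt.hasDerivAt

theorem hasDerivAt_velocity_time {t : ℝ} (ht : t ∈ Set.Ioo 0 T) (x : Space d) (i : Fin d) :
    HasDerivAt (fun s => u s x i) (deriv (fun s => u s x i) t) t :=
  (hasDerivAt_time (f := fun s x => u s x i)
    ((S.contDiffAt_velocity ht x i).differentiableAt (by simp))).differentiableAt.hasDerivAt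

theorem hasDerivAt_density_space {t : ℝ} (ht : t ∈ Set.Ioo 0 T) (x : Space d) (j : Fin d) :
    HasDerivAt (fun s : ℝ => ρ t (x + s • EuclideanSpace.single j (1:ℝ))) (pderiv j (ρ t) x) 0 :=
  hasDerivAt_space ((S.contDiffAt_density_slice ht x).differentiableAt (by simp)) j

theorem hasDerivAt_velocity_space {t : ℝ} (ht : t ∈ Set.Ioo 0 T) (x : Space d) (i j : Fin d) :
    HasDerivAt (fun s : ℝ => u t (x + s • EuclideanSpace.single j (1:ℝ)) i)
      (pderiv j (fun y => u t y i) x) 0 :=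
  hasDerivAt_space ((S.contDiffAt_velocity_slice ht x i).differentiableAt (by simp)) j

/-- The equation of mass conservation in non-divergence form. -/
theorem mass_expanded {t : ℝ} (ht : t ∈ Set.Ioo 0 T) (x : Space d) :
    deriv (fun s => ρ s x) t
      + ∑ j, (pderiv j (ρ t) x * u t x j + ρ t x * pderiv j (fun y => u t y j) x) = 0 := by
  rw [← S.mass t ht x]
  congr 1
  refine Finset.sum_congr rfl fun j _ => ?_
  refine (pderiv_eq_of_hasDerivAt ?_ ?_).symm
  · exact ((S.contDiffAt_density_slice ht x).differentiableAt (by simp)).mul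
      ((S.contDiffAt_velocity_slice ht x j).differentiableAt (by simp))
  · have := (S.hasDerivAt_density_space ht x j).mul (S.hasDerivAt_velocity_space ht x j j)
    exact this.congr_deriv (by simp)

theorem hasDerivAt_pressure_space {t : ℝ} (ht : t ∈ Set.Ioo 0 T) (x : Space d) (j : Fin d) :
    pderiv j (fun y => P.pressure (ρ t y)) x
      = P.A * P.γ * ρ t x ^ (P.γ - 1) * pderiv j (ρ t) x := by
  have hpos := S.density_pos t ⟨ht.1.le, ht.2⟩ x
  have hd : DifferentiableAt ℝ (ρ t) x :=
    (S.contDiffAt_density_slice ht x).differentiableAt (by simp)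
  refine pderiv_eq_of_hasDerivAt ?_ ?_
  · exact (hd.rpow_const (Or.inl hpos.ne')).const_mul _
  · have h := S.hasDerivAt_density_space ht x j
    have h0 : ρ t (x + (0:ℝ) • EuclideanSpace.single j (1:ℝ)) = ρ t x := by simp
    refine ((h.rpow_const (p := P.γ) (Or.inl (by rw [h0]; exact hpos.ne'))).const_mul
      P.A).congr_deriv ?_
    rw [h0]; ring

/-- The momentum equation in non-conservative form. -/
theorem momentum_expanded {t : ℝ} (ht : t ∈ Set.Ioo 0 T) (x : Space d) (i : Fin d) :
    ρ t x * deriv (fun s => u s x i) t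
      + ρ t x * (∑ j, u t x j * pderiv j (fun y => u t y i) x)
      + P.A * P.γ * ρ t x ^ (P.γ - 1) * pderiv i (ρ t) x
      = -(P.damping t * (ρ t x * u t x i)) := by
  have hm := S.momentum t ht x i
  have hmass := S.mass_expanded ht x
  have hprod : deriv (fun s => ρ s x * u s x i) t
      = deriv (fun s => ρ s x) t * u t x i + ρ t x * deriv (fun s => u s x i) t :=
    ((S.hasDerivAt_density_time ht x).mul (S.hasDerivAt_velocity_time ht x i)).deriv
  rw [S.hasDerivAt_pressure_space ht x i, hprod] at hm
  have hsum : ∑ j, pderiv j (fun y => ρ t y * u t y i * u t y j) x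
      = (∑ j, (pderiv j (ρ t) x * u t x j + ρ t x * pderiv j (fun y => u t y j) x)) * u t x i
        + ρ t x * ∑ j, u t x j * pderiv j (fun y => u t y i) x := by
    rw [Finset.sum_mul, Finset.mul_sum, ← Finset.sum_add_distrib]
    refine Finset.sum_congr rfl fun j _ => ?_
    refine pderiv_eq_of_hasDerivAt ?_ ?_
    · exact (((S.contDiffAt_density_slice ht x).differentiableAt (by simp)).mul
        ((S.contDiffAt_velocity_slice ht x i).differentiableAt (by simp))).mul
        ((S.contDiffAt_velocity_slice ht x j).differentiableAt (by simp))
    · have := ((S.hasDerivAt_density_space ht x j).mul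
        (S.hasDerivAt_velocity_space ht x i j)).mul (S.hasDerivAt_velocity_space ht x j j)
      refine this.congr_deriv ?_
      simp only [Pi.mul_apply, zero_smul, add_zero]
      ring
  rw [hsum] at hm
  linear_combination hm - u t x i * hmass

end IsSmoothSolution

end Smooth

/-! ### The entropy -/

/-- The derivative of the internal energy relative to the background state. -/
def Params.enthalpy (P : Params) (r : ℝ) : ℝ :=
  P.A * P.γ / (P.γ - 1) * (r ^ (P.γ - 1) - P.rhoBar ^ (P.γ - 1))

/-- The internal energy relative to the background state. -/
def Params.internal (P : Params) (r : ℝ) : ℝ := P.excess r / (P.γ - 1)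

theorem Params.hasDerivAt_internal (P : Params) {r : ℝ} (hr : 0 < r) :
    HasDerivAt P.internal (P.enthalpy r) r := by
  have hγ : P.γ - 1 ≠ 0 := by have := P.one_lt_γ; linarith
  unfold Params.internal Params.excess Params.pressure Params.enthalpy
  have h1 := (Real.hasDerivAt_rpow_const (p := P.γ) (Or.inl hr.ne')).const_mul P.A
  have h2 := ((hasDerivAt_id r).sub_const P.rhoBar).const_mul (P.sound ^ 2)
  refine (((h1.sub_const (P.A * P.rhoBar ^ P.γ)).sub h2).div_const (P.γ - 1)).congr_deriv ?_
  rw [P.sound_sq]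
  field_simp

theorem Params.hasDerivAt_enthalpy (P : Params) {r : ℝ} (hr : 0 < r) :
    HasDerivAt P.enthalpy (P.A * P.γ * r ^ (P.γ - 2)) r := by
  have hγ : P.γ - 1 ≠ 0 := by have := P.one_lt_γ; linarith
  unfold Params.enthalpy
  refine (((Real.hasDerivAt_rpow_const (p := P.γ - 1) (Or.inl hr.ne')).sub_const
    (P.rhoBar ^ (P.γ - 1))).const_mul (P.A * P.γ / (P.γ - 1))).congr_deriv ?_
  rw [show P.γ - 1 - 1 = P.γ - 2 by ring]
  field_simp

theorem Params.internal_nonneg (P : Params) {r : ℝ} (hr : 0 ≤ r) : 0 ≤ P.internal r :=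
  div_nonneg (P.excess_nonneg hr) (by have := P.one_lt_γ; linarith)

/-- Strict convexity of the pressure, in the form of the strict Bernoulli inequality; vanishing
energy therefore identifies the background state. -/
theorem Params.eq_rhoBar_of_internal_eq_zero (P : Params) {r : ℝ} (hr : 0 ≤ r)
    (h : P.internal r = 0) : r = P.rhoBar := by
  by_contra hne
  have hγ := P.one_lt_γ
  have hb := P.rhoBar_pos
  have hA := P.A_pos
  have h1 : P.excess r = 0 := by
    unfold Params.internal at h
    rcases div_eq_zero_iff.1 h with h | h
    · exact h
    · linarith
  rw [P.excess_eq hr] at h1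
  have h2 := one_add_mul_self_lt_rpow_one_add (s := (r - P.rhoBar) / P.rhoBar) (p := P.γ)
    (by rw [le_div_iff₀ hb]; linarith) (div_ne_zero (sub_ne_zero.2 hne) hb.ne') hγ
  have h3 : 0 < P.A * P.rhoBar ^ P.γ := by positivity
  rcases mul_eq_zero.1 h1 with h | h <;> linarith

theorem Params.internal_rhoBar (P : Params) : P.internal P.rhoBar = 0 := by
  simp [Params.internal, Params.excess]

theorem Params.enthalpy_rhoBar (P : Params) : P.enthalpy P.rhoBar = 0 := by
  simp [Params.enthalpy]

theorem Params.rpow_mul_self (P : Params) {r : ℝ} (hr : 0 < r) :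
    r * r ^ (P.γ - 2) = r ^ (P.γ - 1) := by
  rw [show P.γ - 1 = 1 + (P.γ - 2) by ring, Real.rpow_add hr, Real.rpow_one]

/-- Close to the background state, the enthalpy is controlled by the internal energy. -/
theorem Params.exists_enthalpy_sq_le (P : Params) {c' : ℝ} (hc' : P.sound < c') :
    ∃ ν > 0, ∀ r, 0 < r → |r - P.rhoBar| < ν →
      r * P.enthalpy r ^ 2 ≤ 2 * c' ^ 2 * P.internal r := by
  have hb := P.rhoBar_pos
  have hA := P.A_pos
  have hγ := P.one_lt_γ
  have hγ1 : 0 < P.γ - 1 := by linarith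
  have hs := P.sound_pos
  -- `φ` is the cofactor in `D' = enthalpy * φ` for the difference `D` of the two sides. At `ρ̄` it
  -- equals `2 (c'² - c²) > 0`, so nearby `D'` has the sign of `r - ρ̄` and `D` has its minimum,
  -- zero, at `ρ̄`.
  set φ : ℝ → ℝ := fun r => 2 * c' ^ 2 - P.enthalpy r - 2 * (r * (P.A * P.γ * r ^ (P.γ - 2)))
    with hφ
  have hφb : 0 < φ P.rhoBar := by
    simp only [hφ, P.enthalpy_rhoBar]
    have h1 : P.rhoBar * (P.A * P.γ * P.rhoBar ^ (P.γ - 2)) = P.sound ^ 2 := by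
      rw [P.sound_sq, ← P.rpow_mul_self hb]; ring
    rw [h1]
    nlinarith
  have hφc : ContinuousAt φ P.rhoBar := by
    have h1 := (P.hasDerivAt_enthalpy hb).continuousAt
    have h2 : ContinuousAt (fun r : ℝ => r ^ (P.γ - 2)) P.rhoBar :=
      Real.continuousAt_rpow_const _ _ (Or.inl hb.ne')
    fun_prop
  obtain ⟨ν, hν, H⟩ := Metric.eventually_nhds_iff.1 (hφc.eventually_const_lt hφb)
  set D : ℝ → ℝ := fun r => 2 * c' ^ 2 * P.internal r - r * P.enthalpy r ^ 2 with hD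
  have hDd : ∀ r, 0 < r → HasDerivAt D (P.enthalpy r * φ r) r := by
    intro r hr
    have h1 := P.hasDerivAt_internal hr
    have h2 := P.hasDerivAt_enthalpy hr
    refine ((h1.const_mul (2 * c' ^ 2)).sub ((hasDerivAt_id r).mul (h2.pow 2))).congr_deriv ?_
    simp only [hφ, id, Pi.pow_apply]
    push_cast
    ring
  have hDb : D P.rhoBar = 0 := by simp [hD, P.internal_rhoBar, P.enthalpy_rhoBar]
  have hcoef : 0 < P.A * P.γ / (P.γ - 1) := by positivity
  refine ⟨ν, hν, fun r hr hrν => ?_⟩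
  suffices h : 0 ≤ D r by
    simp only [hD] at h; linarith
  rw [← hDb]
  rcases le_total P.rhoBar r with hle | hle
  · have hm : MonotoneOn D (Set.Icc P.rhoBar r) := by
      refine monotoneOn_of_deriv_nonneg (convex_Icc _ _) ?_ ?_ ?_
      · exact fun s hs => (hDd s (hb.trans_le hs.1)).continuousAt.continuousWithinAt
      · intro s hs
        rw [interior_Icc] at hs
        exact (hDd s (hb.trans hs.1)).differentiableAt.differentiableWithinAt
      · intro s hs
        rw [interior_Icc] at hs
        rw [(hDd s (hb.trans hs.1)).deriv]
        refine mul_nonneg (mul_nonneg hcoef.le (sub_nonneg.2 ?_)) (H ?_).le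
        · exact Real.rpow_le_rpow hb.le hs.1.le hγ1.le
        · rw [Real.dist_eq, abs_of_pos (by linarith [hs.1])]
          rw [abs_of_nonneg (by linarith)] at hrν
          linarith [hs.2]
    exact hm ⟨le_rfl, hle⟩ ⟨hle, le_rfl⟩ hle
  · have hm : AntitoneOn D (Set.Icc r P.rhoBar) := by
      refine antitoneOn_of_deriv_nonpos (convex_Icc _ _) ?_ ?_ ?_
      · exact fun s hs => (hDd s (hr.trans_le hs.1)).continuousAt.continuousWithinAt
      · intro s hs
        rw [interior_Icc] at hs
        exact (hDd s (hr.trans hs.1)).differentiableAt.differentiableWithinAt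
      · intro s hs
        rw [interior_Icc] at hs
        have hs0 := hr.trans hs.1
        rw [(hDd s hs0).deriv]
        refine mul_nonpos_of_nonpos_of_nonneg
          (mul_nonpos_of_nonneg_of_nonpos hcoef.le (sub_nonpos.2 ?_)) (H ?_).le
        · exact Real.rpow_le_rpow hs0.le hs.2.le hγ1.le
        · rw [Real.dist_eq, abs_of_neg (by linarith [hs.2])]
          rw [abs_of_nonpos (by linarith)] at hrν
          linarith [hs.1]
    exact hm ⟨le_rfl, hle⟩ ⟨hle, le_rfl⟩ hle

/-- Close to the background state, the entropy flux is bounded by `C` times the entropy for every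
`C` larger than the speed of sound. -/
theorem Params.exists_flux_le (P : Params) {C : ℝ} (hC : P.sound < C) :
    ∃ ν > 0, ∀ r w, 0 < r → |r - P.rhoBar| < ν → 0 ≤ w → w < ν →
      w * (1 / 2 * r * w ^ 2 + r * |P.enthalpy r|) ≤
        C * (1 / 2 * r * w ^ 2 + P.internal r) := by
  have hs := P.sound_pos
  set c' := (P.sound + C) / 2 with hc'
  have hc1 : P.sound < c' := by simp only [hc']; linarith
  have hc0 : 0 < c' := hs.trans hc1
  obtain ⟨ν, hν, H⟩ := P.exists_enthalpy_sq_le hc1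
  -- The margin `C - sound` is divided at the midpoint `c'`: the slope `c'` handles the quadratic
  -- part of the flux, and `w < C - c'` the cubic part `w * (r w² / 2)`.
  refine ⟨min ν (C - c'), lt_min hν (by simp only [hc']; linarith), fun r w hr hrν hw hwν => ?_⟩
  have h1 := H r hr (hrν.trans_le (min_le_left _ _))
  have h2 : w < C - c' := hwν.trans_le (min_le_right _ _)
  have h3 := P.internal_nonneg hr.le
  set e := |P.enthalpy r| with he
  have he2 : e ^ 2 = P.enthalpy r ^ 2 := sq_abs _
  rw [← he2] at h1
  -- arithmetic-geometric mean
  have h4 : w * (r * e) ≤ c' * (1 / 2 * r * w ^ 2 + P.internal r) := by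
    have h5 : 0 ≤ r * (c' * w - e) ^ 2 := by positivity
    have h6 : c' * (w * (r * e)) ≤ c' * (c' * (1 / 2 * r * w ^ 2 + P.internal r)) := by
      nlinarith
    exact le_of_mul_le_mul_left h6 hc0
  have h7 : w * (1 / 2 * r * w ^ 2) ≤ (C - c') * (1 / 2 * r * w ^ 2) := by gcongr
  have h8 : 0 ≤ (C - c') * P.internal r := mul_nonneg (by linarith) h3
  linarith

end DampedEuler
end

noncomputable section
namespace DampedEuler

open MeasureTheory Filter Topology

variable {d : ℕ}

/-- The entropy of the state `(r, v)` relative to the background state. -/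
def Params.entropy (P : Params) (r : ℝ) (v : Space d) : ℝ :=
  1 / 2 * r * (∑ i, v i ^ 2) + P.internal r

/-- The components of the entropy flux. -/
def Params.entropyFlux (P : Params) (r : ℝ) (v : Space d) (j : Fin d) : ℝ :=
  v j * (1 / 2 * r * (∑ i, v i ^ 2) + r * P.enthalpy r)

theorem Params.entropy_nonneg (P : Params) {r : ℝ} (hr : 0 < r) (v : Space d) :
    0 ≤ P.entropy r v := by
  have := P.internal_nonneg hr.le
  have : 0 ≤ ∑ i, v i ^ 2 := Finset.sum_nonneg fun i _ => sq_nonneg _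
  unfold Params.entropy
  positivity

theorem Params.eq_of_entropy_eq_zero (P : Params) {r : ℝ} (hr : 0 < r) {v : Space d}
    (h : P.entropy r v = 0) : r = P.rhoBar ∧ v = 0 := by
  have h1 := P.internal_nonneg hr.le
  have h2 : 0 ≤ ∑ i, v i ^ 2 := Finset.sum_nonneg fun i _ => sq_nonneg _
  unfold Params.entropy at h
  have h3 : 0 ≤ 1 / 2 * r * ∑ i, v i ^ 2 := by positivity
  refine ⟨P.eq_rhoBar_of_internal_eq_zero hr.le (by linarith), ?_⟩
  have h4 : 1 / 2 * r * ∑ i, v i ^ 2 = 0 := by linarith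
  have h5 : ∑ i, v i ^ 2 = 0 := by
    rcases mul_eq_zero.1 h4 with h | h
    · linarith
    · exact h
  ext i
  have := (Finset.sum_eq_zero_iff_of_nonneg fun i _ => sq_nonneg (v i)).1 h5 i (Finset.mem_univ _)
  simpa using this

theorem Params.entropy_background (P : Params) : P.entropy P.rhoBar (0 : Space d) = 0 := by
  simp [Params.entropy, P.internal_rhoBar]

theorem Params.contDiffAt_internal (P : Params) {r : ℝ} (hr : 0 < r) :
    ContDiffAt ℝ ∞ P.internal r := by
  unfold Params.internal Params.excess Params.pressure
  have h := contDiffAt_id.rpow_const_of_ne (n := ∞) (x := r) (f := id) (p := P.γ) hr.ne'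
  exact (((contDiffAt_const.mul h).sub contDiffAt_const).sub
    (contDiffAt_const.mul (contDiffAt_id.sub contDiffAt_const))).div_const _

theorem Params.contDiffAt_enthalpy (P : Params) {r : ℝ} (hr : 0 < r) :
    ContDiffAt ℝ ∞ P.enthalpy r := by
  unfold Params.enthalpy
  have h := contDiffAt_id.rpow_const_of_ne (n := ∞) (x := r) (f := id) (p := P.γ - 1)
    hr.ne'
  exact contDiffAt_const.mul (h.sub contDiffAt_const)

/-- The derivative of the entropy along a curve of states. -/
theorem Params.hasDerivAt_entropy (P : Params) {r : ℝ → ℝ} {v : ℝ → Space d} {r' s : ℝ}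
    {v' : Fin d → ℝ} (hr : HasDerivAt r r' s) (hv : ∀ i, HasDerivAt (fun z => v z i) (v' i) s)
    (hpos : 0 < r s) :
    HasDerivAt (fun z => P.entropy (r z) (v z))
      (1 / 2 * r' * (∑ i, v s i ^ 2) + r s * (∑ i, v s i * v' i) + P.enthalpy (r s) * r') s := by
  unfold Params.entropy
  have h1 : HasDerivAt (fun z => ∑ i, v z i ^ 2) (∑ i, 2 * v s i * v' i) s :=
    HasDerivAt.fun_sum fun i _ => ((hv i).pow 2).congr_deriv (by push_cast; ring)
  have h2 := ((hr.const_mul (1 / 2)).mul h1).add ((P.hasDerivAt_internal hpos).comp s hr)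
  refine h2.congr_deriv ?_
  have h3 : ∑ i, 2 * v s i * v' i = 2 * ∑ i, v s i * v' i := by
    rw [Finset.mul_sum]; exact Finset.sum_congr rfl fun i _ => by ring
  rw [h3]; ring

/-- The derivative of the entropy flux along a curve of states. -/
theorem Params.hasDerivAt_entropyFlux (P : Params) {r : ℝ → ℝ} {v : ℝ → Space d} {r' s : ℝ}
    {v' : Fin d → ℝ} (hr : HasDerivAt r r' s) (hv : ∀ i, HasDerivAt (fun z => v z i) (v' i) s)
    (hpos : 0 < r s) (j : Fin d) :
    HasDerivAt (fun z => P.entropyFlux (r z) (v z) j)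
      (v' j * (1 / 2 * r s * (∑ i, v s i ^ 2) + r s * P.enthalpy (r s))
        + v s j * (1 / 2 * r' * (∑ i, v s i ^ 2) + r s * (∑ i, v s i * v' i)
          + P.enthalpy (r s) * r' + P.A * P.γ * r s ^ (P.γ - 1) * r')) s := by
  unfold Params.entropyFlux
  have h1 : HasDerivAt (fun z => ∑ i, v z i ^ 2) (∑ i, 2 * v s i * v' i) s :=
    HasDerivAt.fun_sum fun i _ => ((hv i).pow 2).congr_deriv (by push_cast; ring)
  have h2 := (hv j).mul (((hr.const_mul (1 / 2)).mul h1).add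
    (hr.mul ((P.hasDerivAt_enthalpy hpos).comp s hr)))
  refine h2.congr_deriv ?_
  have h3 : ∑ i, 2 * v s i * v' i = 2 * ∑ i, v s i * v' i := by
    rw [Finset.mul_sum]; exact Finset.sum_congr rfl fun i _ => by ring
  rw [h3, ← P.rpow_mul_self hpos]
  simp only [Function.comp_apply, Pi.add_apply, Pi.mul_apply]
  ring

namespace IsSmoothSolution

variable {P : Params} {ε : ℝ} {ρ₀ : Space d → ℝ} {u₀ : Space d → Space d} {T : ℝ}
  {ρ : ℝ → Space d → ℝ} {u : ℝ → Space d → Space d}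
  (S : IsSmoothSolution P ε ρ₀ u₀ T ρ u)
include S

theorem contDiffAt_entropy {t : ℝ} (ht : t ∈ Set.Ioo 0 T) (x : Space d) :
    ContDiffAt ℝ ∞ (fun z : ℝ × Space d => P.entropy (ρ z.1 z.2) (u z.1 z.2)) (t, x) := by
  unfold Params.entropy
  have hr := S.contDiffAt_density ht x
  have hi := (P.contDiffAt_internal (S.density_pos t ⟨ht.1.le, ht.2⟩ x)).comp (t, x) hr
  exact ((contDiffAt_const.mul hr).mul (ContDiffAt.sum fun i _ =>
    (S.contDiffAt_velocity ht x i).pow 2)).add hi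

theorem contDiffAt_entropyFlux {t : ℝ} (ht : t ∈ Set.Ioo 0 T) (x : Space d) (j : Fin d) :
    ContDiffAt ℝ ∞ (fun y => P.entropyFlux (ρ t y) (u t y) j) x := by
  unfold Params.entropyFlux
  have hr := S.contDiffAt_density_slice ht x
  have hi := (P.contDiffAt_enthalpy (S.density_pos t ⟨ht.1.le, ht.2⟩ x)).comp x hr
  exact (S.contDiffAt_velocity_slice ht x j).mul (((contDiffAt_const.mul hr).mul
    (ContDiffAt.sum fun i _ => (S.contDiffAt_velocity_slice ht x i).pow 2)).add (hr.mul hi))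

/-- The entropy identity. -/
theorem entropy_identity {t : ℝ} (ht : t ∈ Set.Ioo 0 T) (x : Space d) :
    deriv (fun s => P.entropy (ρ s x) (u s x)) t
      = -(∑ j, pderiv j (fun y => P.entropyFlux (ρ t y) (u t y) j) x)
        - P.damping t * ρ t x * ∑ i, u t x i ^ 2 := by
  have hpos := S.density_pos t ⟨ht.1.le, ht.2⟩ x
  have hmass := S.mass_expanded ht x
  rw [(P.hasDerivAt_entropy (S.hasDerivAt_density_time ht x)
    (fun i => S.hasDerivAt_velocity_time ht x i) hpos).deriv]
  have hflux : ∀ j, pderiv j (fun y => P.entropyFlux (ρ t y) (u t y) j) x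
      = (1 / 2 * (∑ i, u t x i ^ 2) + P.enthalpy (ρ t x)) *
          (pderiv j (ρ t) x * u t x j + ρ t x * pderiv j (fun y => u t y j) x)
        + (∑ i, u t x i * (ρ t x * (u t x j * pderiv j (fun y => u t y i) x)))
        + u t x j * (P.A * P.γ * ρ t x ^ (P.γ - 1) * pderiv j (ρ t) x) := by
    intro j
    refine pderiv_eq_of_hasDerivAt
      ((S.contDiffAt_entropyFlux ht x j).differentiableAt (by simp)) ?_
    have h0 : x + (0:ℝ) • EuclideanSpace.single j (1:ℝ) = x := by simp
    refine (P.hasDerivAt_entropyFlux (S.hasDerivAt_density_space ht x j)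
      (v := fun s => u t (x + s • EuclideanSpace.single j (1:ℝ)))
      (fun i => S.hasDerivAt_velocity_space ht x i j) (by rw [h0]; exact hpos) j).congr_deriv ?_
    rw [h0]
    have : ∑ i, u t x i * (ρ t x * (u t x j * pderiv j (fun y => u t y i) x))
        = u t x j * (ρ t x * ∑ i, u t x i * pderiv j (fun y => u t y i) x) := by
      rw [Finset.mul_sum, Finset.mul_sum]
      exact Finset.sum_congr rfl fun i _ => by ring
    rw [this]; ring
  have hmom : ∑ i, u t x i * (ρ t x * deriv (fun s => u s x i) t)
      + (∑ j, ∑ i, u t x i * (ρ t x * (u t x j * pderiv j (fun y => u t y i) x)))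
      + (∑ j, u t x j * (P.A * P.γ * ρ t x ^ (P.γ - 1) * pderiv j (ρ t) x))
      = -(P.damping t * ρ t x * ∑ i, u t x i ^ 2) := by
    rw [Finset.sum_comm, ← Finset.sum_add_distrib, ← Finset.sum_add_distrib, Finset.mul_sum,
      ← Finset.sum_neg_distrib]
    refine Finset.sum_congr rfl fun i _ => ?_
    have h := S.momentum_expanded ht x i
    have h2 : ∑ j, u t x i * (ρ t x * (u t x j * pderiv j (fun y => u t y i) x))
        = u t x i * (ρ t x * ∑ j, u t x j * pderiv j (fun y => u t y i) x) := by
      rw [Finset.mul_sum, Finset.mul_sum]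
    rw [h2]
    linear_combination u t x i * h
  have hsum : ρ t x * ∑ i, u t x i * deriv (fun s => u s x i) t
      = ∑ i, u t x i * (ρ t x * deriv (fun s => u s x i) t) := by
    rw [Finset.mul_sum]; exact Finset.sum_congr rfl fun i _ => by ring
  rw [Finset.sum_congr rfl fun j _ => hflux j, Finset.sum_add_distrib, Finset.sum_add_distrib,
    ← Finset.mul_sum, hsum]
  -- Momentum tested with `u`, plus mass conservation times `|u|²/2` + enthalpy.
  linear_combination hmom + (1 / 2 * (∑ i, u t x i ^ 2) + P.enthalpy (ρ t x)) * hmass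

end IsSmoothSolution

/-! ### Cut-off functions for backward cones -/

/-- A smooth cut-off function of the backward cone with vertex `(R / C, x₀)` and slope `C`. -/
def coneCutoff (x₀ : Space d) (R C t : ℝ) (y : Space d) : ℝ :=
  expNegInvGlue ((R - C * t) ^ 2 - ‖y - x₀‖ ^ 2)

theorem contDiff_coneCutoff (x₀ : Space d) (R C : ℝ) :
    ContDiff ℝ ∞ (fun z : ℝ × Space d => coneCutoff x₀ R C z.1 z.2) := by
  unfold coneCutoff
  have h1 : ContDiff ℝ ∞ fun z : ℝ × Space d => (R - C * z.1) ^ 2 - ‖z.2 - x₀‖ ^ 2 := by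
    have := (contDiff_norm_sq ℝ (E := Space d) (n := ∞)).comp
      (contDiff_snd.sub (contDiff_const (c := x₀)) : ContDiff ℝ ∞ fun z : ℝ × Space d => z.2 - x₀)
    refine ContDiff.sub ?_ this
    fun_prop
  exact (expNegInvGlue.contDiff (n := ⊤)).comp h1

theorem coneCutoff_nonneg (x₀ : Space d) (R C t : ℝ) (y : Space d) : 0 ≤ coneCutoff x₀ R C t y :=
  expNegInvGlue.nonneg _

theorem coneCutoff_eq_zero_iff {x₀ : Space d} {R C t : ℝ} (hR : 0 ≤ R - C * t) (y : Space d) :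
    coneCutoff x₀ R C t y = 0 ↔ R - C * t ≤ ‖y - x₀‖ := by
  unfold coneCutoff
  rw [expNegInvGlue.zero_iff_nonpos, sub_nonpos, sq_le_sq₀ hR (norm_nonneg _)]

theorem hasDerivAt_expNegInvGlue (z : ℝ) :
    HasDerivAt expNegInvGlue (deriv expNegInvGlue z) z :=
  ((expNegInvGlue.contDiff (n := 1)).differentiable (by simp) z).hasDerivAt

theorem hasDerivAt_coneCutoff_time (x₀ : Space d) (R C t : ℝ) (y : Space d) :
    HasDerivAt (fun s => coneCutoff x₀ R C s y)
      (deriv expNegInvGlue ((R - C * t) ^ 2 - ‖y - x₀‖ ^ 2) * (-(2 * C * (R - C * t)))) t := by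
  unfold coneCutoff
  have h1 : HasDerivAt (fun s : ℝ => (R - C * s) ^ 2 - ‖y - x₀‖ ^ 2)
      (-(2 * C * (R - C * t))) t := by
    have := ((((hasDerivAt_id t).const_mul C).const_sub R).pow 2).sub_const (‖y - x₀‖ ^ 2)
    refine this.congr_deriv ?_
    simp only [id]
    push_cast
    ring
  exact (hasDerivAt_expNegInvGlue _).comp t h1

theorem pderiv_coneCutoff (x₀ : Space d) (R C t : ℝ) (y : Space d) (j : Fin d) :
    pderiv j (coneCutoff x₀ R C t) y
      = deriv expNegInvGlue ((R - C * t) ^ 2 - ‖y - x₀‖ ^ 2) * (-(2 * (y - x₀) j)) := by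
  unfold pderiv
  have h1 : HasFDerivAt (fun y : Space d => (R - C * t) ^ 2 - ‖y - x₀‖ ^ 2)
      (-(2 • innerSL ℝ (y - x₀))) y := by
    have := ((hasStrictFDerivAt_norm_sq (y - x₀)).hasFDerivAt.comp y
      ((hasFDerivAt_id y).sub_const x₀)).const_sub ((R - C * t) ^ 2)
    exact this
  have h2 := (hasDerivAt_expNegInvGlue ((R - C * t) ^ 2 - ‖y - x₀‖ ^ 2)).comp_hasFDerivAt y h1
  have h3 : fderiv ℝ (coneCutoff x₀ R C t) y = _ := h2.fderiv
  rw [h3]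
  simp [EuclideanSpace.inner_single_right]

theorem deriv_expNegInvGlue_nonneg (z : ℝ) : 0 ≤ deriv expNegInvGlue z :=
  expNegInvGlue.monotone.deriv_nonneg

theorem deriv_expNegInvGlue_of_neg {z : ℝ} (hz : z < 0) : deriv expNegInvGlue z = 0 := by
  have : expNegInvGlue =ᶠ[𝓝 z] fun _ => 0 := by
    filter_upwards [Iio_mem_nhds hz] with y hy
    exact expNegInvGlue.zero_of_nonpos (le_of_lt hy)
  rw [this.deriv_eq]; simp

end DampedEuler
end

/-! ### Finite speed of propagation. -/

noncomputable section
namespace DampedEuler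

open MeasureTheory Filter Topology

variable {d : ℕ}

namespace IsSmoothSolution

variable {P : Params} {ε : ℝ} {ρ₀ : Space d → ℝ} {u₀ : Space d → Space d} {T : ℝ}
  {ρ : ℝ → Space d → ℝ} {u : ℝ → Space d → Space d}
  (S : IsSmoothSolution P ε ρ₀ u₀ T ρ u)
include S

set_option maxHeartbeats 1000000 in
/-- The localized entropy decreases as long as the state in the cone is such that the entropy flux
is dominated by the entropy. -/
theorem exists_localEntropy_deriv {x₀ : Space d} {R C t : ℝ} (hC : 0 < C)
    (ht : t ∈ Set.Ioo 0 T) (hRt : C * t < R)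
    (hgood : ∀ y, ‖y - x₀‖ ≤ R - C * t →
      ‖u t y‖ * (1 / 2 * ρ t y * ‖u t y‖ ^ 2 + ρ t y * |P.enthalpy (ρ t y)|) ≤
        C * (1 / 2 * ρ t y * ‖u t y‖ ^ 2 + P.internal (ρ t y))) :
    ∃ E' ≤ 0, HasDerivAt
      (fun s => ∫ y, coneCutoff x₀ R C s y * P.entropy (ρ s y) (u s y)) E' t := by
  have hR : 0 < R := by have := mul_pos hC ht.1; linarith
  have hdamp := P.damping_nonneg (by linarith [ht.1] : -1 < t)
  set K := Metric.closedBall x₀ R with hK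
  have hKc : IsCompact K := isCompact_closedBall x₀ R
  have hcut0 : ∀ s, 0 ≤ s → C * s < R → ∀ y ∉ K, coneCutoff x₀ R C s y = 0 := by
    intro s hs hsR y hy
    rw [coneCutoff_eq_zero_iff (by linarith)]
    rw [hK, Metric.mem_closedBall, dist_eq_norm, not_le] at hy
    have : 0 ≤ C * s := by positivity
    linarith
  set b := min T (R / C) with hb
  have hbt : t ∈ Set.Ioo 0 b := ⟨ht.1, lt_min ht.2 (by rw [lt_div_iff₀ hC]; linarith)⟩
  have hbT : ∀ s ∈ Set.Ioo 0 b, s ∈ Set.Ioo 0 T ∧ C * s < R := by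
    intro s hs
    refine ⟨⟨hs.1, hs.2.trans_le (min_le_left _ _)⟩, ?_⟩
    have := hs.2.trans_le (min_le_right _ _)
    rw [lt_div_iff₀ hC] at this
    linarith
  have hder := hasDerivAt_integral_weight
    (f := fun s y => coneCutoff x₀ R C s y * P.entropy (ρ s y) (u s y))
    (g := fun _ _ => 1) (g' := fun _ => 0) (Cg := 1) (Lg := 0) hKc hbt
    (fun s hs x => ((contDiff_coneCutoff x₀ R C).contDiffAt.mul
      (S.contDiffAt_entropy (hbT s hs).1 x)).of_le (by simp))
    (fun s hs x hx => by simp [hcut0 s hs.1.le (hbT s hs).2 x hx])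
    (fun _ => measurable_const) measurable_const (by simp) (by simp)
    (Eventually.of_forall fun x => hasDerivAt_const _ _)
  simp only [one_mul, zero_mul, zero_add] at hder
  refine ⟨_, ?_, hder⟩
  -- the integrand
  set χ := coneCutoff x₀ R C t with hχ
  set G : Space d → ℝ := fun y => deriv expNegInvGlue ((R - C * t) ^ 2 - ‖y - x₀‖ ^ 2) with hG
  set η : Space d → ℝ := fun y => P.entropy (ρ t y) (u t y) with hη
  set F : Fin d → Space d → ℝ := fun j y => P.entropyFlux (ρ t y) (u t y) j with hF
  set X : Space d → ℝ := fun y => G y * (-(2 * C * (R - C * t))) * η y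
    - χ y * (P.damping t * ρ t y * ∑ i, u t y i ^ 2) with hX
  have hderiv : ∀ y, deriv (fun s => coneCutoff x₀ R C s y * P.entropy (ρ s y) (u s y)) t
      = X y - ∑ j, χ y * pderiv j (F j) y := by
    intro y
    have h1 : HasDerivAt (fun s => P.entropy (ρ s y) (u s y)) _ t :=
      ((hasDerivAt_time (f := fun s y => P.entropy (ρ s y) (u s y))
        ((S.contDiffAt_entropy ht y).differentiableAt (by simp)))).differentiableAt.hasDerivAt
    have h2 := ((hasDerivAt_coneCutoff_time x₀ R C t y).mul h1).deriv
    rw [S.entropy_identity ht y] at h2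
    refine Eq.trans h2 ?_
    rw [← Finset.mul_sum]
    simp only [hX, hG, hχ, hη, hF]
    ring
  have hχC : ContDiff ℝ ∞ χ :=
    (contDiff_coneCutoff x₀ R C).comp (contDiff_const.prodMk contDiff_id :
      ContDiff ℝ ∞ fun y : Space d => (t, y))
  have hFC : ∀ j, ContDiff ℝ ∞ (F j) := fun j =>
    contDiff_iff_contDiffAt.2 fun y => S.contDiffAt_entropyFlux ht y j
  have hηc : Continuous η := continuous_iff_continuousAt.2 fun y =>
    ((S.contDiffAt_entropy ht y).continuousAt.comp (f := fun y => (t, y)) (by fun_prop) :)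
  have hρc : Continuous (ρ t) := continuous_iff_continuousAt.2 fun y =>
    (S.contDiffAt_density_slice ht y).continuousAt
  have huc : ∀ i, Continuous fun y => u t y i := fun i => continuous_iff_continuousAt.2 fun y =>
    (S.contDiffAt_velocity_slice ht y i).continuousAt
  have hGc : Continuous G := by
    have h1 : Continuous (deriv expNegInvGlue) :=
      (expNegInvGlue.contDiff (n := 1)).continuous_deriv (by simp)
    exact h1.comp (by fun_prop)
  have hχ0 : ∀ y ∉ K, χ y = 0 := hcut0 t ht.1.le hRt
  have hG0 : ∀ y ∉ K, G y = 0 := by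
    intro y hy
    refine deriv_expNegInvGlue_of_neg ?_
    rw [hK, Metric.mem_closedBall, dist_eq_norm, not_le] at hy
    have h1 : R - C * t < ‖y - x₀‖ := by have := mul_pos hC ht.1; linarith
    have : (R - C * t) ^ 2 < ‖y - x₀‖ ^ 2 := by gcongr
    linarith
  have hXi : Integrable X := by
    have hXc : Continuous X :=
      ((hGc.mul continuous_const).mul hηc).sub (hχC.continuous.mul
        ((continuous_const.mul hρc).mul (continuous_finset_sum _ fun i _ => (huc i).pow 2)))
    exact hXc.integrable_of_hasCompactSupport (HasCompactSupport.intro hKc fun y hy => by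
      simp [hX, hG0 y hy, hχ0 y hy])
  have hdF : ∀ j, Continuous fun y => pderiv j (F j) y := fun j =>
    ((hFC j).continuous_fderiv (by simp)).clm_apply continuous_const
  have hFi : ∀ j, Integrable fun y => χ y * pderiv j (F j) y := fun j =>
    (hχC.continuous.mul (hdF j)).integrable_of_hasCompactSupport
      (HasCompactSupport.intro hKc fun y hy => by simp [hχ0 y hy])
  have hdχ : ∀ j y, pderiv j χ y = G y * (-(2 * (y - x₀) j)) := fun j y =>
    pderiv_coneCutoff x₀ R C t y j
  have hdχi : ∀ j, Integrable fun y => pderiv j χ y * F j y := fun j => by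
    simp only [hdχ]
    have h1 : Continuous fun y : Space d => (y - x₀) j := by fun_prop
    have h2 := (hFC j).continuous
    exact Continuous.integrable_of_hasCompactSupport
      ((hGc.mul (continuous_const.mul h1).neg).mul h2) (HasCompactSupport.intro hKc fun y hy => by simp [hG0 y hy])
  have hχ1 : ∀ y, 0 ≤ χ y := fun y => coneCutoff_nonneg _ _ _ _ _
  have hG1 : ∀ y, 0 ≤ G y := fun y => deriv_expNegInvGlue_nonneg _
  have hG2 : ∀ y, R - C * t < ‖y - x₀‖ → G y = 0 := by
    intro y hy
    refine deriv_expNegInvGlue_of_neg ?_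
    have : (R - C * t) ^ 2 < ‖y - x₀‖ ^ 2 := by
      have : 0 ≤ R - C * t := by linarith
      gcongr
    linarith
  simp only [hderiv]
  clear hderiv hder hcut0
  clear_value χ G η F X
  calc ∫ y, (X y - ∑ j, χ y * pderiv j (F j) y)
      = (∫ y, X y) - ∑ j, ∫ y, χ y * pderiv j (F j) y := by
        rw [integral_sub hXi (integrable_finsetSum _ fun j _ => hFi j),
          integral_finsetSum _ fun j _ => hFi j]
    _ = (∫ y, X y) + ∑ j, ∫ y, pderiv j χ y * F j y := by
        rw [sub_eq_add_neg, ← Finset.sum_neg_distrib]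
        congr 1
        refine Finset.sum_congr rfl fun j _ => ?_
        rw [integral_mul_pderiv hKc (hχC.of_le (by simp)) ((hFC j).of_le (by simp)) hχ0 j, neg_neg]
    _ = ∫ y, (X y + ∑ j, pderiv j χ y * F j y) := by
        rw [integral_add hXi (integrable_finsetSum _ fun j _ => hdχi j),
          integral_finsetSum _ fun j _ => hdχi j]
    -- Pointwise sign. Where `G` may be nonzero, `‖y - x₀‖ ≤ R - C t`. There the shrinking of the
    -- cone contributes `-2 C (R - C t) G η`, while the flux contributes at most `2 G ‖y - x₀‖ C η`
    -- by `hgood`. The damping only lowers the energy.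
    _ ≤ 0 := by
        refine integral_nonpos fun y => ?_
        simp only [Pi.zero_apply, hdχ]
        have hρ := S.density_pos t ⟨ht.1.le, ht.2⟩ y
        have hN : ∑ i, u t y i ^ 2 = ‖u t y‖ ^ 2 := (EuclideanSpace.real_norm_sq_eq _).symm
        have hsum : ∑ j, G y * (-(2 * (y - x₀) j)) * F j y
            = -(2 * G y * ((∑ j, (y - x₀) j * u t y j) *
              (1 / 2 * ρ t y * ‖u t y‖ ^ 2 + ρ t y * P.enthalpy (ρ t y)))) := by
          rw [Finset.sum_mul, Finset.mul_sum, ← Finset.sum_neg_distrib]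
          refine Finset.sum_congr rfl fun j _ => ?_
          simp only [hF, Params.entropyFlux, hN]
          ring
        rw [hsum]
        have hχy := hχ1 y
        have hdiss : 0 ≤ χ y * (P.damping t * ρ t y * ∑ i, u t y i ^ 2) := by
          rw [hN]; positivity
        have hG1y := hG1 y
        suffices h : G y * (-(2 * C * (R - C * t))) * η y
            + -(2 * G y * ((∑ j, (y - x₀) j * u t y j) *
              (1 / 2 * ρ t y * ‖u t y‖ ^ 2 + ρ t y * P.enthalpy (ρ t y)))) ≤ 0 by
          simp only [hX]; linarith
        rcases le_or_gt ‖y - x₀‖ (R - C * t) with hy | hy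
        · have h1 := hgood y hy
          have hηy : η y = 1 / 2 * ρ t y * ‖u t y‖ ^ 2 + P.internal (ρ t y) := by
            simp only [hη, Params.entropy, hN]
          rw [← hηy] at h1
          have hin : |∑ j, (y - x₀) j * u t y j| ≤ ‖y - x₀‖ * ‖u t y‖ := by
            have h3 := abs_real_inner_le_norm (u t y) (y - x₀)
            rw [PiLp.inner_apply] at h3
            simp only [RCLike.inner_apply, conj_trivial] at h3
            linarith [mul_comm ‖u t y‖ ‖y - x₀‖]
          have hH : |1 / 2 * ρ t y * ‖u t y‖ ^ 2 + ρ t y * P.enthalpy (ρ t y)|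
              ≤ 1 / 2 * ρ t y * ‖u t y‖ ^ 2 + ρ t y * |P.enthalpy (ρ t y)| := by
            refine (abs_add_le _ _).trans_eq ?_
            rw [abs_of_nonneg (by positivity : 0 ≤ 1 / 2 * ρ t y * ‖u t y‖ ^ 2), abs_mul,
              abs_of_pos hρ]
          have h4 : |(∑ j, (y - x₀) j * u t y j) *
              (1 / 2 * ρ t y * ‖u t y‖ ^ 2 + ρ t y * P.enthalpy (ρ t y))|
              ≤ (R - C * t) * (C * η y) := by
            rw [abs_mul]
            calc _ ≤ (‖y - x₀‖ * ‖u t y‖) *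
                  (1 / 2 * ρ t y * ‖u t y‖ ^ 2 + ρ t y * |P.enthalpy (ρ t y)|) := by gcongr
              _ = ‖y - x₀‖ * (‖u t y‖ *
                  (1 / 2 * ρ t y * ‖u t y‖ ^ 2 + ρ t y * |P.enthalpy (ρ t y)|)) := by ring
              _ ≤ ‖y - x₀‖ * (C * η y) := by gcongr
              _ ≤ _ := by
                  have : 0 ≤ η y := by rw [hη]; exact P.entropy_nonneg hρ _
                  gcongr
          have h5 := (abs_le.1 h4).1
          have h6 : 2 * G y * -((R - C * t) * (C * η y)) ≤ 2 * G y *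
              ((∑ j, (y - x₀) j * u t y j) *
              (1 / 2 * ρ t y * ‖u t y‖ ^ 2 + ρ t y * P.enthalpy (ρ t y))) := by gcongr
          linarith
        · simp [hG2 y hy]

set_option maxHeartbeats 1000000 in
/-- Local uniqueness: a solution that is in the background state in a ball at time zero remains in
the background state in every backward cone of slope larger than the speed of sound. -/
theorem eq_background_of_cone {x₀ : Space d} {R C : ℝ} (hC : P.sound < C)
    (hinit : ∀ y, ‖y - x₀‖ < R → ρ 0 y = P.rhoBar ∧ u 0 y = 0)
    {t₁ : ℝ} (ht₁ : t₁ ∈ Set.Ico 0 T) (hRt : C * t₁ < R) {y : Space d}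
    (hy : ‖y - x₀‖ < R - C * t₁) : ρ t₁ y = P.rhoBar ∧ u t₁ y = 0 := by
  have hC0 : 0 < C := P.sound_pos.trans hC
  set ρc : ℝ → Space d → ℝ := fun t y => ρ (clamp t₁ t) y with hρc
  set uc : ℝ → Space d → Space d := fun t y => u (clamp t₁ t) y with huc
  have hρcc : Continuous fun z : ℝ × Space d => ρc z.1 z.2 := S.continuous_density ht₁.1 ht₁.2
  have hucc : Continuous fun z : ℝ × Space d => uc z.1 z.2 := S.continuous_velocity ht₁.1 ht₁.2
  have hcl : ∀ t, clamp t₁ t ∈ Set.Icc 0 t₁ := fun t => clamp_mem ht₁.1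
  have hpos : ∀ t y, 0 < ρc t y := fun t y =>
    S.density_pos _ ⟨(hcl t).1, (hcl t).2.trans_lt ht₁.2⟩ y
  have hRs : ∀ s ∈ Set.Icc 0 t₁, C * s < R := fun s hs =>
    (mul_le_mul_of_nonneg_left hs.2 hC0.le).trans_lt hRt
  have hR0 : 0 < R := by have := hRs 0 ⟨le_rfl, ht₁.1⟩; simpa using this
  set K := Metric.closedBall x₀ R with hK
  set F : ℝ → Space d → ℝ := fun t y =>
    coneCutoff x₀ R C (clamp t₁ t) y * P.entropy (ρc t y) (uc t y) with hF
  have hχc : Continuous fun z : ℝ × Space d => coneCutoff x₀ R C (clamp t₁ z.1) z.2 :=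
    (contDiff_coneCutoff x₀ R C).continuous.comp
      (((continuous_clamp t₁).comp continuous_fst).prodMk continuous_snd)
  have hFc : Continuous (Function.uncurry F) := by
    refine hχc.mul ?_
    have hint : Continuous fun z : ℝ × Space d => P.internal (ρc z.1 z.2) :=
      continuous_iff_continuousAt.2 fun z =>
        ((P.contDiffAt_internal (hpos z.1 z.2)).continuousAt.comp
          (f := fun z : ℝ × Space d => ρc z.1 z.2) hρcc.continuousAt :)
    have hui : ∀ i, Continuous fun z : ℝ × Space d => uc z.1 z.2 i := fun i => by fun_prop
    simp only [Params.entropy]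
    fun_prop
  have hF0 : ∀ t, ∀ y ∉ K, F t y = 0 := by
    intro t y hy
    have : coneCutoff x₀ R C (clamp t₁ t) y = 0 := by
      rw [coneCutoff_eq_zero_iff (by linarith [hRs _ (hcl t)])]
      rw [hK, Metric.mem_closedBall, dist_eq_norm, not_le] at hy
      have : 0 ≤ C * clamp t₁ t := mul_nonneg hC0.le (hcl t).1
      linarith
    simp [hF, this]
  have hFnn : ∀ t y, 0 ≤ F t y := fun t y =>
    mul_nonneg (coneCutoff_nonneg _ _ _ _ _) (P.entropy_nonneg (hpos t y) _)
  set E : ℝ → ℝ := fun t => ∫ y, F t y with hE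
  have hEc : Continuous E := by
    have := continuous_integral_weight (f := F) (g := fun _ _ => 1) (isCompact_closedBall x₀ R)
      hFc hF0 (fun _ => measurable_const) (fun _ => ⟨1, by simp⟩)
      (fun _ => Eventually.of_forall fun _ => continuousAt_const)
    simpa using this
  have hEnn : ∀ t, 0 ≤ E t := fun t => integral_nonneg (hFnn t)
  -- vanishing of the energy means background state
  have hback : ∀ t, E t = 0 → ∀ y, ‖y - x₀‖ < R - C * clamp t₁ t →
      ρc t y = P.rhoBar ∧ uc t y = 0 := by
    intro t hEt y hy
    have hFt : Continuous (F t) := hFc.comp (Continuous.prodMk_right t)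
    have hFi : Integrable (F t) := hFt.integrable_of_hasCompactSupport
      (HasCompactSupport.intro (isCompact_closedBall x₀ R) (hF0 t))
    have h1 : F t = 0 := by
      have := (integral_eq_zero_iff_of_nonneg (hFnn t) hFi).1 hEt
      exact Measure.eq_of_ae_eq this hFt continuous_const
    have h2 : F t y = 0 := congrFun h1 y
    rcases mul_eq_zero.1 h2 with h | h
    · rw [coneCutoff_eq_zero_iff (by linarith [hRs _ (hcl t)])] at h
      linarith
    · exact P.eq_of_entropy_eq_zero (hpos t y) h
  obtain ⟨ν, hν, hflux⟩ := P.exists_flux_le hC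
  -- continuity induction
  have hind : Set.Icc 0 t₁ ⊆ {t | E t = 0} := by
    refine IsClosed.Icc_subset_of_forall_exists_gt ?_ ?_ ?_
    · exact (isClosed_eq hEc continuous_const).inter isClosed_Icc
    · have hc0 : clamp t₁ 0 = 0 := clamp_eq ⟨le_rfl, ht₁.1⟩
      have : ∀ y, F 0 y = 0 := by
        intro y
        rcases lt_or_ge ‖y - x₀‖ R with h | h
        · obtain ⟨h1, h2⟩ := hinit y h
          simp [hF, hρc, huc, hc0, h1, h2, P.entropy_background]
        · have : coneCutoff x₀ R C (clamp t₁ 0) y = 0 := by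
            rw [hc0, coneCutoff_eq_zero_iff (by simpa using hR0.le)]; simpa using h
          simp [hF, this]
      simp [hE, this]
    · intro t ht s hs
      obtain ⟨hEt, ht⟩ := ht
      have hct : clamp t₁ t = t := clamp_eq ⟨ht.1, ht.2.le⟩
      have hRt' := hRs t ⟨ht.1, ht.2.le⟩
      -- closed ball at time `t`
      have hclosed : ∀ y ∈ Metric.closedBall x₀ (R - C * t),
          ρc t y = P.rhoBar ∧ uc t y = 0 := by
        have h1 : Continuous (ρc t) := hρcc.comp (Continuous.prodMk_right t)
        have h2 : Continuous (uc t) := hucc.comp (Continuous.prodMk_right t)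
        have h3 : IsClosed {y | ρc t y = P.rhoBar ∧ uc t y = 0} :=
          (isClosed_eq h1 continuous_const).inter (isClosed_eq h2 continuous_const)
        have h4 : Metric.ball x₀ (R - C * t) ⊆ {y | ρc t y = P.rhoBar ∧ uc t y = 0} := by
          intro y hy
          rw [Metric.mem_ball, dist_eq_norm] at hy
          exact hback t hEt y (by rw [hct]; exact hy)
        have h5 := h3.closure_subset_iff.2 h4
        rwa [closure_ball x₀ (by linarith)] at h5
      -- The state is the background on the closed ball at time `t`; by compactness it stays
      -- `ν`-close on that ball for a short time. Later slices of the cone lie in the same ball, so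
      -- `hflux` makes the energy decrease there.
      have hnear : ∀ᶠ s in 𝓝 t, ∀ y ∈ Metric.closedBall x₀ (R - C * t),
          |ρc s y - P.rhoBar| < ν ∧ ‖uc s y‖ < ν := by
        refine (isCompact_closedBall x₀ (R - C * t)).eventually_forall_of_forall_eventually
          fun y hy => ?_
        obtain ⟨h1, h2⟩ := hclosed y hy
        have e1 : ContinuousAt (fun z : ℝ × Space d => |ρc z.1 z.2 - P.rhoBar|) (t, y) := by
          fun_prop
        have e2 : ContinuousAt (fun z : ℝ × Space d => ‖uc z.1 z.2‖) (t, y) := by fun_prop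
        exact (e1.eventually_lt_const (by simpa [h1] using hν)).and
          (e2.eventually_lt_const (by simpa [h2] using hν))
      obtain ⟨τ, hτ, hτs⟩ := Metric.eventually_nhds_iff.1 hnear
      obtain ⟨r, hr⟩ : ∃ r, t < r ∧ r ≤ s ∧ r ≤ t₁ ∧ r < t + τ := by
        refine ⟨min (min s t₁) (t + τ / 2), lt_min (lt_min hs ht.2) (by linarith),
          (min_le_left _ _).trans (min_le_left _ _), (min_le_left _ _).trans (min_le_right _ _), ?_⟩
        have := min_le_right (min s t₁) (t + τ / 2)
        linarith
      obtain ⟨hr1, hr2, hr3, hr4⟩ := hr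
      refine ⟨r, ?_, hr1, hr2⟩
      have hdE : ∀ q ∈ Set.Ioo t r, ∃ E' ≤ 0, HasDerivAt E E' q := by
        intro q hq
        have hq0 : q ∈ Set.Ioo 0 t₁ := ⟨ht.1.trans_lt hq.1, hq.2.trans_le hr3⟩
        have hqT : q ∈ Set.Ioo 0 T := ⟨hq0.1, hq0.2.trans ht₁.2⟩
        have hcq : clamp t₁ q = q := clamp_eq ⟨hq0.1.le, hq0.2.le⟩
        obtain ⟨E', hE', hd⟩ := S.exists_localEntropy_deriv (x₀ := x₀) (R := R) hC0 hqT
          (hRs q ⟨hq0.1.le, hq0.2.le⟩) (by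
            intro y hy
            have hy' : y ∈ Metric.closedBall x₀ (R - C * t) := by
              rw [Metric.mem_closedBall, dist_eq_norm]
              have : C * t ≤ C * q := mul_le_mul_of_nonneg_left hq.1.le hC0.le
              linarith
            have h1 := hτs (y := q) (by
              rw [Real.dist_eq, abs_of_pos (by linarith [hq.1])]; linarith [hq.2]) y hy'
            simp only [hρc, huc, hcq] at h1
            exact hflux _ _ (S.density_pos q ⟨hqT.1.le, hqT.2⟩ y) h1.1 (norm_nonneg _) h1.2)
        refine ⟨E', hE', hd.congr_of_eventuallyEq ?_⟩
        filter_upwards [clamp_eventuallyEq hq0] with z hz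
        simp only [hE, hF, hρc, huc, hz, id]
      have hanti : AntitoneOn E (Set.Icc t r) := by
        refine antitoneOn_of_deriv_nonpos (convex_Icc _ _) hEc.continuousOn ?_ ?_
        · intro q hq
          rw [interior_Icc] at hq
          obtain ⟨E', _, hd⟩ := hdE q hq
          exact hd.differentiableAt.differentiableWithinAt
        · intro q hq
          rw [interior_Icc] at hq
          obtain ⟨E', hE', hd⟩ := hdE q hq
          rw [hd.deriv]; exact hE'
      have h1 : E r ≤ E t := hanti ⟨le_rfl, hr1.le⟩ ⟨hr1.le, le_rfl⟩ hr1.le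
      have h2 : E t = 0 := hEt
      exact le_antisymm (h1.trans_eq h2) (hEnn r)
  have hcl1 : clamp t₁ t₁ = t₁ := clamp_eq ⟨ht₁.1, le_rfl⟩
  have := hback t₁ (hind ⟨ht₁.1, le_rfl⟩) y (by rw [hcl1]; exact hy)
  simpa only [hρc, huc, hcl1] using this

/-- Finite speed of propagation. -/
theorem eq_background {M : ℝ} (hρ₀ : tsupport ρ₀ ⊆ Metric.closedBall 0 M)
    (hu₀ : tsupport u₀ ⊆ Metric.closedBall 0 M) {t : ℝ} (ht : t ∈ Set.Ico 0 T) {x : Space d}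
    (hx : M + P.sound * t < ‖x‖) : ρ t x = P.rhoBar ∧ u t x = 0 := by
  have h0 : ∀ y : Space d, M < ‖y‖ → ρ 0 y = P.rhoBar ∧ u 0 y = 0 := by
    intro y hy
    have hy' : y ∉ Metric.closedBall (0 : Space d) M := by simpa using hy
    have h1 : ρ₀ y = 0 := image_eq_zero_of_notMem_tsupport fun h => hy' (hρ₀ h)
    have h2 : u₀ y = 0 := image_eq_zero_of_notMem_tsupport fun h => hy' (hu₀ h)
    rw [S.init_density, S.init_velocity]
    simp [initDensity, initVelocity, h1, h2]
  -- The cone estimate needs a slope strictly above the sound speed. As `x` lies strictly outside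
  -- the sound cone, a small increase `κ` with `κ t` less than the remaining distance is affordable.
  set κ := (‖x‖ - M - P.sound * t) / (2 * (t + 1)) with hκ
  have ht1 : 0 < t + 1 := by linarith [ht.1]
  have hκ0 : 0 < κ := div_pos (by linarith) (by linarith)
  have hκt : κ * t < ‖x‖ - M - P.sound * t := by
    rw [hκ, div_mul_eq_mul_div, div_lt_iff₀ (by linarith)]
    have : 0 < ‖x‖ - M - P.sound * t := by linarith
    nlinarith [ht.1]
  have hlt : (P.sound + κ) * t < ‖x‖ - M := by linarith
  refine S.eq_background_of_cone (x₀ := x) (R := ‖x‖ - M) (C := P.sound + κ) (by linarith) ?_ ht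
    hlt (by simp; linarith)
  intro y hy
  refine h0 y ?_
  have h1 := norm_sub_norm_le x y
  rw [norm_sub_rev] at h1
  linarith

end IsSmoothSolution

end DampedEuler
end

noncomputable section
namespace DampedEuler

open MeasureTheory Filter Topology

/-! ### Weights supported in a half-line -/

/-- The characteristic function of the positive half-line. -/
def pos0 (z : ℝ) : ℝ := if 0 < z then 1 else 0

/-- The positive part. -/
def pos1 (z : ℝ) : ℝ := max z 0

/-- The square of the positive part. -/
def pos2 (z : ℝ) : ℝ := max z 0 ^ 2

theorem pos0_nonneg (z : ℝ) : 0 ≤ pos0 z := by unfold pos0; split_ifs <;> norm_num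

theorem abs_pos0_le (z : ℝ) : |pos0 z| ≤ 1 := by unfold pos0; split_ifs <;> simp

theorem abs_pos1_le (z : ℝ) : |pos1 z| ≤ |z| := by
  unfold pos1
  rw [abs_of_nonneg (le_max_right _ _)]
  exact max_le (le_abs_self z) (abs_nonneg z)

theorem measurable_pos0 : Measurable pos0 :=
  Measurable.ite measurableSet_Ioi measurable_const measurable_const

theorem continuous_pos1 : Continuous pos1 := by unfold pos1; fun_prop

theorem continuous_pos2 : Continuous pos2 := by unfold pos2; fun_prop

theorem pos0_of_nonpos {z : ℝ} (hz : z ≤ 0) : pos0 z = 0 := if_neg (not_lt.2 hz)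

theorem pos0_of_pos {z : ℝ} (hz : 0 < z) : pos0 z = 1 := if_pos hz

theorem pos1_of_nonpos {z : ℝ} (hz : z ≤ 0) : pos1 z = 0 := max_eq_right hz

theorem pos1_of_nonneg {z : ℝ} (hz : 0 ≤ z) : pos1 z = z := max_eq_left hz

theorem pos2_of_nonpos {z : ℝ} (hz : z ≤ 0) : pos2 z = 0 := by
  unfold pos2; rw [max_eq_right hz]; ring

theorem pos2_of_nonneg {z : ℝ} (hz : 0 ≤ z) : pos2 z = z ^ 2 := by
  unfold pos2; rw [max_eq_left hz]

theorem abs_pos1_sub_le (a b : ℝ) : |pos1 a - pos1 b| ≤ |a - b| :=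
  (abs_max_sub_max_le_abs a b 0)

theorem hasDerivAt_pos1 {z : ℝ} (hz : z ≠ 0) : HasDerivAt pos1 (pos0 z) z := by
  rcases lt_or_gt_of_ne hz with h | h
  · rw [pos0_of_nonpos h.le]
    refine (hasDerivAt_const z (0:ℝ)).congr_of_eventuallyEq ?_
    filter_upwards [Iio_mem_nhds h] with y hy
    exact pos1_of_nonpos (le_of_lt hy)
  · rw [pos0_of_pos h]
    refine (hasDerivAt_id z).congr_of_eventuallyEq ?_
    filter_upwards [Ioi_mem_nhds h] with y hy
    exact pos1_of_nonneg (le_of_lt hy)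

theorem hasDerivAt_pos2 (z : ℝ) : HasDerivAt pos2 (2 * pos1 z) z := by
  rcases eq_or_ne z 0 with rfl | h
  · rw [pos1_of_nonpos le_rfl, mul_zero]
    rw [hasDerivAt_iff_isLittleO_nhds_zero]
    simp only [zero_add, pos2_of_nonpos le_rfl, sub_zero, smul_zero]
    have : (fun h : ℝ => h ^ 2) =o[𝓝 0] fun h => h := by
      simpa using Asymptotics.isLittleO_pow_pow (𝕜 := ℝ) (m := 1) (n := 2) (by norm_num)
    refine Asymptotics.IsBigO.trans_isLittleO (Asymptotics.isBigO_of_le _ fun h => ?_) this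
    unfold pos2
    rw [norm_pow, norm_pow]
    have := abs_pos1_le h
    unfold pos1 at this
    simp only [Real.norm_eq_abs]
    gcongr
  · have : pos2 = fun y => pos1 y ^ 2 := rfl
    rw [this]
    refine ((hasDerivAt_pos1 h).pow 2).congr_deriv ?_
    rcases lt_or_gt_of_ne h with h | h
    · simp [pos1_of_nonpos h.le]
    · simp [pos0_of_pos h]

theorem continuousAt_pos0 {z : ℝ} (hz : z ≠ 0) : ContinuousAt pos0 z := by
  rcases lt_or_gt_of_ne hz with h | h
  · refine continuousAt_const.congr (f := fun _ => (0:ℝ)) ?_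
    filter_upwards [Iio_mem_nhds h] with y hy
    exact (pos0_of_nonpos (le_of_lt hy)).symm
  · refine continuousAt_const.congr (f := fun _ => (1:ℝ)) ?_
    filter_upwards [Ioi_mem_nhds h] with y hy
    exact (pos0_of_pos hy).symm

theorem contDiff_pos2 : ContDiff ℝ 1 pos2 := by
  rw [contDiff_one_iff_deriv]
  refine ⟨fun z => (hasDerivAt_pos2 z).differentiableAt, ?_⟩
  have : deriv pos2 = fun z => 2 * pos1 z := funext fun z => (hasDerivAt_pos2 z).deriv
  rw [this]
  exact continuous_const.mul continuous_pos1

section Moments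

variable {d : ℕ} [NeZero d]

/-- The kink of `pos1` and the jump of `pos0` sit on a hyperplane, which is a null set. -/
theorem ae_coord_ne (s : ℝ) : ∀ᵐ x : Space d, x 0 ≠ s := by
  have h := Measure.ae_eval_ne (μ := fun _ : Fin d => (volume : Measure ℝ)) (0 : Fin d) s
  exact (PiLp.volume_preserving_ofLp (Fin d)).quasiMeasurePreserving.ae h

theorem abs_coord_le (x : Space d) (i : Fin d) : |x i| ≤ ‖x‖ := by
  have := PiLp.norm_apply_le x i
  simpa using this

theorem measurable_weight {φ : ℝ → ℝ} (hφ : Measurable φ) (l : ℝ) :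
    Measurable fun x : Space d => φ (x 0 - l) :=
  hφ.comp (Continuous.measurable (by fun_prop))

/-- Continuity of the moments in time and space. -/
theorem continuous_moment {φ : ℝ → ℝ} (hφm : Measurable φ) (hφc : ∀ z ≠ 0, ContinuousAt φ z)
    (hφb : ∀ z, |φ z| ≤ 1 + z ^ 2) {f : ℝ → Space d → ℝ} {K : Set (Space d)} (hK : IsCompact K)
    (hf : Continuous (Function.uncurry f)) (hf0 : ∀ t, ∀ y ∉ K, f t y = 0) :
    Continuous fun z : ℝ × ℝ => ∫ x, φ (x 0 - z.2) * f z.1 x := by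
  obtain ⟨B, hB⟩ := hK.isBounded.exists_norm_le
  refine continuous_integral_weight (X := ℝ × ℝ) (f := fun z x => f z.1 x)
    (g := fun z x => φ (x 0 - z.2)) hK ?_ (fun z y hy => hf0 z.1 y hy) ?_ ?_ ?_
  · exact hf.comp (by fun_prop : Continuous fun w : (ℝ × ℝ) × Space d => (w.1.1, w.2))
  · exact fun z => measurable_weight hφm z.2
  · intro z₀
    refine ⟨1 + (|B| + (|z₀.2| + 1)) ^ 2, ?_⟩
    have h1 : ∀ᶠ z : ℝ × ℝ in 𝓝 z₀, |z.2| < |z₀.2| + 1 :=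
      (continuous_snd.abs.continuousAt).eventually_lt_const (by simp)
    filter_upwards [h1] with z hz
    intro y hy
    refine (hφb _).trans ?_
    have h2 : |y 0 - z.2| ≤ |B| + (|z₀.2| + 1) := by
      have h3 := (abs_coord_le y 0).trans ((hB y hy).trans (le_abs_self B))
      exact (abs_sub _ _).trans (by linarith)
    have h4 : (y 0 - z.2) ^ 2 ≤ (|B| + (|z₀.2| + 1)) ^ 2 := by
      rw [← sq_abs]; gcongr
    linarith
  · intro z₀
    filter_upwards [ae_coord_ne (d := d) z₀.2] with y hy
    exact (hφc (y 0 - z₀.2) (sub_ne_zero.2 hy)).comp (f := fun z : ℝ × ℝ => y 0 - z.2)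
      (by fun_prop)

theorem abs_pos0_bound (z : ℝ) : |pos0 z| ≤ 1 + z ^ 2 :=
  (abs_pos0_le z).trans (by nlinarith [sq_nonneg z])

theorem abs_pos1_bound (z : ℝ) : |pos1 z| ≤ 1 + z ^ 2 := by
  refine (abs_pos1_le z).trans ?_
  nlinarith [sq_nonneg (|z| - 1), sq_abs z]

theorem abs_pos2_bound (z : ℝ) : |pos2 z| ≤ 1 + z ^ 2 := by
  have h := abs_pos1_le z
  have : pos2 z = pos1 z ^ 2 := rfl
  rw [this, abs_pow, ← sq_abs z]
  nlinarith [abs_nonneg (pos1 z)]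

variable {f : ℝ → Space d → ℝ} {t₀ T : ℝ} {K : Set (Space d)}

/-- The endpoint `a + b t` moves so that derivatives along characteristics can be taken directly.
The weight is Lipschitz in `t` and differentiable off a hyperplane, which is enough under the
integral sign. -/
theorem hasDerivAt_moment1 (hK : IsCompact K) (ht₀ : t₀ ∈ Set.Ioo 0 T)
    (hf : ∀ t ∈ Set.Ioo 0 T, ∀ x, ContDiffAt ℝ 1 (Function.uncurry f) (t, x))
    (hf0 : ∀ t ∈ Set.Ioo 0 T, ∀ x ∉ K, f t x = 0) (a b : ℝ) :
    HasDerivAt (fun t => ∫ x, pos1 (x 0 - (a + b * t)) * f t x)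
      (∫ x, (-b * pos0 (x 0 - (a + b * t₀)) * f t₀ x
        + pos1 (x 0 - (a + b * t₀)) * deriv (fun s => f s x) t₀)) t₀ := by
  obtain ⟨B, hB⟩ := hK.isBounded.exists_norm_le
  refine hasDerivAt_integral_weight (g := fun t x => pos1 (x 0 - (a + b * t)))
    (g' := fun x => -b * pos0 (x 0 - (a + b * t₀))) (Cg := |B| + (|a| + |b| * T)) (Lg := |b|)
    hK ht₀ hf hf0 (fun t => measurable_weight continuous_pos1.measurable _)
    ((measurable_weight measurable_pos0 _).const_mul _) ?_ ?_ ?_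
  · intro t ht x hx
    refine (abs_pos1_le _).trans ((abs_sub _ _).trans ?_)
    have h3 := (abs_coord_le x 0).trans ((hB x hx).trans (le_abs_self B))
    have h4 : |a + b * t| ≤ |a| + |b| * T := by
      refine (abs_add_le _ _).trans ?_
      rw [abs_mul, abs_of_pos ht.1]
      have := ht.2.le
      gcongr
    linarith
  · intro s _ t _ x _
    refine (abs_pos1_sub_le _ _).trans ?_
    rw [← abs_mul, abs_sub_comm]
    apply le_of_eq; congr 1; ring
  · filter_upwards [ae_coord_ne (d := d) (a + b * t₀)] with x hx
    have h1 : HasDerivAt (fun t : ℝ => x 0 - (a + b * t)) (-b) t₀ := by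
      refine ((((hasDerivAt_id t₀).const_mul b).const_add a).const_sub (x 0)).congr_deriv ?_
      ring
    refine ((hasDerivAt_pos1 (sub_ne_zero.2 hx)).comp t₀ h1).congr_deriv ?_
    ring

theorem hasDerivAt_moment2 (hK : IsCompact K) (ht₀ : t₀ ∈ Set.Ioo 0 T)
    (hf : ∀ t ∈ Set.Ioo 0 T, ∀ x, ContDiffAt ℝ 1 (Function.uncurry f) (t, x))
    (hf0 : ∀ t ∈ Set.Ioo 0 T, ∀ x ∉ K, f t x = 0) (a b : ℝ) :
    HasDerivAt (fun t => ∫ x, pos2 (x 0 - (a + b * t)) * f t x)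
      (∫ x, (-(2 * b) * pos1 (x 0 - (a + b * t₀)) * f t₀ x
        + pos2 (x 0 - (a + b * t₀)) * deriv (fun s => f s x) t₀)) t₀ := by
  obtain ⟨B, hB⟩ := hK.isBounded.exists_norm_le
  set C := |B| + (|a| + |b| * T) with hC
  have hle : ∀ t ∈ Set.Ioo 0 T, ∀ x ∈ K, |pos1 (x 0 - (a + b * t))| ≤ C := by
    intro t ht x hx
    refine (abs_pos1_le _).trans ((abs_sub _ _).trans ?_)
    have h3 := (abs_coord_le x 0).trans ((hB x hx).trans (le_abs_self B))
    have h4 : |a + b * t| ≤ |a| + |b| * T := by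
      refine (abs_add_le _ _).trans ?_
      rw [abs_mul, abs_of_pos ht.1]
      have := ht.2.le
      gcongr
    linarith
  have hp : ∀ z, pos2 z = pos1 z ^ 2 := fun z => rfl
  refine hasDerivAt_integral_weight (g := fun t x => pos2 (x 0 - (a + b * t)))
    (g' := fun x => -(2 * b) * pos1 (x 0 - (a + b * t₀))) (Cg := C ^ 2) (Lg := 2 * C * |b|)
    hK ht₀ hf hf0 (fun t => measurable_weight continuous_pos2.measurable _)
    ((measurable_weight continuous_pos1.measurable _).const_mul _) ?_ ?_ ?_
  · intro t ht x hx
    rw [hp, abs_pow]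
    have := hle t ht x hx
    gcongr
  · intro s hs t ht x hx
    rw [hp, hp, sq_sub_sq, abs_mul]
    have h1 := hle s hs x hx
    have h2 := hle t ht x hx
    have h3 : |pos1 (x 0 - (a + b * s)) + pos1 (x 0 - (a + b * t))| ≤ 2 * C :=
      (abs_add_le _ _).trans (by linarith)
    have h4 : |pos1 (x 0 - (a + b * s)) - pos1 (x 0 - (a + b * t))| ≤ |b| * |s - t| := by
      refine (abs_pos1_sub_le _ _).trans ?_
      rw [← abs_mul, abs_sub_comm]
      apply le_of_eq; congr 1; ring
    have : 0 ≤ 2 * C := (abs_nonneg _).trans h3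
    calc _ ≤ 2 * C * (|b| * |s - t|) := by gcongr
      _ = _ := by ring
  · refine Eventually.of_forall fun x => ?_
    have h1 : HasDerivAt (fun t : ℝ => x 0 - (a + b * t)) (-b) t₀ := by
      refine ((((hasDerivAt_id t₀).const_mul b).const_add a).const_sub (x 0)).congr_deriv ?_
      ring
    refine ((hasDerivAt_pos2 (x 0 - (a + b * t₀))).comp t₀ h1).congr_deriv ?_
    ring

/-! Integration by parts against the weights -/

theorem integral_pos2_mul_pderiv {F : Space d → ℝ} (hK : IsCompact K) (hF : ContDiff ℝ 1 F)
    (hF0 : ∀ x ∉ K, F x = 0) (l : ℝ) (j : Fin d) :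
    ∫ x, pos2 (x 0 - l) * pderiv j F x
      = if j = 0 then -(2 * ∫ x, pos1 (x 0 - l) * F x) else 0 := by
  have hw : ContDiff ℝ 1 fun x : Space d => pos2 (x 0 - l) :=
    contDiff_pos2.comp (by fun_prop)
  have h := integral_mul_pderiv hK hF hw hF0 j
  have h1 : ∀ x : Space d, pderiv j (fun x : Space d => pos2 (x 0 - l)) x
      = if j = 0 then 2 * pos1 (x 0 - l) else 0 := by
    intro x
    refine pderiv_eq_of_hasDerivAt ((hw.differentiable one_ne_zero) x) ?_
    by_cases hj : j = 0
    · subst hj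
      have h2 : HasDerivAt (fun s : ℝ => (x + s • EuclideanSpace.single (0 : Fin d) (1:ℝ)) 0 - l)
          1 0 := by
        simp only [PiLp.add_apply, PiLp.smul_apply, EuclideanSpace.single_apply, if_true,
          smul_eq_mul, mul_one]
        exact ((hasDerivAt_id (0:ℝ)).const_add (x 0)).sub_const l
      have h3 := (hasDerivAt_pos2 ((x + (0:ℝ) • EuclideanSpace.single (0 : Fin d) (1:ℝ)) 0
        - l)).comp (0:ℝ) h2
      refine h3.congr_deriv ?_
      simp
    · simp only [hj, if_false]
      refine (hasDerivAt_const (0:ℝ) (pos2 (x 0 - l))).congr_of_eventuallyEq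
        (Eventually.of_forall fun s => ?_)
      simp [EuclideanSpace.single_apply, Ne.symm hj]
  simp only [h1] at h
  have h4 : ∫ x, pos2 (x 0 - l) * pderiv j F x = ∫ x, pderiv j F x * pos2 (x 0 - l) := by
    simp only [mul_comm]
  rw [h4, eq_neg_iff_add_eq_zero.1 h |> fun e => (by linarith :
    ∫ x, pderiv j F x * pos2 (x 0 - l)
      = -∫ x, F x * (if j = 0 then 2 * pos1 (x 0 - l) else 0))]
  split_ifs with hj
  · rw [← integral_const_mul]
    congr 2; funext x; ring
  · simp

/-- The weight `pos1` is only Lipschitz, so the classical integration by parts used for `pos2` is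
replaced by the one for Lipschitz functions and line derivatives, valid almost everywhere. -/
theorem integral_pos1_mul_pderiv {F : Space d → ℝ} (hK : IsCompact K) (hF : ContDiff ℝ 1 F)
    (hF0 : ∀ x ∉ K, F x = 0) (l : ℝ) (j : Fin d) :
    ∫ x, pos1 (x 0 - l) * pderiv j F x
      = if j = 0 then -∫ x, pos0 (x 0 - l) * F x else 0 := by
  have hcs : HasCompactSupport F := HasCompactSupport.intro hK hF0
  obtain ⟨C, hC⟩ := hF.lipschitzWith_of_hasCompactSupport hcs one_ne_zero
  have hw : LipschitzWith 1 fun x : Space d => pos1 (x 0 - l) := by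
    refine LipschitzWith.of_dist_le_mul fun x y => ?_
    rw [Real.dist_eq, NNReal.coe_one, one_mul, dist_eq_norm]
    refine (abs_pos1_sub_le _ _).trans ?_
    have := abs_coord_le (x - y) 0
    rwa [sub_sub_sub_cancel_right]
  have h := hw.integral_lineDeriv_mul_eq (μ := volume) hC hcs (EuclideanSpace.single j (1:ℝ))
  have h1 : ∀ᵐ x : Space d, lineDeriv ℝ (fun x : Space d => pos1 (x 0 - l)) x
      (EuclideanSpace.single j (1:ℝ)) * F x = (if j = 0 then pos0 (x 0 - l) else 0) * F x := by
    filter_upwards [ae_coord_ne (d := d) l] with x hx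
    congr 1
    unfold lineDeriv
    by_cases hj : j = 0
    · subst hj
      have h2 : HasDerivAt (fun s : ℝ => (x + s • EuclideanSpace.single (0 : Fin d) (1:ℝ)) 0 - l)
          1 0 := by
        simp only [PiLp.add_apply, PiLp.smul_apply, EuclideanSpace.single_apply, if_true,
          smul_eq_mul, mul_one]
        exact ((hasDerivAt_id (0:ℝ)).const_add (x 0)).sub_const l
      have h3 := (hasDerivAt_pos1 (z := (x + (0:ℝ) • EuclideanSpace.single (0 : Fin d) (1:ℝ)) 0
        - l) (by simpa using sub_ne_zero.2 hx)).comp (0:ℝ) h2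
      refine h3.deriv.trans ?_
      simp
    · simp only [hj, if_false]
      have : (fun s : ℝ => pos1 ((x + s • EuclideanSpace.single j (1:ℝ)) 0 - l))
          = fun _ => pos1 (x 0 - l) := by
        funext s
        simp [EuclideanSpace.single_apply, Ne.symm hj]
      rw [this, deriv_const]
  have h2 : ∀ x, lineDeriv ℝ F x (-EuclideanSpace.single j (1:ℝ)) = -pderiv j F x := by
    intro x
    rw [((hF.differentiable one_ne_zero) x).lineDeriv_eq_fderiv, map_neg]
    rfl
  rw [integral_congr_ae h1] at h
  simp only [h2] at h
  have h4 : ∫ x, -pderiv j F x * pos1 (x 0 - l) = -∫ x, pos1 (x 0 - l) * pderiv j F x := by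
    rw [← integral_neg]; congr 1; funext x; ring
  rw [h4] at h
  split_ifs at h ⊢ with hj
  · linarith
  · simp only [zero_mul, integral_zero] at h
    linarith

end Moments

end DampedEuler
end

/-! ### Divergences tested against half-space weights. -/

noncomputable section
namespace DampedEuler

open MeasureTheory Filter Topology

theorem integral_lin3 {α : Type*} [MeasurableSpace α] {μ : Measure α} {f g h : α → ℝ}
    (hf : Integrable f μ) (hg : Integrable g μ) (hh : Integrable h μ) (a b c : ℝ) :
    ∫ x, (a * f x + b * g x + c * h x) ∂μ
      = a * (∫ x, f x ∂μ) + b * (∫ x, g x ∂μ) + c * ∫ x, h x ∂μ := by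
  rw [integral_add (f := fun x => a * f x + b * g x) (g := fun x => c * h x)
      ((hf.const_mul a).add (hg.const_mul b)) (hh.const_mul c),
    integral_add (hf.const_mul a) (hg.const_mul b), integral_const_mul, integral_const_mul,
    integral_const_mul]

section Divergence

variable {d : ℕ} [NeZero d] {K : Set (Space d)}

theorem integrable_weight_mul {φ : ℝ → ℝ} (hφm : Measurable φ) (hφb : ∀ z, |φ z| ≤ 1 + z ^ 2)
    {g : Space d → ℝ} (hK : IsCompact K) (hg : Continuous g) (hg0 : ∀ x ∉ K, g x = 0) (l : ℝ) :
    Integrable fun x => φ (x 0 - l) * g x := by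
  have hc : Continuous fun x : Space d => (1 + (x 0 - l) ^ 2) * |g x| := by fun_prop
  obtain ⟨C, hC⟩ := hK.exists_bound_of_continuousOn hc.continuousOn
  refine integrable_of_bound_on hK (C := C)
    ((measurable_weight hφm l).aestronglyMeasurable.mul hg.aestronglyMeasurable) ?_ ?_
  · intro x hx
    rw [abs_mul]
    refine le_trans ?_ (hC x hx)
    refine le_trans ?_ (le_abs_self _)
    exact mul_le_mul_of_nonneg_right (hφb _) (abs_nonneg _)
  · intro x hx
    simp [hg0 x hx]

theorem pderiv_eq_zero_of_notMem (hK : IsCompact K) {F : Space d → ℝ}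
    (hF0 : ∀ x ∉ K, F x = 0) (j : Fin d) : ∀ x ∉ K, pderiv j F x = 0 := by
  intro x hx
  have : F =ᶠ[𝓝 x] fun _ => 0 := by
    filter_upwards [hK.isClosed.isOpen_compl.mem_nhds hx] with y hy using hF0 y hy
  unfold pderiv
  rw [this.fderiv_eq]; simp

theorem continuous_pderiv {F : Space d → ℝ} (hF : ContDiff ℝ 1 F) (j : Fin d) :
    Continuous fun x => pderiv j F x :=
  (hF.continuous_fderiv one_ne_zero).clm_apply continuous_const

theorem integral_pos2_mul_div (hK : IsCompact K) {F : Fin d → Space d → ℝ}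
    (hF : ∀ j, ContDiff ℝ 1 (F j)) (hF0 : ∀ j, ∀ x ∉ K, F j x = 0) (l : ℝ) :
    ∫ x, pos2 (x 0 - l) * ∑ j, pderiv j (F j) x = -(2 * ∫ x, pos1 (x 0 - l) * F 0 x) := by
  simp only [Finset.mul_sum]
  rw [integral_finsetSum _ fun j _ => integrable_weight_mul continuous_pos2.measurable
    abs_pos2_bound hK (continuous_pderiv (hF j) j) (pderiv_eq_zero_of_notMem hK (hF0 j) j) l]
  rw [Finset.sum_congr rfl fun j _ => integral_pos2_mul_pderiv hK (hF j) (hF0 j) l j]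
  simp

theorem integral_pos1_mul_div (hK : IsCompact K) {F : Fin d → Space d → ℝ}
    (hF : ∀ j, ContDiff ℝ 1 (F j)) (hF0 : ∀ j, ∀ x ∉ K, F j x = 0) (l : ℝ) :
    ∫ x, pos1 (x 0 - l) * ∑ j, pderiv j (F j) x = -∫ x, pos0 (x 0 - l) * F 0 x := by
  simp only [Finset.mul_sum]
  rw [integral_finsetSum _ fun j _ => integrable_weight_mul continuous_pos1.measurable
    abs_pos1_bound hK (continuous_pderiv (hF j) j) (pderiv_eq_zero_of_notMem hK (hF0 j) j) l]
  rw [Finset.sum_congr rfl fun j _ => integral_pos1_mul_pderiv hK (hF j) (hF0 j) l j]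
  simp

end Divergence

/-! ### The functionals of Sideris -/

section Functionals

variable {d : ℕ} [NeZero d]

/-- The second moment of the density perturbation in the half-space `x₁ > l`. -/
def momP (P : Params) (ρ : ℝ → Space d → ℝ) (t l : ℝ) : ℝ :=
  ∫ x, pos2 (x 0 - l) * (ρ t x - P.rhoBar)

/-- The first moment of the density perturbation in the half-space `x₁ > l`. -/
def momN (P : Params) (ρ : ℝ → Space d → ℝ) (t l : ℝ) : ℝ :=
  ∫ x, pos1 (x 0 - l) * (ρ t x - P.rhoBar)

/-- Twice the first moment of the momentum in the half-space `x₁ > l`. -/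
def momQ (ρ : ℝ → Space d → ℝ) (u : ℝ → Space d → Space d) (t l : ℝ) : ℝ :=
  ∫ x, pos1 (x 0 - l) * (2 * (ρ t x * u t x 0))

/-- The source term of the wave equation for `momP`. -/
def momG (P : Params) (ρ : ℝ → Space d → ℝ) (u : ℝ → Space d → Space d) (t l : ℝ) : ℝ :=
  ∫ x, pos0 (x 0 - l) * (2 * (ρ t x * u t x 0 * u t x 0 + P.excess (ρ t x)))

/-- The weighted derivative of `momP` along the incoming characteristics. -/
def momY (P : Params) (ρ : ℝ → Space d → ℝ) (u : ℝ → Space d → Space d) (t l : ℝ) : ℝ :=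
  P.weight t * (momQ ρ u t l + 2 * P.sound * momN P ρ t l + P.damping t / 2 * momP P ρ t l)

namespace IsSmoothSolution

variable {P : Params} {ε : ℝ} {ρ₀ : Space d → ℝ} {u₀ : Space d → Space d} {T T₁ M : ℝ}
  {ρ : ℝ → Space d → ℝ} {u : ℝ → Space d → Space d}
  (S : IsSmoothSolution P ε ρ₀ u₀ T ρ u)
  (hbg : ∀ t ∈ Set.Ico 0 T, ∀ x : Space d, M + P.sound * t < ‖x‖ → ρ t x = P.rhoBar ∧ u t x = 0)
  (hT₁ : T₁ < T)
include S hbg hT₁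

omit S [NeZero d] in
theorem background_of_notMem {t : ℝ} (ht : t ∈ Set.Icc 0 T₁) {x : Space d}
    (hx : x ∉ Metric.closedBall (0 : Space d) (M + P.sound * T₁)) :
    ρ t x = P.rhoBar ∧ u t x = 0 := by
  refine hbg t ⟨ht.1, ht.2.trans_lt hT₁⟩ x ?_
  rw [Metric.mem_closedBall, dist_zero_right, not_le] at hx
  have := mul_le_mul_of_nonneg_left ht.2 P.sound_pos.le
  linarith

/-- Mass conservation integrated by parts gives `momQ`; the moving endpoint gives `momN`. The slope
`b` is free because both families of characteristics, `b = ± sound`, are used. -/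
theorem hasDerivAt_momP {t : ℝ} (ht : t ∈ Set.Ioo 0 T₁) (a b : ℝ) :
    HasDerivAt (fun s => momP P ρ s (a + b * s))
      (-(2 * b) * momN P ρ t (a + b * t) + momQ ρ u t (a + b * t)) t := by
  have hsub : ∀ s ∈ Set.Ioo 0 T₁, s ∈ Set.Ioo 0 T := fun s hs => ⟨hs.1, hs.2.trans hT₁⟩
  set K := Metric.closedBall (0 : Space d) (M + P.sound * T₁) with hKdef
  have hK : IsCompact K := isCompact_closedBall _ _
  have hb : ∀ s ∈ Set.Ioo 0 T₁, ∀ x ∉ K, ρ s x = P.rhoBar ∧ u s x = 0 := fun s hs x hx =>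
    background_of_notMem hbg hT₁ ⟨hs.1.le, hs.2.le⟩ hx
  have hd := hasDerivAt_moment2 (f := fun s x => ρ s x - P.rhoBar) hK ht
    (fun s hs x => ((S.contDiffAt_density (hsub s hs) x).sub contDiffAt_const).of_le (by simp))
    (fun s hs x hx => by simp [(hb s hs x hx).1]) a b
  refine hd.congr_deriv ?_
  set l := a + b * t
  have hF : ∀ j, ContDiff ℝ 1 fun y => ρ t y * u t y j := fun j =>
    contDiff_iff_contDiffAt.2 fun y => ((S.contDiffAt_density_slice (hsub t ht) y).mul
      (S.contDiffAt_velocity_slice (hsub t ht) y j)).of_le (by simp)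
  have hF0 : ∀ j, ∀ y ∉ K, ρ t y * u t y j = 0 := fun j y hy => by simp [(hb t ht y hy).2]
  have hderiv : ∀ x, deriv (fun s => ρ s x - P.rhoBar) t
      = -∑ j, pderiv j (fun y => ρ t y * u t y j) x := by
    intro x
    rw [deriv_sub_const]; linarith [S.mass t (hsub t ht) x]
  have hρc : Continuous (ρ t) := continuous_iff_continuousAt.2 fun y =>
    (S.contDiffAt_density_slice (hsub t ht) y).continuousAt
  simp only [hderiv, mul_neg]
  rw [integral_add, integral_neg, integral_pos2_mul_div hK hF hF0]
  · unfold momN momQ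
    rw [neg_neg, ← integral_const_mul, ← integral_const_mul]
    congr 1
    · congr 1; funext x; ring
    · congr 1; funext x; ring
  · simp only [mul_assoc]
    exact (integrable_weight_mul continuous_pos1.measurable abs_pos1_bound hK
      (hρc.sub continuous_const) (fun x hx => by simp [(hb t ht x hx).1]) l).const_mul _
  · exact (integrable_weight_mul continuous_pos2.measurable abs_pos2_bound hK
      (continuous_finsetSum _ fun j _ => continuous_pderiv (hF j) j) (fun x hx =>
        Finset.sum_eq_zero fun j _ => pderiv_eq_zero_of_notMem hK (hF0 j) j x hx) l).neg

/-- The derivative of the first moments along the outgoing characteristics. -/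
theorem hasDerivAt_momQ_add_momN {t : ℝ} (ht : t ∈ Set.Ioo 0 T₁) (a : ℝ) :
    HasDerivAt (fun s => momQ ρ u s (a + P.sound * s)
        + 2 * P.sound * momN P ρ s (a + P.sound * s))
      (momG P ρ u t (a + P.sound * t) - P.damping t * momQ ρ u t (a + P.sound * t)) t := by
  have hsub : ∀ s ∈ Set.Ioo 0 T₁, s ∈ Set.Ioo 0 T := fun s hs => ⟨hs.1, hs.2.trans hT₁⟩
  have htT := hsub t ht
  set c := P.sound with hc
  set K := Metric.closedBall (0 : Space d) (M + c * T₁) with hKdef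
  have hK : IsCompact K := isCompact_closedBall _ _
  have hb : ∀ s ∈ Set.Ioo 0 T₁, ∀ x ∉ K, ρ s x = P.rhoBar ∧ u s x = 0 := fun s hs x hx =>
    background_of_notMem hbg hT₁ ⟨hs.1.le, hs.2.le⟩ hx
  have hd1 := hasDerivAt_moment1 (f := fun s x => ρ s x - P.rhoBar) hK ht
    (fun s hs x => ((S.contDiffAt_density (hsub s hs) x).sub contDiffAt_const).of_le (by simp))
    (fun s hs x hx => by simp [(hb s hs x hx).1]) a c
  have hd2 := hasDerivAt_moment1 (f := fun s x => 2 * (ρ s x * u s x 0)) hK ht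
    (fun s hs x => (contDiffAt_const.mul ((S.contDiffAt_density (hsub s hs) x).mul
      (S.contDiffAt_velocity (hsub s hs) x 0))).of_le (by simp))
    (fun s hs x hx => by simp [(hb s hs x hx).2]) a c
  refine (hd2.add (hd1.const_mul (2 * c))).congr_deriv ?_
  set l := a + c * t
  have hρ1 : ContDiff ℝ 1 (ρ t) := contDiff_iff_contDiffAt.2 fun y =>
    (S.contDiffAt_density_slice htT y).of_le (by simp)
  have hu1 : ∀ j, ContDiff ℝ 1 fun y => u t y j := fun j => contDiff_iff_contDiffAt.2 fun y =>
    (S.contDiffAt_velocity_slice htT y j).of_le (by simp)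
  have hρc := hρ1.continuous
  have huc := fun j => (hu1 j).continuous
  have hF : ∀ j, ContDiff ℝ 1 fun y => ρ t y * u t y j := fun j => hρ1.mul (hu1 j)
  have hF0 : ∀ j, ∀ y ∉ K, ρ t y * u t y j = 0 := fun j y hy => by simp [(hb t ht y hy).2]
  have hH : ∀ j, ContDiff ℝ 1 fun y => ρ t y * u t y 0 * u t y j := fun j => (hF 0).mul (hu1 j)
  have hH0 : ∀ j, ∀ y ∉ K, ρ t y * u t y 0 * u t y j = 0 := fun j y hy => by
    simp [(hb t ht y hy).2]
  have hpos : ∀ y, 0 < ρ t y := fun y => S.density_pos t ⟨htT.1.le, htT.2⟩ y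
  have hp1 : ContDiff ℝ 1 fun y => P.pressure (ρ t y) - P.pressure P.rhoBar := by
    unfold Params.pressure
    exact (contDiff_const.mul (hρ1.rpow_const_of_ne fun y => (hpos y).ne')).sub contDiff_const
  have hp0 : ∀ y ∉ K, P.pressure (ρ t y) - P.pressure P.rhoBar = 0 := fun y hy => by
    simp [(hb t ht y hy).1]
  have hderiv1 : ∀ x, deriv (fun s => ρ s x - P.rhoBar) t
      = -∑ j, pderiv j (fun y => ρ t y * u t y j) x := by
    intro x
    rw [deriv_sub_const]; linarith [S.mass t htT x]
  have hderiv2 : ∀ x, deriv (fun s => 2 * (ρ s x * u s x 0)) t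
      = 2 * (-(∑ j, pderiv j (fun y => ρ t y * u t y 0 * u t y j) x)
        - pderiv 0 (fun y => P.pressure (ρ t y) - P.pressure P.rhoBar) x
        - P.damping t * (ρ t x * u t x 0)) := by
    intro x
    rw [deriv_const_mul_field']
    have h1 : pderiv 0 (fun y => P.pressure (ρ t y) - P.pressure P.rhoBar) x
        = pderiv 0 (fun y => P.pressure (ρ t y)) x := by
      unfold pderiv; rw [fderiv_sub_const]
    rw [h1]
    linear_combination 2 * S.momentum t htT x 0
  -- integrability
  have i0r := integrable_weight_mul (g := fun x => ρ t x - P.rhoBar) measurable_pos0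
    abs_pos0_bound hK (hρc.sub continuous_const) (fun x hx => by simp [(hb t ht x hx).1]) l
  have i0m := integrable_weight_mul measurable_pos0 abs_pos0_bound hK (hF 0).continuous (hF0 0) l
  have i1m := integrable_weight_mul continuous_pos1.measurable abs_pos1_bound hK
    (hF 0).continuous (hF0 0) l
  have i0h := integrable_weight_mul measurable_pos0 abs_pos0_bound hK (hH 0).continuous (hH0 0) l
  have i0p := integrable_weight_mul measurable_pos0 abs_pos0_bound hK hp1.continuous hp0 l
  have i1div := integrable_weight_mul continuous_pos1.measurable abs_pos1_bound hK
      (continuous_finsetSum Finset.univ fun j _ => continuous_pderiv (hF j) j) (fun x hx =>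
        Finset.sum_eq_zero fun j _ => pderiv_eq_zero_of_notMem hK (hF0 j) j x hx) l
  have i1divh := integrable_weight_mul continuous_pos1.measurable abs_pos1_bound hK
      (continuous_finsetSum Finset.univ fun j _ => continuous_pderiv (hH j) j) (fun x hx =>
        Finset.sum_eq_zero fun j _ => pderiv_eq_zero_of_notMem hK (hH0 j) j x hx) l
  have i1p := integrable_weight_mul continuous_pos1.measurable abs_pos1_bound hK
      (continuous_pderiv hp1 0) (pderiv_eq_zero_of_notMem hK hp0 0) l
  -- evaluation of the two integrals
  have e1 : ∫ x, (-c * pos0 (x 0 - l) * (ρ t x - P.rhoBar)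
        + pos1 (x 0 - l) * deriv (fun s => ρ s x - P.rhoBar) t)
      = -c * (∫ x, pos0 (x 0 - l) * (ρ t x - P.rhoBar))
        + ∫ x, pos0 (x 0 - l) * (ρ t x * u t x 0) := by
    have h := integral_lin3 i0r i1div i1div (-c) (-1) 0
    rw [integral_pos1_mul_div hK hF hF0] at h
    refine Eq.trans (integral_congr_ae (Eventually.of_forall fun x => ?_)) (h.trans (by ring))
    simp only [hderiv1]; ring
  have e2 : ∫ x, (-c * pos0 (x 0 - l) * (2 * (ρ t x * u t x 0))
        + pos1 (x 0 - l) * deriv (fun s => 2 * (ρ s x * u s x 0)) t)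
      = -2 * c * (∫ x, pos0 (x 0 - l) * (ρ t x * u t x 0))
        + 2 * (∫ x, pos0 (x 0 - l) * (ρ t x * u t x 0 * u t x 0))
        + 2 * (∫ x, pos0 (x 0 - l) * (P.pressure (ρ t x) - P.pressure P.rhoBar))
        - 2 * P.damping t * ∫ x, pos1 (x 0 - l) * (ρ t x * u t x 0) := by
    have h := (integral_add' (i0m.const_mul (-2 * c)) (((i1divh.const_mul (-2)).add
      (i1p.const_mul (-2))).add (i1m.const_mul (-2 * P.damping t))))
    have h' := integral_lin3 i1divh i1p i1m (-2) (-2) (-2 * P.damping t)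
    rw [integral_pos1_mul_div hK hH hH0, integral_pos1_mul_pderiv hK hp1 hp0, if_pos rfl] at h'
    have h0 : ∫ x, -2 * c * (pos0 (x 0 - l) * (ρ t x * u t x 0))
      = -2 * c * ∫ x, pos0 (x 0 - l) * (ρ t x * u t x 0) := integral_const_mul _ _
    refine Eq.trans (integral_congr_ae (Eventually.of_forall fun x => ?_))
      (h.trans ((congrArg₂ (· + ·) h0 h').trans (by ring)))
    simp only [hderiv2, Pi.add_apply]; ring
  have eG : momG P ρ u t l = 2 * (∫ x, pos0 (x 0 - l) * (ρ t x * u t x 0 * u t x 0))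
        + 2 * (∫ x, pos0 (x 0 - l) * (P.pressure (ρ t x) - P.pressure P.rhoBar))
        - 2 * c ^ 2 * (∫ x, pos0 (x 0 - l) * (ρ t x - P.rhoBar)) := by
    unfold momG Params.excess
    have h := integral_lin3 i0h i0p i0r 2 2 (-2 * c ^ 2)
    refine Eq.trans (integral_congr_ae (Eventually.of_forall fun x => ?_)) (h.trans (by ring))
    simp only; ring
  have eQ : momQ ρ u t l = 2 * ∫ x, pos1 (x 0 - l) * (ρ t x * u t x 0) := by
    unfold momQ
    rw [← integral_const_mul]
    congr 1; funext x; ring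
  -- The half-space integrals of `ρ u₁` cancel: `-2c` arises from the moving endpoint in `momQ`,
  -- `+2c` from mass conservation in `2c momN`. The term `-2c² (ρ - ρ̄)` is exactly the linear part
  -- that turns the pressure difference into the excess.
  rw [e1, e2, eG, eQ]
  ring

/-- The weighted functional along the incoming characteristics. -/
theorem hasDerivAt_weight_mul_momP {t : ℝ} (ht : t ∈ Set.Ioo 0 T₁) (a : ℝ) :
    HasDerivAt (fun s => P.weight s * momP P ρ s (a - P.sound * s))
      (momY P ρ u t (a - P.sound * t)) t := by
  have h1 := P.hasDerivAt_weight (by linarith [ht.1] : -1 < t)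
  have h2 := S.hasDerivAt_momP hbg hT₁ ht a (-P.sound)
  simp only [neg_mul, ← sub_eq_add_neg] at h2
  refine (h1.mul h2).congr_deriv ?_
  unfold momY
  ring

/-- The wave equation along the outgoing characteristics. -/
theorem hasDerivAt_momY {t : ℝ} (ht : t ∈ Set.Ioo 0 T₁) (a : ℝ) :
    HasDerivAt (fun s => momY P ρ u s (a + P.sound * s))
      (P.weight t * momG P ρ u t (a + P.sound * t)
        - P.potential t * (P.weight t * momP P ρ t (a + P.sound * t))) t := by
  have ht' : -1 < t := by linarith [ht.1]
  have h1 := P.hasDerivAt_weight ht'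
  have h2 := S.hasDerivAt_momP hbg hT₁ ht a P.sound
  have h3 := S.hasDerivAt_momQ_add_momN hbg hT₁ ht a
  have h4 := (P.hasDerivAt_damping ht').div_const 2
  have h5 := h1.mul (h3.add (h4.mul h2))
  unfold momY
  -- All terms in `momQ` and `momN` cancel, which is the purpose of the integrating factor and of
  -- the term `α/2 * momP` in `momY`; only `(α²/4 + α'/2) momP`, minus the potential times `momP`,
  -- survives.
  refine h5.congr_deriv ?_
  have : 1 + t ≠ 0 := by linarith
  unfold Params.potential
  simp only [Pi.add_apply, Pi.mul_apply]
  field_simp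
  ring

end IsSmoothSolution

end Functionals

end DampedEuler
end

/-! ### The representation formula in characteristic coordinates. -/

noncomputable section
namespace DampedEuler

open MeasureTheory Filter Topology

theorem continuous_comp_clamp {f : ℝ → ℝ} (hf : ∀ t, 0 ≤ t → ContinuousAt f t) {T : ℝ}
    (hT : 0 ≤ T) : Continuous fun t => f (clamp T t) :=
  continuous_iff_continuousAt.2 fun t =>
    (hf _ (clamp_mem hT).1).comp (continuous_clamp T).continuousAt

theorem Params.continuous_weight_clamp (P : Params) {T : ℝ} (hT : 0 ≤ T) :
    Continuous fun t => P.weight (clamp T t) :=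
  continuous_comp_clamp (fun _ ht => (P.hasDerivAt_weight (by linarith)).continuousAt) hT

theorem Params.continuous_damping_clamp (P : Params) {T : ℝ} (hT : 0 ≤ T) :
    Continuous fun t => P.damping (clamp T t) :=
  continuous_comp_clamp (fun _ ht => (P.hasDerivAt_damping (by linarith)).continuousAt) hT

theorem Params.continuous_potential_clamp (P : Params) {T : ℝ} (hT : 0 ≤ T) :
    Continuous fun t => P.potential (clamp T t) := by
  refine continuous_comp_clamp (fun t ht => ?_) hT
  have h := (P.hasDerivAt_damping (by linarith : -1 < t)).continuousAt
  have h1 : 2 * (1 + t) ≠ 0 := by positivity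
  unfold Params.potential
  exact ((continuousAt_const.mul h).div (by fun_prop) h1).sub ((h.pow 2).div_const 4)

theorem Params.continuous_excess (P : Params) : Continuous P.excess := by
  unfold Params.excess Params.pressure
  have := Real.continuous_rpow_const (q := P.γ) (by have := P.one_lt_γ; linarith)
  fun_prop

section Representation

variable {d : ℕ} [NeZero d]

/-- The weighted functional in characteristic coordinates. -/
def charV (P : Params) (ρ : ℝ → Space d → ℝ) (T₁ τ ξ : ℝ) : ℝ :=
  P.weight (clamp T₁ τ) * momP P ρ (clamp T₁ τ) (ξ + P.sound * clamp T₁ τ)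

/-- The weighted source term in characteristic coordinates. -/
def charG (P : Params) (ρ : ℝ → Space d → ℝ) (u : ℝ → Space d → Space d) (T₁ τ ξ : ℝ) : ℝ :=
  P.weight (clamp T₁ τ) * momG P ρ u (clamp T₁ τ) (ξ + P.sound * clamp T₁ τ)

namespace IsSmoothSolution

variable {P : Params} {ε : ℝ} {ρ₀ : Space d → ℝ} {u₀ : Space d → Space d} {T T₁ M : ℝ}
  {ρ : ℝ → Space d → ℝ} {u : ℝ → Space d → Space d}
  (S : IsSmoothSolution P ε ρ₀ u₀ T ρ u)
  (hbg : ∀ t ∈ Set.Ico 0 T, ∀ x : Space d, M + P.sound * t < ‖x‖ → ρ t x = P.rhoBar ∧ u t x = 0)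
  (hT₁ : T₁ < T) (hT₁0 : 0 < T₁)
include S hbg hT₁ hT₁0

omit [NeZero d] S in
theorem background_clamp (t : ℝ) {x : Space d}
    (hx : x ∉ Metric.closedBall (0 : Space d) (M + P.sound * T₁)) :
    ρ (clamp T₁ t) x = P.rhoBar ∧ u (clamp T₁ t) x = 0 :=
  background_of_notMem hbg hT₁ (clamp_mem hT₁0.le) hx

theorem continuous_momP_clamp :
    Continuous fun z : ℝ × ℝ => momP P ρ (clamp T₁ z.1) z.2 :=
  continuous_moment continuous_pos2.measurable (fun _ _ => continuous_pos2.continuousAt)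
    abs_pos2_bound (f := fun t x => ρ (clamp T₁ t) x - P.rhoBar) (isCompact_closedBall (0 : Space d) (M + P.sound * T₁))
    ((S.continuous_density hT₁0.le hT₁).sub continuous_const)
    (fun t y hy => by simp [(background_clamp hbg hT₁ hT₁0 t hy).1])

theorem continuous_momN_clamp :
    Continuous fun z : ℝ × ℝ => momN P ρ (clamp T₁ z.1) z.2 :=
  continuous_moment continuous_pos1.measurable (fun _ _ => continuous_pos1.continuousAt)
    abs_pos1_bound (f := fun t x => ρ (clamp T₁ t) x - P.rhoBar) (isCompact_closedBall (0 : Space d) (M + P.sound * T₁))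
    ((S.continuous_density hT₁0.le hT₁).sub continuous_const)
    (fun t y hy => by simp [(background_clamp hbg hT₁ hT₁0 t hy).1])

theorem continuous_velocity_coord :
    Continuous fun z : ℝ × Space d => u (clamp T₁ z.1) z.2 0 := by
  exact (EuclideanSpace.proj (𝕜 := ℝ) (0 : Fin d)).continuous.comp
    (S.continuous_velocity hT₁0.le hT₁)

theorem continuous_momQ_clamp :
    Continuous fun z : ℝ × ℝ => momQ ρ u (clamp T₁ z.1) z.2 :=
  continuous_moment continuous_pos1.measurable (fun _ _ => continuous_pos1.continuousAt)
    abs_pos1_bound (f := fun t x => 2 * (ρ (clamp T₁ t) x * u (clamp T₁ t) x 0))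
    (isCompact_closedBall (0 : Space d) (M + P.sound * T₁))
    (continuous_const.mul ((S.continuous_density hT₁0.le hT₁).mul
      (S.continuous_velocity_coord hbg hT₁ hT₁0)))
    (fun t y hy => by simp [(background_clamp hbg hT₁ hT₁0 t hy).2])

theorem continuous_momG_clamp :
    Continuous fun z : ℝ × ℝ => momG P ρ u (clamp T₁ z.1) z.2 :=
  continuous_moment measurable_pos0 (fun _ hz => continuousAt_pos0 hz)
    abs_pos0_bound (f := fun t x => 2 * (ρ (clamp T₁ t) x * u (clamp T₁ t) x 0
      * u (clamp T₁ t) x 0 + P.excess (ρ (clamp T₁ t) x)))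
    (isCompact_closedBall (0 : Space d) (M + P.sound * T₁))
    (continuous_const.mul ((((S.continuous_density hT₁0.le hT₁).mul
      (S.continuous_velocity_coord hbg hT₁ hT₁0)).mul
      (S.continuous_velocity_coord hbg hT₁ hT₁0)).add
      (P.continuous_excess.comp (S.continuous_density hT₁0.le hT₁))))
    (fun t y hy => by
      have h := background_clamp hbg hT₁ hT₁0 t hy
      simp [h.1, h.2, Params.excess])

theorem continuous_momY_clamp :
    Continuous fun z : ℝ × ℝ => momY P ρ u (clamp T₁ z.1) z.2 := by
  have h1 := (P.continuous_weight_clamp hT₁0.le).comp (continuous_fst (X := ℝ) (Y := ℝ))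
  have h2 := (P.continuous_damping_clamp hT₁0.le).comp (continuous_fst (X := ℝ) (Y := ℝ))
  unfold momY
  exact h1.mul (((S.continuous_momQ_clamp hbg hT₁ hT₁0).add
    (continuous_const.mul (S.continuous_momN_clamp hbg hT₁ hT₁0))).add
    ((h2.div_const 2).mul (S.continuous_momP_clamp hbg hT₁ hT₁0)))

omit [NeZero d] S hbg hT₁ hT₁0 in
theorem continuous_char (c : ℝ) :
    Continuous fun z : ℝ × ℝ => (z.1, z.2 + c * clamp T₁ z.1) := by
  have := (continuous_clamp T₁).comp (continuous_fst (X := ℝ) (Y := ℝ))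
  exact continuous_fst.prodMk (continuous_snd.add (continuous_const.mul this))

theorem continuous_charV : Continuous (Function.uncurry (charV P ρ T₁)) :=
  ((P.continuous_weight_clamp hT₁0.le).comp continuous_fst).mul
    ((S.continuous_momP_clamp hbg hT₁ hT₁0).comp (continuous_char P.sound))

theorem continuous_charG : Continuous (Function.uncurry (charG P ρ u T₁)) :=
  ((P.continuous_weight_clamp hT₁0.le).comp continuous_fst).mul
    ((S.continuous_momG_clamp hbg hT₁ hT₁0).comp (continuous_char P.sound))

theorem continuous_momP_zero : Continuous (momP P ρ 0) := by
  have h := (S.continuous_momP_clamp hbg hT₁ hT₁0).comp (Continuous.prodMk_right (0:ℝ))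
  have h0 : clamp T₁ 0 = 0 := clamp_eq ⟨le_rfl, hT₁0.le⟩
  simpa only [Function.comp_def, h0] using h

theorem continuous_momN_zero : Continuous (momN P ρ 0) := by
  have h := (S.continuous_momN_clamp hbg hT₁ hT₁0).comp (Continuous.prodMk_right (0:ℝ))
  have h0 : clamp T₁ 0 = 0 := clamp_eq ⟨le_rfl, hT₁0.le⟩
  simpa only [Function.comp_def, h0] using h

theorem continuous_momQ_zero : Continuous (momQ ρ u 0) := by
  have h := (S.continuous_momQ_clamp hbg hT₁ hT₁0).comp (Continuous.prodMk_right (0:ℝ))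
  have h0 : clamp T₁ 0 = 0 := clamp_eq ⟨le_rfl, hT₁0.le⟩
  simpa only [Function.comp_def, h0] using h

/-- Since `momP` has `l`-derivative `-2 momN`, the `momN` part of the initial value of `momY`
integrates to a difference of values of `momP`. Together with the initial value on the incoming
characteristic it makes up the symmetric mean in d'Alembert's formula. -/
theorem integral_momN_zero {t : ℝ} (ht : 0 ≤ t) (ξ : ℝ) {c : ℝ} :
    ∫ σ in (0:ℝ)..t, 2 * c * momN P ρ 0 (ξ + 2 * c * σ)
      = 1 / 2 * (momP P ρ 0 ξ - momP P ρ 0 (ξ + 2 * c * t)) := by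
  have hρ : ContDiff ℝ ∞ (ρ 0) :=
    S.smooth_density.comp_contDiff (f := fun x : Space d => ((0:ℝ), x))
      (contDiff_const.prodMk contDiff_id) fun x => ⟨⟨le_rfl, hT₁0.trans hT₁⟩, trivial⟩
  have hP := S.continuous_momP_zero hbg hT₁ hT₁0
  have hN := S.continuous_momN_zero hbg hT₁ hT₁0
  have := intervalIntegral.integral_eq_sub_of_hasDerivAt_of_le ht
    (f := fun σ => -(1 / 2) * momP P ρ 0 (ξ + 2 * c * σ))
    (f' := fun σ => 2 * c * momN P ρ 0 (ξ + 2 * c * σ))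
    (Continuous.continuousOn (by fun_prop)) ?_ (Continuous.intervalIntegrable (by fun_prop) _ _)
  · rw [this]
    simp only [mul_zero, add_zero]
    ring
  · intro σ hσ
    have hd := hasDerivAt_moment2 (f := fun _ x => ρ 0 x - P.rhoBar)
      (isCompact_closedBall (0 : Space d) (M + P.sound * T₁)) hσ
      (fun s _ x => ((hρ.comp contDiff_snd).contDiffAt.sub contDiffAt_const).of_le (by simp))
      (fun s _ x hx => by
        simp [(background_of_notMem hbg hT₁ ⟨le_rfl, hT₁0.le⟩ hx).1]) ξ (2 * c)
    refine (hd.const_mul (-(1 / 2))).congr_deriv ?_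
    unfold momN
    simp only [deriv_const, mul_zero, add_zero]
    rw [← integral_const_mul, ← integral_const_mul]
    congr 1; funext x; ring

/-- The representation formula for the weighted functional in characteristic coordinates. -/
theorem charV_eq {t : ℝ} (ht : t ∈ Set.Icc 0 T₁) (ξ : ℝ) :
    charV P ρ T₁ t ξ
      = 1 / 2 * (momP P ρ 0 ξ + momP P ρ 0 (ξ + 2 * P.sound * t))
      + (∫ σ in (0:ℝ)..t, (momQ ρ u 0 (ξ + 2 * P.sound * σ)
        + P.mu / 2 * momP P ρ 0 (ξ + 2 * P.sound * σ)))
      + coneIntegral P.sound (fun τ η => charG P ρ u T₁ τ η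
        - P.potential (clamp T₁ τ) * charV P ρ T₁ τ η) t ξ := by
  set c := P.sound with hc
  have h0 : clamp T₁ 0 = 0 := clamp_eq ⟨le_rfl, hT₁0.le⟩
  have hct : clamp T₁ t = t := clamp_eq ht
  have hYc := S.continuous_momY_clamp hbg hT₁ hT₁0
  set h : ℝ → ℝ → ℝ := fun τ η => charG P ρ u T₁ τ η
        - P.potential (clamp T₁ τ) * charV P ρ T₁ τ η with hh
  have hhc : Continuous (Function.uncurry h) :=
    (S.continuous_charG hbg hT₁ hT₁0).sub
      (((P.continuous_potential_clamp hT₁0.le).comp continuous_fst).mul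
        (S.continuous_charV hbg hT₁ hT₁0))
  -- integration along the outgoing characteristics
  have hout : ∀ τ ∈ Set.Icc 0 t, ∀ η, momY P ρ u τ (η + c * τ)
      = momY P ρ u 0 η + ∫ s in (0:ℝ)..τ, h s η := by
    intro τ hτ η
    have hcτ : clamp T₁ τ = τ := clamp_eq ⟨hτ.1, hτ.2.trans ht.2⟩
    have := intervalIntegral.integral_eq_sub_of_hasDerivAt_of_le hτ.1
      (f := fun s => momY P ρ u (clamp T₁ s) (η + c * s)) (f' := fun s => h s η)
      (hYc.comp (by fun_prop : Continuous fun s : ℝ => (s, η + c * s))).continuousOn ?_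
      ((continuous_slice hhc η).intervalIntegrable _ _)
    · rw [this]
      simp [h0, hcτ]
    · intro s hs
      have hs' : s ∈ Set.Ioo 0 T₁ := ⟨hs.1, hs.2.trans_le (hτ.2.trans ht.2)⟩
      have hcs : clamp T₁ s = s := clamp_eq ⟨hs'.1.le, hs'.2.le⟩
      refine ((S.hasDerivAt_momY hbg hT₁ hs' η).congr_of_eventuallyEq ?_).congr_deriv ?_
      · filter_upwards [clamp_eventuallyEq hs'] with z hz
        rw [hz]; rfl
      · simp only [hh, charG, charV, hcs]
  -- integration along the incoming characteristic
  have hPc := S.continuous_momP_clamp hbg hT₁ hT₁0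
  have hin := intervalIntegral.integral_eq_sub_of_hasDerivAt_of_le ht.1
      (f := fun s => P.weight (clamp T₁ s) * momP P ρ (clamp T₁ s) ((ξ + 2 * c * t) - c * s))
      (f' := fun s => momY P ρ u (clamp T₁ s) ((ξ + 2 * c * t) - c * s))
      (((P.continuous_weight_clamp hT₁0.le).mul (hPc.comp
        (by fun_prop : Continuous fun s : ℝ => (s, (ξ + 2 * c * t) - c * s)))).continuousOn) ?_
      ((hYc.comp (by fun_prop : Continuous fun s : ℝ =>
        (s, (ξ + 2 * c * t) - c * s))).intervalIntegrable _ _)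
  swap
  · intro s hs
    have hs' : s ∈ Set.Ioo 0 T₁ := ⟨hs.1, hs.2.trans_le ht.2⟩
    have hcs : clamp T₁ s = s := clamp_eq ⟨hs'.1.le, hs'.2.le⟩
    refine ((S.hasDerivAt_weight_mul_momP hbg hT₁ hs' (ξ + 2 * c * t)).congr_of_eventuallyEq
      ?_).congr_deriv ?_
    · filter_upwards [clamp_eventuallyEq hs'] with z hz
      rw [hz]; rfl
    · rw [hcs]
  have hY0 : Continuous (momY P ρ u 0) := by
    have := hYc.comp (Continuous.prodMk_right (0:ℝ))
    simpa only [Function.comp_def, h0] using this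
  -- With `σ = t - s`, the incoming characteristic through the apex meets at time `s` the outgoing
  -- characteristic labelled `ξ + 2cσ`. Inserting `hout` there produces the triangle, without a
  -- Jacobian factor.
  have hcov : ∫ s in (0:ℝ)..t, momY P ρ u (clamp T₁ s) ((ξ + 2 * c * t) - c * s)
      = ∫ σ in (0:ℝ)..t, (momY P ρ u 0 (ξ + 2 * c * σ)
        + ∫ s in (0:ℝ)..(t - σ), h s (ξ + 2 * c * σ)) := by
    have e := intervalIntegral.integral_comp_sub_left (a := 0) (b := t)
      (fun σ => momY P ρ u 0 (ξ + 2 * c * σ)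
        + ∫ s in (0:ℝ)..(t - σ), h s (ξ + 2 * c * σ)) t
    rw [sub_self, sub_zero] at e
    rw [← e]
    refine intervalIntegral.integral_congr fun s hs => ?_
    rw [Set.uIcc_of_le ht.1] at hs
    have hcs : clamp T₁ s = s := clamp_eq ⟨hs.1, hs.2.trans ht.2⟩
    simp only [hcs]
    rw [sub_sub_cancel, ← hout s hs]
    congr 1; ring
  have hN := S.continuous_momN_zero hbg hT₁ hT₁0
  have hP := S.continuous_momP_zero hbg hT₁ hT₁0
  have hQ := S.continuous_momQ_zero hbg hT₁ hT₁0
  have hY0eq : ∫ σ in (0:ℝ)..t, momY P ρ u 0 (ξ + 2 * c * σ)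
      = (∫ σ in (0:ℝ)..t, (momQ ρ u 0 (ξ + 2 * c * σ) + P.mu / 2 * momP P ρ 0 (ξ + 2 * c * σ)))
        + 1 / 2 * (momP P ρ 0 ξ - momP P ρ 0 (ξ + 2 * c * t)) := by
    rw [← S.integral_momN_zero hbg hT₁ hT₁0 ht.1 ξ, ← intervalIntegral.integral_add
      (Continuous.intervalIntegrable (by fun_prop) _ _)
      (Continuous.intervalIntegrable (by fun_prop) _ _)]
    refine intervalIntegral.integral_congr fun σ _ => ?_
    simp only [momY, P.weight_zero, P.damping_zero]
    ring
  rw [hcov, intervalIntegral.integral_add (Continuous.intervalIntegrable (by fun_prop) _ _)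
    ((continuous_inner hhc c t ξ).intervalIntegrable _ _), hY0eq] at hin
  simp only [h0, hct, P.weight_zero, mul_zero, sub_zero, one_mul] at hin
  unfold charV coneIntegral
  rw [hct]
  rw [show ξ + 2 * c * t - c * t = ξ + c * t by ring] at hin
  linarith

omit S in
-- For `η ≥ M` the half-space `x₁ > η + ct` lies outside the ball reached by the perturbation at
-- time `t`.
theorem charV_eq_zero {τ : ℝ} (η : ℝ) (hη : M ≤ η) : charV P ρ T₁ τ η = 0 := by
  unfold charV momP
  have hτ : clamp T₁ τ ∈ Set.Icc 0 T₁ := clamp_mem hT₁0.le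
  rw [integral_eq_zero_of_ae, mul_zero]
  refine Eventually.of_forall fun x => ?_
  simp only [Pi.zero_apply]
  rcases le_or_gt (x 0) (η + P.sound * clamp T₁ τ) with h | h
  · rw [pos2_of_nonpos (by linarith), zero_mul]
  · have h1 := (le_abs_self _).trans (abs_coord_le x 0)
    rw [(hbg _ ⟨hτ.1, hτ.2.trans_lt hT₁⟩ x (by linarith)).1, sub_self, mul_zero]

omit hbg hT₁ hT₁0 in
theorem momG_nonneg {t : ℝ} (ht : t ∈ Set.Ico 0 T) (l : ℝ) : 0 ≤ momG P ρ u t l := by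
  refine integral_nonneg fun x => mul_nonneg (pos0_nonneg _) ?_
  have h1 := S.density_pos t ht x
  have h2 := P.excess_nonneg h1.le
  have h3 : 0 ≤ ρ t x * u t x 0 * u t x 0 := by
    rw [mul_assoc]; exact mul_nonneg h1.le (mul_self_nonneg _)
  linarith

end IsSmoothSolution

end Representation

end DampedEuler
end

noncomputable section
namespace DampedEuler

open MeasureTheory Filter Topology

/-! ### The lower bound for the source term -/

theorem Params.one_lt_expo (P : Params) : 1 < P.expo := lt_min P.one_lt_γ (by norm_num)

theorem Params.expo_le_two (P : Params) : P.expo ≤ 2 := min_le_right _ _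

/-- Because `p ≤ 2 ` and `s ≥ 1`, rescaling costs at most `s²` for either power. -/
theorem min_pow_scale {p s x : ℝ} (hp : p ≤ 2) (hs : 1 ≤ s) (hx : 0 ≤ x) :
    min (x ^ 2) (x ^ p) / s ^ 2 ≤ min ((x / s) ^ 2) ((x / s) ^ p) := by
  have hs0 : 0 < s := by linarith
  refine le_min ?_ ?_
  · rw [div_pow]
    exact div_le_div_of_nonneg_right (min_le_left _ _) (by positivity)
  · rw [Real.div_rpow hx hs0.le]
    refine (div_le_div_of_nonneg_right (min_le_right _ _) (by positivity)).trans ?_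
    refine div_le_div_of_nonneg_left (by positivity) (by positivity) ?_
    rw [← Real.rpow_two]
    exact Real.rpow_le_rpow_of_exponent_le hs hp

/-- Dividing by the argument leaves `min y (y ^ (p - 1))`, which is nondecreasing. This stands in
for Hölder's inequality, since `min (y²) (y ^ p)` is not a single power. -/
theorem mul_min_pow_le {p a y : ℝ} (hp : 1 ≤ p) (ha : 0 < a) (hay : a ≤ y) :
    y * min (a ^ 2) (a ^ p) ≤ a * min (y ^ 2) (y ^ p) := by
  have hy : 0 < y := ha.trans_le hay
  have e : ∀ z : ℝ, 0 < z → min (z ^ 2) (z ^ p) = z * min z (z ^ (p - 1)) := by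
    intro z hz
    rw [mul_min_of_nonneg _ _ hz.le, ← sq, Real.rpow_sub_one hz.ne', mul_div_cancel₀ _ hz.ne']
  rw [e a ha, e y hy, mul_left_comm]
  have h : min a (a ^ (p - 1)) ≤ min y (y ^ (p - 1)) :=
    min_le_min hay (Real.rpow_le_rpow ha.le hay (by linarith))
  exact mul_le_mul_of_nonneg_left (mul_le_mul_of_nonneg_left h hy.le) ha.le

/-! ### The volume of the region near the front. -/

section Cap

variable {d : ℕ} [NeZero d]

/-- The cap cut off a ball by a half-space. -/
def cap (d : ℕ) [NeZero d] (R l : ℝ) : Set (Space d) := {x | l < x 0 ∧ ‖x‖ ≤ R}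

theorem measurableSet_cap (R l : ℝ) : MeasurableSet (cap d R l) := by
  refine MeasurableSet.inter ?_ ?_
  · exact (isOpen_lt continuous_const (by fun_prop : Continuous fun x : Space d => x 0)).measurableSet
  · exact (isClosed_le continuous_norm continuous_const).measurableSet

theorem volume_cap_lt_top (R l : ℝ) : volume (cap d R l) < ⊤ := by
  refine (measure_mono ?_).trans_lt (measure_closedBall_lt_top (x := (0 : Space d)) (r := R))
  intro x hx
  simpa using hx.2

theorem sq_coord_add_sq_coord_le (x : Space d) {j : Fin d} (hj : j ≠ 0) :
    x 0 ^ 2 + x j ^ 2 ≤ ‖x‖ ^ 2 := by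
  rw [EuclideanSpace.real_norm_sq_eq, ← Finset.sum_pair (f := fun i => x i ^ 2) hj.symm]
  exact Finset.sum_le_sum_of_subset_of_nonneg (Finset.subset_univ _) fun i _ _ => sq_nonneg _

/-- In the cap the transversal coordinates satisfy `x_j² ≤ R² - l² ≤ 2R`, since its height `R - l`
is at most 1; so it lies in a box of height 1 and transversal side `2 √(2R)`. -/
theorem volume_cap_le {R l : ℝ} (hl : 0 < l) (hR : R ≤ l + 1) :
    volume.real (cap d R l) ≤ (2 * Real.sqrt (2 * R)) ^ (d - 1) := by
  set s := Real.sqrt (2 * R) with hs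
  set B : Set (Fin d → ℝ) := Set.univ.pi fun j => if j = 0 then Set.Icc l (l + 1)
    else Set.Icc (-s) s with hB
  have hBm : MeasurableSet B := MeasurableSet.univ_pi fun j => by
    split_ifs <;> exact measurableSet_Icc
  have hsub : cap d R l ⊆ (WithLp.ofLp : Space d → Fin d → ℝ) ⁻¹' B := by
    rintro x ⟨h1, h2⟩
    have hR0 : 0 ≤ R := (norm_nonneg x).trans h2
    have h3 := (le_abs_self _).trans (abs_coord_le x 0)
    intro j _
    show x j ∈ if j = 0 then Set.Icc l (l + 1) else Set.Icc (-s) s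
    split_ifs with hj
    · rw [hj]; exact ⟨h1.le, by linarith⟩
    · have h4 := sq_coord_add_sq_coord_le x hj
      have h5 : x j ^ 2 ≤ 2 * R := by
        have : ‖x‖ ^ 2 ≤ R ^ 2 := pow_le_pow_left₀ (norm_nonneg x) h2 2
        nlinarith
      exact Set.mem_Icc.2 (abs_le.1 (Real.abs_le_sqrt h5))
  have hv : volume B = ENNReal.ofReal ((2 * s) ^ (d - 1)) := by
    rw [hB, volume_pi_pi, Fintype.prod_eq_mul_prod_compl 0, if_pos rfl]
    rw [Finset.prod_congr rfl (g := fun _ => ENNReal.ofReal (2 * s))]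
    · rw [Finset.prod_const, Finset.card_compl]
      simp [ENNReal.ofReal_pow (by positivity : 0 ≤ 2 * s)]
    · intro j hj
      have hj : j ≠ 0 := by simpa using hj
      rw [if_neg hj, Real.volume_Icc]
      congr 1; ring
  have hp := (PiLp.volume_preserving_ofLp (Fin d)).measure_preimage hBm.nullMeasurableSet
  refine ENNReal.toReal_le_of_le_ofReal (by positivity) ?_
  rw [← hv, ← hp]
  exact measure_mono hsub

end Cap

namespace IsSmoothSolution

variable {d : ℕ} [NeZero d] {P : Params} {ε : ℝ} {ρ₀ : Space d → ℝ} {u₀ : Space d → Space d}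
  {T T₁ M : ℝ} {ρ : ℝ → Space d → ℝ} {u : ℝ → Space d → Space d}
  (S : IsSmoothSolution P ε ρ₀ u₀ T ρ u)
  (hbg : ∀ t ∈ Set.Ico 0 T, ∀ x : Space d, M + P.sound * t < ‖x‖ → ρ t x = P.rhoBar ∧ u t x = 0)
  (hT₁ : T₁ < T) (hT₁0 : 0 < T₁)
include S hbg hT₁ hT₁0

omit [NeZero d] hbg in
theorem continuous_slice_density {t : ℝ} (ht : t ∈ Set.Icc 0 T₁) : Continuous (ρ t) := by
  have h := (S.continuous_density hT₁0.le hT₁).comp (Continuous.prodMk_right t)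
  simpa only [Function.comp_def, clamp_eq ht] using h

theorem continuous_slice_velocity {t : ℝ} (ht : t ∈ Set.Icc 0 T₁) :
    Continuous fun x => u t x 0 := by
  have h := (S.continuous_velocity_coord hbg hT₁ hT₁0).comp (Continuous.prodMk_right t)
  simpa only [Function.comp_def, clamp_eq ht] using h

/-- A reverse estimate of Hölder type. On the cap the weight `(x₁ - l)²` is at most 1, so `momP` is
at most the integral of the positive part of `ρ - ρ̄`. Values below a threshold account for at most
half of it, and values above are controlled linearly by the excess. -/
theorem momG_ge {k₀ W t l : ℝ} (hk₀ : 0 < k₀)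
    (hex : ∀ y, 0 ≤ y → k₀ * min (y ^ 2) (y ^ P.expo) ≤ P.excess (P.rhoBar + y))
    (ht : t ∈ Set.Icc 0 T₁) (hl : M + P.sound * t ≤ l + 1) (hW1 : 1 ≤ W)
    (hW : volume.real (cap d (M + P.sound * t) l) ≤ W) (hP : 0 < momP P ρ t l) :
    k₀ / (2 * W) * min (momP P ρ t l ^ 2) (momP P ρ t l ^ P.expo) ≤ momG P ρ u t l := by
  have hp1 := P.one_lt_expo
  have htT : t ∈ Set.Ico 0 T := ⟨ht.1, ht.2.trans_lt hT₁⟩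
  set R := M + P.sound * t with hR
  set K := Metric.closedBall (0 : Space d) (M + P.sound * T₁) with hKdef
  have hK : IsCompact K := isCompact_closedBall _ _
  have hbK : ∀ x ∉ K, ρ t x = P.rhoBar ∧ u t x = 0 := fun x hx =>
    background_of_notMem hbg hT₁ ht hx
  have hρc := S.continuous_slice_density hT₁ hT₁0 ht
  have huc := S.continuous_slice_velocity hbg hT₁ hT₁0 ht
  set p := momP P ρ t l with hpdef
  -- The threshold: density perturbations below `a` contribute at most `W a = p / 2` on a cap of
  -- volume at most `W`.
  set a := p / (2 * W) with ha
  have ha0 : 0 < a := by positivity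
  set ψ : ℝ → ℝ := fun y => min (y ^ 2) (y ^ P.expo) with hψ
  have hψa : 0 < ψ a := lt_min (by positivity) (by positivity)
  set G : Space d → ℝ := fun x => pos0 (x 0 - l)
    * (2 * (ρ t x * u t x 0 * u t x 0 + P.excess (ρ t x))) with hG
  have hGint : Integrable G := by
    refine integrable_weight_mul measurable_pos0 abs_pos0_bound hK ?_ ?_ l
    · exact continuous_const.mul (((hρc.mul huc).mul huc).add (P.continuous_excess.comp hρc))
    · intro x hx
      simp [(hbK x hx).1, (hbK x hx).2, Params.excess]
  have hPint : Integrable fun x : Space d => pos2 (x 0 - l) * (ρ t x - P.rhoBar) := by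
    refine integrable_weight_mul continuous_pos2.measurable abs_pos2_bound hK
      (hρc.sub continuous_const) ?_ l
    intro x hx
    simp [(hbK x hx).1]
  have hIint : Integrable ((cap d R l).indicator fun _ => a) :=
    (integrableOn_const (volume_cap_lt_top R l).ne).integrable_indicator (measurableSet_cap R l)
  have hpt : ∀ x, pos2 (x 0 - l) * (ρ t x - P.rhoBar)
      ≤ (cap d R l).indicator (fun _ => a) x + a / (2 * k₀ * ψ a) * G x := by
    intro x
    have hρ := S.density_pos t htT x
    have hE := P.excess_nonneg hρ.le
    have hGx : 2 * pos0 (x 0 - l) * P.excess (ρ t x) ≤ G x := by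
      have h3 : 0 ≤ ρ t x * u t x 0 * u t x 0 := by
        rw [mul_assoc]; exact mul_nonneg hρ.le (mul_self_nonneg _)
      have := mul_nonneg (pos0_nonneg (x 0 - l)) h3
      simp only [hG]; linarith
    have hG0 : 0 ≤ G x := (mul_nonneg (mul_nonneg two_pos.le (pos0_nonneg _)) hE).trans hGx
    have hco : 0 ≤ a / (2 * k₀ * ψ a) := by positivity
    have hind : 0 ≤ (cap d R l).indicator (fun _ => a) x :=
      Set.indicator_nonneg (fun _ _ => ha0.le) x
    have hnn : 0 ≤ (cap d R l).indicator (fun _ => a) x + a / (2 * k₀ * ψ a) * G x :=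
      add_nonneg hind (mul_nonneg hco hG0)
    rcases le_or_gt (x 0 - l) 0 with h | h
    · rw [pos2_of_nonpos h, zero_mul]; exact hnn
    rcases lt_or_ge R ‖x‖ with h' | h'
    · rw [(hbg t htT x h').1, sub_self, mul_zero]; exact hnn
    rcases le_or_gt (ρ t x - P.rhoBar) 0 with hr | hr
    · refine (mul_nonpos_of_nonneg_of_nonpos ?_ hr).trans hnn
      rw [pos2_of_nonneg h.le]; positivity
    have hmem : x ∈ cap d R l := ⟨by linarith, h'⟩
    have h1 := (le_abs_self _).trans (abs_coord_le x 0)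
    have hw : pos2 (x 0 - l) ≤ 1 := by
      rw [pos2_of_nonneg h.le]; nlinarith
    refine (mul_le_of_le_one_left hr.le hw).trans ?_
    rw [Set.indicator_of_mem hmem]
    rcases le_or_gt (ρ t x - P.rhoBar) a with hra | hra
    · linarith [mul_nonneg hco hG0]
    have h2 := mul_min_pow_le hp1.le ha0 hra.le
    have h3 := hex _ hr.le
    rw [add_sub_cancel] at h3
    rw [pos0_of_pos h] at hGx
    have h4 : ρ t x - P.rhoBar ≤ a / (2 * k₀ * ψ a) * G x := by
      rw [div_mul_eq_mul_div, le_div_iff₀ (by positivity)]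
      have h5 := mul_le_mul_of_nonneg_left h3 ha0.le
      have h6 := mul_le_mul_of_nonneg_left h2 hk₀.le
      have h7 := mul_le_mul_of_nonneg_left hGx ha0.le
      simp only [hψ]
      linarith
    linarith
  have hint := integral_mono hPint (hIint.add (hGint.const_mul _)) hpt
  simp only [Pi.add_apply] at hint
  rw [integral_add hIint (hGint.const_mul _), integral_const_mul,
    integral_indicator_const a (measurableSet_cap R l), smul_eq_mul] at hint
  change p ≤ volume.real (cap d R l) * a + a / (2 * k₀ * ψ a) * momG P ρ u t l at hint
  have h1 : volume.real (cap d R l) * a ≤ p / 2 := by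
    refine (mul_le_mul_of_nonneg_right hW ha0.le).trans (le_of_eq ?_)
    rw [ha]; field_simp
  have h2 : p / 2 ≤ a / (2 * k₀ * ψ a) * momG P ρ u t l := by linarith
  rw [div_mul_eq_mul_div, le_div_iff₀ (by positivity)] at h2
  have h3 : 2 * W * (k₀ * ψ a) ≤ momG P ρ u t l := by
    have e : p = 2 * W * a := by rw [ha]; field_simp
    rw [e] at h2
    refine le_of_mul_le_mul_left ?_ ha0
    linarith
  refine le_trans ?_ h3
  have h4 := min_pow_scale (x := p) P.expo_le_two (by linarith : 1 ≤ 2 * W) hP.le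
  have h5 := mul_le_mul_of_nonneg_left h4 (by positivity : 0 ≤ 2 * W * k₀)
  simp only [hψ, ha]
  rw [← mul_assoc]
  refine le_trans (le_of_eq ?_) h5
  field_simp

end IsSmoothSolution

theorem exists_cap_bound {d : ℕ} [NeZero d] (c M : ℝ) (hc : 0 < c) (hM : 0 < M) :
    ∃ C ≥ 1, ∀ t l, 0 ≤ t → 0 < l → M + c * t ≤ l + 1 →
      volume.real (cap d (M + c * t) l) ≤ C * (1 + t) ^ (((d:ℝ) - 1) / 2) := by
  refine ⟨max 1 ((2 * Real.sqrt (2 * (M + c))) ^ (d - 1)), le_max_left _ _,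
    fun t l ht hl h => ?_⟩
  refine (volume_cap_le hl h).trans ?_
  have h1 : M + c * t ≤ (M + c) * (1 + t) := by nlinarith
  have h2 : Real.sqrt (2 * (M + c * t)) ≤ Real.sqrt (2 * (M + c)) * Real.sqrt (1 + t) := by
    rw [← Real.sqrt_mul (by positivity)]
    exact Real.sqrt_le_sqrt (by linarith)
  have hd : ((d - 1 : ℕ) : ℝ) = (d:ℝ) - 1 := by
    rw [Nat.cast_sub (Nat.one_le_iff_ne_zero.2 (NeZero.ne d))]; simp
  have h3 : Real.sqrt (1 + t) ^ (d - 1) = (1 + t) ^ (((d:ℝ) - 1) / 2) := by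
    rw [Real.sqrt_eq_rpow, ← Real.rpow_natCast, ← Real.rpow_mul (by linarith), hd]
    congr 1; ring
  calc (2 * Real.sqrt (2 * (M + c * t))) ^ (d - 1)
      ≤ (2 * Real.sqrt (2 * (M + c)) * Real.sqrt (1 + t)) ^ (d - 1) := by
        refine pow_le_pow_left₀ (by positivity) (by linarith) _
    _ = (2 * Real.sqrt (2 * (M + c))) ^ (d - 1) * (1 + t) ^ (((d:ℝ) - 1) / 2) := by
        rw [mul_pow, h3]
    _ ≤ _ := mul_le_mul_of_nonneg_right (le_max_right _ _) (by positivity)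

/-- The cap volume `W` and one factor of the integrating factor end up in the denominator, and their
product is `O(1 + t)` in the admitted cases. The borderline decay `1 / (1 + t)` is what the blowup
argument needs. The constant `k` does not depend on `ε` or on the solution. -/
theorem exists_charG_ge {d : ℕ} [NeZero d] (P : Params)
    (hcase : (P.lam = 1 ∧ P.mu ≤ 1 ∧ d = 2) ∨ (1 < P.lam ∧ (d = 2 ∨ d = 3)))
    {M : ℝ} (hM : 0 < M) :
    ∃ k > 0, ∀ (ε : ℝ) (ρ₀ : Space d → ℝ) (u₀ : Space d → Space d) (T T₁ : ℝ)
      (ρ : ℝ → Space d → ℝ) (u : ℝ → Space d → Space d),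
      IsSmoothSolution P ε ρ₀ u₀ T ρ u →
      (∀ t ∈ Set.Ico 0 T, ∀ x : Space d,
        M + P.sound * t < ‖x‖ → ρ t x = P.rhoBar ∧ u t x = 0) →
      T₁ < T → 0 < T₁ → ∀ t ∈ Set.Icc 0 T₁, ∀ ξ, 0 < ξ → M ≤ ξ + 1 → 0 < charV P ρ T₁ t ξ →
      k / (1 + t) * min (charV P ρ T₁ t ξ ^ 2) (charV P ρ T₁ t ξ ^ P.expo)
        ≤ charG P ρ u T₁ t ξ := by
  obtain ⟨k₀, hk₀, hex⟩ := P.exists_excess_ge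
  obtain ⟨C₁, hC₁, hCE⟩ := P.exists_weight_bound hcase
  obtain ⟨C₂, hC₂, hCW⟩ := exists_cap_bound (d := d) P.sound M P.sound_pos hM
  have hlam : 1 ≤ P.lam := by rcases hcase with h | h <;> linarith [h.1]
  refine ⟨k₀ / (2 * C₂ * C₁), by positivity,
    fun ε ρ₀ u₀ T T₁ ρ u S hbg hT₁ hT₁0 t ht ξ hξ hξM hV => ?_⟩
  have hct : clamp T₁ t = t := clamp_eq ht
  simp only [charV, charG, hct] at hV ⊢
  have ht1 : 1 ≤ 1 + t := by linarith [ht.1]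
  have hE := P.one_le_weight hlam ht.1
  have hE0 : 0 < P.weight t := by linarith
  have hct0 : 0 ≤ P.sound * t := mul_nonneg P.sound_pos.le ht.1
  set p := momP P ρ t (ξ + P.sound * t) with hp
  have hp0 : 0 < p := pos_of_mul_pos_right hV hE0.le
  set W := C₂ * (1 + t) ^ (((d:ℝ) - 1) / 2) with hW
  have hd1 : (1:ℝ) ≤ d := by exact_mod_cast Nat.one_le_iff_ne_zero.2 (NeZero.ne d)
  have hr1 : 1 ≤ (1 + t) ^ (((d:ℝ) - 1) / 2) := Real.one_le_rpow ht1 (by linarith)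
  have hW1 : 1 ≤ W := one_le_mul_of_one_le_of_one_le hC₂ hr1
  have hG := S.momG_ge hbg hT₁ hT₁0 hk₀ hex ht (l := ξ + P.sound * t) (by linarith) hW1
    (hCW t _ ht.1 (by linarith) (by linarith)) hp0
  have hsc := min_pow_scale (x := P.weight t * p) P.expo_le_two hE hV.le
  rw [mul_div_cancel_left₀ _ hE0.ne'] at hsc
  set m := min ((P.weight t * p) ^ 2) ((P.weight t * p) ^ P.expo) with hm
  have hm0 : 0 ≤ m := le_min (by positivity) (by positivity)
  have hWE : W * P.weight t ≤ C₂ * (C₁ * (1 + t)) := by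
    rw [hW, mul_assoc]
    exact mul_le_mul_of_nonneg_left (hCE t ht.1) (by linarith)
  calc k₀ / (2 * C₂ * C₁) / (1 + t) * m
      = k₀ / (2 * (C₂ * (C₁ * (1 + t)))) * m := by rw [div_div]; congr 2; ring
    _ ≤ k₀ / (2 * (W * P.weight t)) * m := by
        refine mul_le_mul_of_nonneg_right ?_ hm0
        exact div_le_div_of_nonneg_left hk₀.le (by positivity) (by linarith)
    _ = P.weight t * (k₀ / (2 * W) * (m / P.weight t ^ 2)) := by field_simp
    _ ≤ P.weight t * (k₀ / (2 * W) * min (p ^ 2) (p ^ P.expo)) := by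
        refine mul_le_mul_of_nonneg_left (mul_le_mul_of_nonneg_left hsc (by positivity)) hE0.le
    _ ≤ _ := mul_le_mul_of_nonneg_left hG hE0.le

end DampedEuler
end

noncomputable section
namespace DampedEuler

open MeasureTheory Filter Topology

/-! ### The bound for the lifespan -/

/-- A bound for the potential of the wave equation for the weighted functional. -/
def Params.potBound (P : Params) : ℝ := P.mu * P.lam / 2 + P.mu ^ 2 / 4

theorem Params.potBound_pos (P : Params) : 0 < P.potBound := by
  have := P.mu_pos
  have := P.lam_nonneg
  unfold Params.potBound
  positivity

theorem continuous_const_div_one_add_sq_clamp (b : ℝ) {T₁ : ℝ} (hT₁ : 0 ≤ T₁) :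
    Continuous fun τ => b / (1 + clamp T₁ τ) ^ 2 := by
  have h := continuous_clamp T₁
  refine continuous_const.div (by fun_prop) fun τ => ?_
  have := (clamp_mem (t := τ) hT₁).1
  positivity

theorem integral_clamp_inv_sq_le {b s T₁ : ℝ} (hb : 0 ≤ b) (hs : s ∈ Set.Icc 0 T₁) :
    ∫ τ in (0:ℝ)..s, b / (1 + clamp T₁ τ) ^ 2 ≤ b := by
  refine le_trans (le_of_eq ?_) (integral_inv_sq_le hb hs.1)
  refine intervalIntegral.integral_congr fun τ hτ => ?_
  rw [Set.uIcc_of_le hs.1] at hτ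
  simp only [clamp_eq (⟨hτ.1, hτ.2.trans hs.2⟩ : τ ∈ Set.Icc 0 T₁)]

/-- Once `v` has the floor `a`, the minimum of the two powers may be replaced by a multiple of the
single power `v ^ p`, as required for the iteration. -/
theorem rpow_mul_le_min {a p v : ℝ} (hp : p ≤ 2) (ha : 0 < a) (hav : a ≤ v) :
    min 1 (a ^ (2 - p)) * v ^ p ≤ min (v ^ 2) (v ^ p) := by
  have hv : 0 < v := ha.trans_le hav
  have hvp : 0 ≤ v ^ p := by positivity
  refine le_min ?_ (mul_le_of_le_one_left hvp (min_le_left _ _))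
  refine (mul_le_mul_of_nonneg_right ((min_le_right _ _).trans
    (Real.rpow_le_rpow ha.le hav (by linarith))) hvp).trans (le_of_eq ?_)
  rw [← Real.rpow_add hv, sub_add_cancel, Real.rpow_two]

namespace IsSmoothSolution

variable {d : ℕ} [NeZero d] {P : Params} {ε : ℝ} {ρ₀ : Space d → ℝ} {u₀ : Space d → Space d}
  {T M : ℝ} {ρ : ℝ → Space d → ℝ} {u : ℝ → Space d → Space d}

/-- Combines the three estimates. In the strip of width `2cD` behind the front, `strip_lower_bound`
gives `v ≥ q / 2` plus half the cone integral. The blowup argument runs on the middle half of the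
strip, because `q` vanishes at the front and has no positive lower bound up to it. -/
theorem time_le (S : IsSmoothSolution P ε ρ₀ u₀ T ρ u)
    (hbg : ∀ t ∈ Set.Ico 0 T, ∀ x : Space d,
      M + P.sound * t < ‖x‖ → ρ t x = P.rhoBar ∧ u t x = 0)
    (hlam : 1 ≤ P.lam) (hab : 0 < P.ab) {D : ℝ} (hD : 0 < D)
    (hDK : 4 * (P.potBound * D) ≤ 1) (hDab : P.potBound * D * (1 + 2 * P.potBound) ≤ P.ab)
    (hD1 : 2 * D ≤ 1) (hcD : 2 * P.sound * D ≤ 1) (hMD : 0 < M - 2 * P.sound * D)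
    (hq : ∀ η, M - 2 * P.sound * D < η → η < M → 0 < momP P ρ 0 η)
    (hw : ∀ η, M - 2 * P.sound * D < η → η < M → 3 * P.ab * momP P ρ 0 η ≤ momQ ρ u 0 η)
    (hQM : ∀ η, M ≤ η → momQ ρ u 0 η = 0) {a k : ℝ} (ha : 0 < a)
    (hqa : ∀ η ∈ Set.Icc (M - 3 / 2 * P.sound * D) (M - P.sound * D / 2),
      2 * a ≤ momP P ρ 0 η) (hk : 0 < k)
    (hG : ∀ T₁, T₁ < T → 0 < T₁ → ∀ t ∈ Set.Icc 0 T₁, ∀ ξ, 0 < ξ → M ≤ ξ + 1 →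
      0 < charV P ρ T₁ t ξ → k / (1 + t) * min (charV P ρ T₁ t ξ ^ 2) (charV P ρ T₁ t ξ ^ P.expo)
        ≤ charG P ρ u T₁ t ξ) :
    T ≤ Real.exp (2 * (2 * 4 ^ (1 / (P.expo - 1))
      / (k * min 1 (a ^ (2 - P.expo)) * (D / 4) * a ^ (P.expo - 1)) + D / 4)) := by
  set ℓ := 2 * 4 ^ (1 / (P.expo - 1))
      / (k * min 1 (a ^ (2 - P.expo)) * (D / 4) * a ^ (P.expo - 1)) with hℓ
  have hc := P.sound_pos
  have hcD0 : 0 < P.sound * D := mul_pos hc hD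
  have hmin : 0 < min 1 (a ^ (2 - P.expo)) := lt_min one_pos (by positivity)
  have hℓ0 : 0 < ℓ := by positivity
  by_contra! hlt
  obtain ⟨T₁, hT₁l, hT₁⟩ := exists_between hlt
  have hT₁0 : 0 < T₁ := (Real.exp_pos _).trans hT₁l
  have h0 : clamp T₁ 0 = 0 := clamp_eq ⟨le_rfl, hT₁0.le⟩
  have hq0 : ∀ η, M ≤ η → momP P ρ 0 η = 0 := fun η hη => by
    have := charV_eq_zero (P := P) hbg hT₁ hT₁0 (τ := 0) η hη
    simpa [charV, h0, P.weight_zero] using this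
  have hqnn : ∀ η, M - 2 * P.sound * D < η → 0 ≤ momP P ρ 0 η := fun η hη => by
    rcases lt_or_ge η M with h | h
    · exact (hq η hη h).le
    · exact (hq0 η h).ge
  have hH0 : ∀ τ ∈ Set.Icc 0 T₁, ∀ η, 0 ≤ charG P ρ u T₁ τ η := fun τ hτ η => by
    have hcl : clamp T₁ τ ∈ Set.Icc 0 T₁ := clamp_mem hT₁0.le
    exact mul_nonneg (zero_le_one.trans (P.one_le_weight hlam hcl.1))
      (S.momG_nonneg ⟨hcl.1, hcl.2.trans_lt hT₁⟩ _)
  have hpot := P.continuous_potential_clamp hT₁0.le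
  have hcl0 : ∀ τ, 0 ≤ clamp T₁ τ := fun τ => (clamp_mem hT₁0.le).1
  have hPc := S.continuous_momP_zero hbg hT₁ hT₁0
  have hQc := S.continuous_momQ_zero hbg hT₁ hT₁0
  have hstrip : ∀ t ∈ Set.Icc 0 T₁, ∀ ξ, M - 2 * P.sound * D < ξ →
      1 / 2 * momP P ρ 0 ξ + 1 / 2 * coneIntegral P.sound (charG P ρ u T₁) t ξ
        ≤ charV P ρ T₁ t ξ := by
    intro t ht ξ hξ
    refine strip_lower_bound (V := fun τ => P.potential (clamp T₁ τ)) (q := momP P ρ 0)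
      (w := fun η => momQ ρ u 0 η + P.mu / 2 * momP P ρ 0 η) (K := P.potBound) (β := P.ab)
      hpot hPc (hQc.add (continuous_const.mul hPc)) (S.continuous_charV hbg hT₁ hT₁0)
      (S.continuous_charG hbg hT₁ hT₁0) hc hD.le P.potBound_pos.le ?_ ?_ ?_ hq0 ?_ hH0 hqnn ?_
      hab.le hDK hDab hD1 ?_ ht hξ
    · intro s hs
      refine le_trans ?_ (integral_clamp_inv_sq_le P.potBound_pos.le hs)
      exact intervalIntegral.integral_mono_on hs.1 (hpot.abs.intervalIntegrable _ _)
        ((continuous_const_div_one_add_sq_clamp _ hT₁0.le).intervalIntegrable _ _)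
        fun τ _ => P.abs_potential_le hlam (hcl0 τ)
    · intro s hs
      refine le_trans ?_ (integral_clamp_inv_sq_le hab.le hs)
      exact intervalIntegral.integral_mono_on hs.1 (hpot.intervalIntegrable _ _)
        ((continuous_const_div_one_add_sq_clamp _ hT₁0.le).intervalIntegrable _ _)
        fun τ _ => P.potential_le hlam (hcl0 τ)
    · intro s _
      refine (P.abs_potential_le hlam (hcl0 s)).trans (div_le_self P.potBound_pos.le ?_)
      exact one_le_pow₀ (by linarith [hcl0 s])
    · exact fun τ _ η hη => charV_eq_zero hbg hT₁ hT₁0 η hη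
    · intro η hη
      have hmu := mul_nonneg (by linarith [P.mu_pos] : 0 ≤ P.mu / 2) (hqnn η hη)
      rcases lt_or_ge η M with h | h
      · linarith [hw η hη h]
      · rw [hQM η h, hq0 η h]; simp
    · exact fun t ht ξ => S.charV_eq hbg hT₁ hT₁0 ht ξ
  have hcone : ∀ t ∈ Set.Icc 0 T₁, ∀ ξ, 0 ≤ coneIntegral P.sound (charG P ρ u T₁) t ξ := by
    intro t ht ξ
    have := coneIntegral_mono (S.continuous_charG hbg hT₁ hT₁0) (c := P.sound) (ξ := ξ)
      le_rfl le_rfl (by linarith [ht.1] : (0:ℝ) + 0 ≤ t) ht.2 hH0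
    simpa [coneIntegral] using this
  have hsub : ∀ ξ ∈ Set.Icc (M - 3 / 2 * P.sound * D)
      (M - 3 / 2 * P.sound * D + 4 * P.sound * (D / 4)),
      ξ ∈ Set.Icc (M - 3 / 2 * P.sound * D) (M - P.sound * D / 2) := fun ξ hξ =>
    ⟨hξ.1, hξ.2.trans (by linarith)⟩
  have hva : ∀ t ∈ Set.Icc 0 T₁, ∀ ξ ∈ Set.Icc (M - 3 / 2 * P.sound * D)
      (M - 3 / 2 * P.sound * D + 4 * P.sound * (D / 4)), a ≤ charV P ρ T₁ t ξ := by
    intro t ht ξ hξ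
    have h1 := hqa ξ (hsub ξ hξ)
    have h2 := hstrip t ht ξ (by linarith [hξ.1])
    linarith [hcone t ht ξ]
  -- The choice `d = D / 4` makes the interval of length `4cd = cD` end at `M - cD/2`; `ℓ` is
  -- defined so that the largeness condition holds with equality.
  have hfin := blowup_time_lt (v := charV P ρ T₁) (H := charG P ρ u T₁)
    (ξ₁ := M - 3 / 2 * P.sound * D) (d := D / 4) (k := k * min 1 (a ^ (2 - P.expo)))
    (p := P.expo) (a₀ := a) (ℓ := ℓ) (T := T₁) (S.continuous_charG hbg hT₁ hT₁0) hc
    (by positivity) (by positivity) P.one_lt_expo ha hℓ0 (le_of_eq ?_) hH0 hva ?_ ?_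
  · linarith
  · rw [hℓ]; field_simp
  · intro t ht ξ hξ
    have h1 := hqa ξ (hsub ξ hξ)
    have h2 := hstrip t ht ξ (by linarith [hξ.1])
    linarith
  · intro t ht ξ hξ
    have h1 := hva t ht ξ hξ
    refine le_trans ?_ (hG T₁ hT₁ hT₁0 t ht ξ (by linarith [hξ.1]) (by linarith [hξ.1])
      (ha.trans_le h1))
    have h3 := rpow_mul_le_min P.expo_le_two ha h1
    have ht1 : 0 < 1 + t := by linarith [ht.1]
    refine le_trans (le_of_eq ?_) (mul_le_mul_of_nonneg_left h3 (by positivity : 0 ≤ k / (1 + t)))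
    ring

end IsSmoothSolution

/-! ### Initial data and dependence on `ε`. -/

section InitialMoments

variable {d : ℕ} [NeZero d]

/-- The second moment of `ρ₀` in the half-space `x₁ > l`. -/
def initMoment (ρ₀ : Space d → ℝ) (l : ℝ) : ℝ := ∫ x : Space d, pos2 (x 0 - l) * ρ₀ x

theorem continuous_initMoment {ρ₀ : Space d → ℝ} (hρ₀ : Continuous ρ₀) {M : ℝ}
    (hs : tsupport ρ₀ ⊆ Metric.closedBall 0 M) : Continuous (initMoment ρ₀) := by
  have h := continuous_moment continuous_pos2.measurable (fun _ _ => continuous_pos2.continuousAt)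
    abs_pos2_bound (f := fun _ : ℝ => ρ₀) (isCompact_closedBall (0 : Space d) M)
    (hρ₀.comp continuous_snd)
    (fun _ y hy => image_eq_zero_of_notMem_tsupport fun h => hy (hs h))
  exact h.comp (Continuous.prodMk_right (0:ℝ))

theorem measurableSet_halfSpace (l : ℝ) : MeasurableSet {x : Space d | l < x 0} :=
  (isOpen_lt continuous_const (by fun_prop : Continuous fun x : Space d => x 0)).measurableSet

theorem q0_eq (P : Params) (ε : ℝ) (ρ₀ : Space d → ℝ) (l : ℝ) :
    q0 P ε ρ₀ l = ε * initMoment ρ₀ l := by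
  unfold q0 initMoment
  rw [← integral_indicator (measurableSet_halfSpace l), ← integral_const_mul]
  congr 1; funext x
  by_cases h : l < x 0
  · rw [Set.indicator_of_mem (show x ∈ {x : Space d | l < x 0} from h),
      pos2_of_nonneg (by linarith)]
    unfold initDensity; ring
  · rw [Set.indicator_of_notMem (show x ∉ {x : Space d | l < x 0} from h),
      pos2_of_nonpos (by linarith)]
    ring

variable {P : Params} {ε : ℝ} {ρ₀ : Space d → ℝ} {u₀ : Space d → Space d} {T : ℝ}
  {ρ : ℝ → Space d → ℝ} {u : ℝ → Space d → Space d}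

namespace IsSmoothSolution

theorem momP_zero (S : IsSmoothSolution P ε ρ₀ u₀ T ρ u) (l : ℝ) :
    momP P ρ 0 l = ε * initMoment ρ₀ l := by
  unfold momP initMoment
  rw [← integral_const_mul]
  congr 1; funext x
  rw [S.init_density]; unfold initDensity; ring

theorem momQ_zero (S : IsSmoothSolution P ε ρ₀ u₀ T ρ u) (l : ℝ) :
    momQ ρ u 0 l = q1 P ε ρ₀ u₀ l := by
  unfold momQ q1
  rw [← integral_indicator (measurableSet_halfSpace l), ← integral_const_mul]
  congr 1; funext x
  rw [S.init_density, S.init_velocity]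
  by_cases h : l < x 0
  · rw [Set.indicator_of_mem (show x ∈ {x : Space d | l < x 0} from h),
      pos1_of_nonneg (by linarith)]
    ring
  · rw [Set.indicator_of_notMem (show x ∉ {x : Space d | l < x 0} from h),
      pos1_of_nonpos (by linarith)]
    ring

end IsSmoothSolution

theorem q1_eq_zero (P : Params) (ε : ℝ) (ρ₀ : Space d → ℝ) {u₀ : Space d → Space d} {M l : ℝ}
    (hs : tsupport u₀ ⊆ Metric.closedBall 0 M) (hl : M ≤ l) : q1 P ε ρ₀ u₀ l = 0 := by
  unfold q1
  rw [setIntegral_eq_zero_of_forall_eq_zero, mul_zero]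
  intro x hx
  have hx : l < x 0 := hx
  have h1 := (le_abs_self _).trans (abs_coord_le x 0)
  have h2 : u₀ x = 0 := image_eq_zero_of_notMem_tsupport fun h => by
    have := hs h
    rw [mem_closedBall_zero_iff] at this
    linarith
  simp [initVelocity, h2]

end InitialMoments

theorem lifespan_le {d : ℕ} {P : Params} {ε L : ℝ} {ρ₀ : Space d → ℝ} {u₀ : Space d → Space d}
    (h : ∀ T ρ u, IsSmoothSolution P ε ρ₀ u₀ T ρ u → T ≤ L) :
    lifespan P ε ρ₀ u₀ ≤ ENNReal.ofReal L := by
  refine sSup_le ?_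
  rintro _ ⟨T, _, rfl, ρ, u, S⟩
  exact ENNReal.ofReal_le_ofReal (h T ρ u S)

theorem exists_strip_width (P : Params) (hab : 0 < P.ab) {M M₀ : ℝ} (hM : 0 < M) (hM₀ : M₀ < M) :
    ∃ D > 0, 4 * (P.potBound * D) ≤ 1 ∧ P.potBound * D * (1 + 2 * P.potBound) ≤ P.ab ∧
      2 * D ≤ 1 ∧ 2 * P.sound * D ≤ 1 ∧ 2 * P.sound * D ≤ M / 2 ∧ 2 * P.sound * D ≤ M - M₀ := by
  have hc := P.sound_pos
  have hK := P.potBound_pos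
  set K := P.potBound
  set m := min (min 1 P.ab) (min (M / 2) (M - M₀)) with hm
  have hm0 : 0 < m := lt_min (lt_min one_pos hab) (lt_min (by linarith) (by linarith))
  have hm1 : m ≤ 1 := (min_le_left _ _).trans (min_le_left _ _)
  have hm2 : m ≤ P.ab := (min_le_left _ _).trans (min_le_right _ _)
  have hm3 : m ≤ M / 2 := (min_le_right _ _).trans (min_le_left _ _)
  have hm4 : m ≤ M - M₀ := (min_le_right _ _).trans (min_le_right _ _)
  -- The sum of all coefficients with which `D` enters the required inequalities; `D = m / s` then
  -- satisfies them simultaneously.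
  set s := 2 * P.sound + 4 * K + K * (1 + 2 * K) + 2 with hs
  have hs0 : 0 < s := by positivity
  have hK2 : 0 < K * (1 + 2 * K) := by positivity
  set D := m / s with hD
  have hD0 : 0 < D := by positivity
  have hsD : s * D = m := mul_div_cancel₀ _ hs0.ne'
  have key : ∀ r, r ≤ s → r * D ≤ m := fun r hr =>
    (mul_le_mul_of_nonneg_right hr hD0.le).trans hsD.le
  have k1 := key (4 * K) (by linarith)
  have k2 := key (K * (1 + 2 * K)) (by linarith)
  have k3 := key 2 (by linarith)
  have k4 := key (2 * P.sound) (by linarith)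
  refine ⟨D, hD0, ?_, ?_, ?_, ?_, ?_, ?_⟩ <;> linarith

end DampedEuler
end

/-! ### The lifespan estimate. -/

theorem theorem1p3 (d : ℕ) [NeZero d] (P : DampedEuler.Params)
    (hcase : (P.lam = 1 ∧ P.mu ≤ 1 ∧ d = 2) ∨ (1 < P.lam ∧ (d = 2 ∨ d = 3)))
    (δ₀ : ℝ) (hδ₀ : P.IsDelta δ₀)
    (ρ₀ : DampedEuler.Space d → ℝ) (u₀ : DampedEuler.Space d → DampedEuler.Space d)
    (hρ₀ : ContDiff ℝ ∞ ρ₀) (hu₀ : ContDiff ℝ ∞ u₀)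
    (M M' M₀ Λ : ℝ) (hM'_nonneg : 0 ≤ M') (hM' : M' < M)
    (hρ₀_supp : tsupport ρ₀ ⊆ Metric.closedBall 0 M)
    (hu₀_supp : tsupport u₀ ⊆ Metric.closedBall 0 M)
    (hM₀_lower : max M' (M - δ₀) ≤ M₀) (hM₀ : M₀ < M) (hΛ : 3 * P.ab ≤ Λ) :
    ∃ ε₀ > 0, ∃ C > 0, ∀ ε : ℝ, 0 < ε → ε ≤ ε₀ →
      (∀ l ∈ Set.Ioo M' M, 0 < DampedEuler.q0 P ε ρ₀ l) →
      (∀ l ∈ Set.Ioo M' M, 0 ≤ DampedEuler.q1 P ε ρ₀ u₀ l) →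
      (∀ l ∈ Set.Ioo M₀ M, Λ * DampedEuler.q0 P ε ρ₀ l ≤ DampedEuler.q1 P ε ρ₀ u₀ l) →
      DampedEuler.lifespan P ε ρ₀ u₀ < ⊤ ∧
        (P.γ = 2 → DampedEuler.lifespan P ε ρ₀ u₀ ≤ ENNReal.ofReal (Real.exp (C / ε ^ 2))) := by
  have hM : 0 < M := hM'_nonneg.trans_lt hM'
  have hM'₀ : M' ≤ M₀ := (le_max_left _ _).trans hM₀_lower
  -- As `q₀` is exactly `ε` times the moment of `ρ₀`, its positivity is independent of `ε > 0`. If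
  -- it fails, no `ε` satisfies the hypotheses; otherwise the constants below can be chosen from
  -- `ρ₀` alone.
  by_cases hQ : ∀ l ∈ Set.Ioo M' M, 0 < DampedEuler.initMoment ρ₀ l
  swap
  · refine ⟨1, one_pos, 1, one_pos, fun ε hε _ h => absurd (fun l hl => ?_) hQ⟩
    have := h l hl
    rw [DampedEuler.q0_eq] at this
    exact pos_of_mul_pos_right this hε.le
  have hab : 0 < P.ab := P.ab_pos (hcase.imp (fun h => ⟨h.1, h.2.1⟩) And.left)
  have hlam : 1 ≤ P.lam := by rcases hcase with h | h <;> linarith [h.1]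
  obtain ⟨D, hD, hDK, hDab, hD1, hcD, hcM, hcM₀⟩ := DampedEuler.exists_strip_width P hab hM hM₀
  have hcD0 : 0 < P.sound * D := mul_pos P.sound_pos hD
  obtain ⟨k, hk, hG⟩ := DampedEuler.exists_charG_ge (d := d) P hcase hM
  -- A positive minimum over a compact part of the strip, independent of `ε`; the floor used for `v`
  -- is `a = ε m / 2`.
  obtain ⟨m, hm, hmQ⟩ : ∃ m > 0, ∀ η ∈ Set.Icc (M - 3 / 2 * P.sound * D) (M - P.sound * D / 2),
      m ≤ DampedEuler.initMoment ρ₀ η := by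
    obtain ⟨η₀, h₀, hmin⟩ := (isCompact_Icc (a := M - 3 / 2 * P.sound * D)
      (b := M - P.sound * D / 2)).exists_isMinOn ⟨_, Set.left_mem_Icc.2 (by linarith)⟩
      (DampedEuler.continuous_initMoment hρ₀.continuous hρ₀_supp).continuousOn
    exact ⟨_, hQ η₀ ⟨by linarith [h₀.1], by linarith [h₀.2]⟩, fun η hη => hmin hη⟩
  set bound : ℝ → ℝ := fun ε => 2 * (2 * 4 ^ (1 / (P.expo - 1))
      / (k * min 1 ((ε * m / 2) ^ (2 - P.expo)) * (D / 4) * (ε * m / 2) ^ (P.expo - 1)) + D / 4)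
    with hbound
  have hlife : ∀ ε : ℝ, 0 < ε →
      (∀ l ∈ Set.Ioo M' M, 0 < DampedEuler.q0 P ε ρ₀ l) →
      (∀ l ∈ Set.Ioo M₀ M, Λ * DampedEuler.q0 P ε ρ₀ l ≤ DampedEuler.q1 P ε ρ₀ u₀ l) →
      DampedEuler.lifespan P ε ρ₀ u₀ ≤ ENNReal.ofReal (Real.exp (bound ε)) := by
    intro ε hε hq0 hq1
    refine DampedEuler.lifespan_le fun T ρ u S => ?_
    have hbg : ∀ t ∈ Set.Ico 0 T, ∀ x : DampedEuler.Space d, M + P.sound * t < ‖x‖ →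
        ρ t x = P.rhoBar ∧ u t x = 0 := fun t ht x hx => S.eq_background hρ₀_supp hu₀_supp ht hx
    have hP : ∀ η, DampedEuler.momP P ρ 0 η = DampedEuler.q0 P ε ρ₀ η := fun η => by rw [S.momP_zero, DampedEuler.q0_eq]
    refine S.time_le hbg hlam hab hD hDK hDab hD1 hcD (by linarith) ?_ ?_ ?_ (by positivity) ?_ hk
      (fun T₁ hT₁ hT₁0 => hG ε ρ₀ u₀ T T₁ ρ u S hbg hT₁ hT₁0)
    · intro η h1 h2
      rw [hP]; exact hq0 η ⟨by linarith, h2⟩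
    · intro η h1 h2
      rw [hP, S.momQ_zero]
      exact (mul_le_mul_of_nonneg_right hΛ (hq0 η ⟨by linarith, h2⟩).le).trans
        (hq1 η ⟨by linarith, h2⟩)
    · intro η h
      rw [S.momQ_zero, DampedEuler.q1_eq_zero P ε ρ₀ hu₀_supp h]
    · intro η hη
      rw [S.momP_zero]
      linarith [mul_le_mul_of_nonneg_left (hmQ η hη) hε.le]
  -- For `γ = 2` the exponent is `(32 / (k (D/4) m)) / ε + D/2`, of order `1/ε`. For `ε ≤ 1` it is
  -- bounded by `C / ε²`, and `C` is twice the sum of the two coefficients.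
  refine ⟨1, one_pos, 64 / (k * (D / 4) * m) + D, by positivity,
    fun ε hε hε1 hq0 _ hq1 => ⟨(hlife ε hε hq0 hq1).trans_lt ENNReal.ofReal_lt_top, fun hγ => ?_⟩⟩
  refine (hlife ε hε hq0 hq1).trans (ENNReal.ofReal_le_ofReal (Real.exp_le_exp.2 ?_))
  have hp : P.expo = 2 := by rw [DampedEuler.Params.expo, hγ, min_self]
  have h1 : bound ε = 32 / (k * (D / 4) * m) / ε + D / 2 := by
    simp only [hbound, hp]
    norm_num
    field_simp
    norm_num
  rw [h1, le_div_iff₀ (by positivity)]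
  have h2 : 0 < 32 / (k * (D / 4) * m) := by positivity
  have h3 : ε ^ 2 ≤ 1 := pow_le_one₀ hε.le hε1
  have h4 : 32 / (k * (D / 4) * m) / ε * ε ^ 2 ≤ 32 / (k * (D / 4) * m) := by
    rw [sq, ← mul_assoc, div_mul_cancel₀ _ hε.ne']
    exact mul_le_of_le_one_right h2.le hε1
  have h5 : D / 2 * ε ^ 2 ≤ D / 2 := mul_le_of_le_one_right (by positivity) h3
  have h6 : 64 / (k * (D / 4) * m) = 2 * (32 / (k * (D / 4) * m)) := by ring
  rw [h6]
  linarith
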